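/- Let $Q$ be a closed (compact, without boundary), connected, oriented smooth manifold of dimension $n$, let $q\in Q$, and let $[Q]\in H_n(Q;\mathbb Z)$ be its fundamental class. Notation: * For a space $X$, $C_*(X)$ is the complex of singular cubical chains $\sigma\colon[0,1]^i\to X$ with integer coefficients, modulo the degenerate cubes (those which do not depend on some coordinate), with $\partial\sigma=\sum_{k=1}^{i}\sum_{\epsilon=0,1}(-1)^{k+\epsilon}\,\sigma|_{t_k=\epsilon}$. The quotient $C^{\square}_*(X)$ of $C_*(X)$ is by the subcomplexes spanned by (i) all $\sigma_1+\sigma_2-\sigma$, where $\sigma$ is a cube of dimension $i\ge 1$, $f\colon[0,1]^{i-1}\to[0,1]$ is continuous, $\sigma_1(t,u)=\sigma(t,f(t)u)$ and $\sigma_2(t,u)=\sigma(t,f(t)+(1-f(t))u)$; (ii) all $\sigma+\sigma\circ\phi_k$, where $\phi_k$ exchanges the $k$-th and $(k+1)$-st coordinates. * $\mathcal LQ=\operatorname{Map}(\mathbb R/\mathbb Z,Q)\times[0,\infty)$ is the space of free Moore loops; the second component is the length $\ell$ of the loop, which is then parametrised by $[0,\ell]$. $\Omega_qQ\subset\mathcal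 LQ$ is the subspace of loops of positive length based at $q$, with inclusion $\iota$, and $\alpha\cdot\beta$ is the concatenation ($\alpha$ first). For $\alpha,\beta\in\Omega_qQ$ and $t\in[0,1]$, $\alpha\#_t\beta\in\mathcal LQ$ is $\alpha\cdot\beta$ with its starting point moved to the point of $\alpha$ at time $t\ell(\alpha)$. * $\mathcal A=C_{-*}(\Omega_qQ)$, graded by $|\sigma|=-\dim\sigma$, is the $A_\infty$-algebra with $\mu_1\sigma=\partial\sigma$, $\mu_2(\sigma_2,\sigma_1)=(-1)^{|\sigma_1|}\sigma_1\cdot\sigma_2$ and $\mu_j=0$ for $j\ge 3$. Its cyclic bar complex is $CC_*(\mathcal A)=\bigoplus_{d\ge1}\mathcal A\otimes(\mathcal A[1])^{\otimes(d-1)}$, with differential $$b(a_d\otimes\cdots\otimes a_1)=\sum_{\substack{i\ge 0,\ j\ge 1\\ i+j<d}}(-1)^{m_1^{i}}a_d\otimes\cdots\otimes\mu_j(a_{i+j},\dots,a_{i+1})\otimes a_i\otimes\cdots\otimes a_1$$ $$\qquad+\sum_{\substack{i,j\ge 0\\ i+j<d}}(-1)^{m_1^{i}(1+m_{i+1}^{d})+m_{i+j+1}^{d-1}+m_{i+1}^{i+j}+1}\,\mu_{d-j}(a_i,\dots,a_1,a_d,\dots,a_{i+j+1})\otimes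 a_{i+j}\otimes\cdots\otimes a_{i+1},$$ where $m_r^s=\sum_{k=r}^s(|a_k|+1)$. Its homology is $HH_*(\mathcal A)$, graded cohomologically. * $\mathcal G\colon CC_*(\mathcal A)\to C^{\square}_{-*}(\mathcal LQ)$ is the chain map with $\mathcal G(\sigma)=(-1)^{|\sigma|}\iota_*\sigma$ on words of length $1$, $\mathcal G(\sigma_2\otimes\sigma_1)=-\,\sigma_1\veebar\sigma_2$ on words of length $2$, where, for $i=\dim\sigma_1$ and $j=\dim\sigma_2$, $(\sigma_1\veebar\sigma_2)(t_1,\dots,t_{i+j+1})=\sigma_1(t_1,\dots,t_i)\,\#_{t_{i+j+1}}\,\sigma_2(t_{i+1},\dots,t_{i+j})$, and $\mathcal G=0$ on longer words. Let $H_{-*}(\mathcal LQ)$ denote the homology of $C^{\square}_{-*}(\mathcal LQ)$, the model for the homology of $\mathcal LQ$ in which $\mathcal G$ takes its values, and $H(\mathcal G)\colon HH_*(\mathcal A)\to H_{-*}(\mathcal LQ)$ the induced map. Then the image of $[Q]$ under the map $H_n(Q)\to H_n(\mathcal LQ)$ induced by the inclusion of $Q$ as the constant loops (of length $0$) lies in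 the image of $H(\mathcal G)\colon HH_{-n}(C_{-*}(\Omega_qQ))\to H_n(\mathcal LQ)$. -/

import Mathlib

open scoped Manifold ContDiff NNReal

namespace LoopHochschild

universe u

local notation "𝕀" => unitInterval

noncomputable section

/-! ### Homology of a graded module with a differential of degree `-1` -/

section Homology

variable {M N P : Type*} [AddCommGroup M] [AddCommGroup N] [AddCommGroup P]

/-- Degree `n` cycles. -/
abbrev cycles (gr : ℕ → Submodule ℤ M) (d : M →ₗ[ℤ] M) (n : ℕ) : Submodule ℤ M :=
  gr n ⊓ LinearMap.ker d

/-- Degree `n` boundaries. -/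
abbrev boundaries (gr : ℕ → Submodule ℤ M) (d : M →ₗ[ℤ] M) (n : ℕ) : Submodule ℤ M :=
  (gr (n + 1)).map d

/-- Degree `n` homology: cycles modulo boundaries. -/
abbrev Homology (gr : ℕ → Submodule ℤ M) (d : M →ₗ[ℤ] M) (n : ℕ) : Type _ :=
  ↥(cycles gr d n) ⧸ (boundaries gr d n).comap (cycles gr d n).subtype

/-- The map induced on degree `n` homology by a degree preserving chain map. -/
def homologyMap {gr : ℕ → Submodule ℤ M} {d : M →ₗ[ℤ] M}
    {gr' : ℕ → Submodule ℤ N} {d' : N →ₗ[ℤ] N} (f : M →ₗ[ℤ] N)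
    (hgr : ∀ n, gr n ≤ (gr' n).comap f) (hd : f ∘ₗ d = d' ∘ₗ f) (n : ℕ) :
    Homology gr d n →ₗ[ℤ] Homology gr' d' n :=
  Submodule.mapQ _ _
    (f.restrict (p := cycles gr d n) (q := cycles gr' d' n) (by
      rintro x ⟨hx, hx'⟩
      refine ⟨hgr n hx, ?_⟩
      have := LinearMap.congr_fun hd x
      simp only [LinearMap.comp_apply] at this
      change d' (f x) = 0
      have hx' : d x = 0 := hx'
      rw [← this, hx', map_zero]))
    (by
      rintro ⟨x, hx⟩ ⟨y, hy, hyx⟩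
      refine ⟨f y, hgr (n + 1) hy, ?_⟩
      have := LinearMap.congr_fun hd y
      simp only [LinearMap.comp_apply] at this
      rw [← this, hyx]
      rfl)

end Homology

/-! ### Cubical chains -/

section Cubes

/-- Singular cubes of `X` of all dimensions. -/
abbrev Cube (X : Type u) [TopologicalSpace X] : Type u := Σ n : ℕ, C(Fin n → 𝕀, X)

variable {X Y : Type u} [TopologicalSpace X] [TopologicalSpace Y]

/-- The free abelian group on all singular cubes. -/
abbrev FreeChains (X : Type u) [TopologicalSpace X] : Type u := Cube X →₀ ℤ

/-- The face of a cube where the `k`-th coordinate is constant and equal to `ε`. -/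
def face {n : ℕ} (σ : C(Fin (n + 1) → 𝕀, X)) (k : Fin (n + 1)) (ε : 𝕀) : C(Fin n → 𝕀, X) where
  toFun t := σ (k.insertNth ε t)
  continuous_toFun := σ.continuous.comp
    (Continuous.finInsertNth (A := fun _ => 𝕀) k continuous_const continuous_id)

/-- The cubical boundary of a cube. The coordinates are numbered from `0`, so that the sign of the
face `t_k = ε` is `(-1) ^ (k + 1 + ε)`. -/
def cubeBoundary : Cube X → FreeChains X
  | ⟨0, _⟩ => 0
  | ⟨n + 1, σ⟩ => ∑ k : Fin (n + 1), (-1 : ℤ) ^ (k : ℕ) •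
      (Finsupp.single ⟨n, face σ k 1⟩ 1 - Finsupp.single ⟨n, face σ k 0⟩ 1)

/-- The boundary operator on the free abelian group on cubes. -/
def freeBoundary (X : Type u) [TopologicalSpace X] : FreeChains X →ₗ[ℤ] FreeChains X :=
  Finsupp.linearCombination ℤ cubeBoundary

/-- A cube is degenerate if it factors through the projection which forgets some coordinate. -/
def IsDegenerate (σ : Cube X) : Prop :=
  ∃ k : Fin σ.1, ∀ (t : Fin σ.1 → 𝕀) (x : 𝕀), σ.2 (Function.update t k x) = σ.2 t

/-- The span of the degenerate cubes. -/
def degenerate (X : Type u) [TopologicalSpace X] : Submodule ℤ (FreeChains X) :=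
  Submodule.span ℤ {c | ∃ σ : Cube X, IsDegenerate σ ∧ c = Finsupp.single σ 1}

/-- The half of the cube `σ` below the graph of `f`. -/
def lowerHalf {m : ℕ} (σ : C(Fin (m + 1) → 𝕀, X)) (f : C(Fin m → 𝕀, 𝕀)) :
    C(Fin (m + 1) → 𝕀, X) where
  toFun t := σ (Fin.snoc (α := fun _ => 𝕀) (Fin.init t) (f (Fin.init t) * t (Fin.last m)))
  continuous_toFun := by
    have h : Continuous fun t : Fin (m + 1) → 𝕀 => (Fin.init t : Fin m → 𝕀) :=
      continuous_pi fun i => continuous_apply _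
    exact σ.continuous.comp (Continuous.finSnoc (A := fun _ => 𝕀) h
      ((f.continuous.comp h).mul (continuous_apply _)))

/-- The half of the cube `σ` above the graph of `f`; its last coordinate `u` is sent to
`f + (1 - f) u = 1 - (1 - f) (1 - u)`. -/
def upperHalf {m : ℕ} (σ : C(Fin (m + 1) → 𝕀, X)) (f : C(Fin m → 𝕀, 𝕀)) :
    C(Fin (m + 1) → 𝕀, X) where
  toFun t := σ (Fin.snoc (α := fun _ => 𝕀) (Fin.init t)
    (unitInterval.symm (unitInterval.symm (f (Fin.init t)) *
      unitInterval.symm (t (Fin.last m)))))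
  continuous_toFun := by
    have h : Continuous fun t : Fin (m + 1) → 𝕀 => (Fin.init t : Fin m → 𝕀) :=
      continuous_pi fun i => continuous_apply _
    exact σ.continuous.comp (Continuous.finSnoc (A := fun _ => 𝕀) h
      (unitInterval.continuous_symm.comp
        ((unitInterval.continuous_symm.comp (f.continuous.comp h)).mul
          (unitInterval.continuous_symm.comp (continuous_apply _)))))

/-- The span of all `σ₁ + σ₂ - σ₁ #_f σ₂` where `σ₁` and `σ₂` fit together along the last
coordinate and `σ₁ #_f σ₂` is their concatenation along the graph of `f`: such a triple is the same
as a cube `σ = σ₁ #_f σ₂` together with its two halves. -/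
def fitting (X : Type u) [TopologicalSpace X] : Submodule ℤ (FreeChains X) :=
  Submodule.span ℤ {c | ∃ (m : ℕ) (σ : C(Fin (m + 1) → 𝕀, X)) (f : C(Fin m → 𝕀, 𝕀)),
    c = Finsupp.single ⟨m + 1, lowerHalf σ f⟩ 1 + Finsupp.single ⟨m + 1, upperHalf σ f⟩ 1 -
      Finsupp.single ⟨m + 1, σ⟩ 1}

/-- The cube `σ` with its `k`-th and `(k+1)`-st coordinates exchanged. -/
def swapCube {m : ℕ} (σ : C(Fin (m + 1) → 𝕀, X)) (k : Fin m) : C(Fin (m + 1) → 𝕀, X) where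
  toFun t := σ (t ∘ Equiv.swap k.castSucc k.succ)
  continuous_toFun := σ.continuous.comp (continuous_pi fun _ => continuous_apply _)

/-- The span of all `σ + σ ∘ φ_k`, where `φ_k` is an adjacent transposition of coordinates. -/
def permuting (X : Type u) [TopologicalSpace X] : Submodule ℤ (FreeChains X) :=
  Submodule.span ℤ {c | ∃ (m : ℕ) (σ : C(Fin (m + 1) → 𝕀, X)) (k : Fin m),
    c = Finsupp.single ⟨m + 1, σ⟩ 1 + Finsupp.single ⟨m + 1, swapCube σ k⟩ 1}

/-- The relations of the model `C^□` for chains. -/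
def relations (X : Type u) [TopologicalSpace X] : Submodule ℤ (FreeChains X) :=
  degenerate X ⊔ (fitting X ⊔ permuting X)

/-! Auxiliary description of cubes through infinite sequences of coordinates, which is used only to
prove that the operators below are well defined. -/

def ev (σ : Cube X) (t : ℕ → 𝕀) : X := σ.2 fun i => t i

theorem cube_ext {σ τ : Cube X} (h : σ.1 = τ.1) (h' : ∀ t, ev σ t = ev τ t) : σ = τ := by
  obtain ⟨n, σ⟩ := σ
  obtain ⟨m, τ⟩ := τ
  obtain rfl : n = m := h
  congr 1
  ext t
  have := h' fun i => if h : i < n then t ⟨i, h⟩ else 0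
  simpa [ev] using this

theorem ev_congr (σ : Cube X) {s t : ℕ → 𝕀} (h : ∀ i < σ.1, s i = t i) : ev σ s = ev σ t := by
  unfold ev
  congr 1
  ext i
  rw [h i i.2]

def ins (k : ℕ) (ε : 𝕀) (t : ℕ → 𝕀) : ℕ → 𝕀 :=
  fun i => if i < k then t i else if i = k then ε else t (i - 1)

theorem ev_face {n : ℕ} (σ : C(Fin (n + 1) → 𝕀, X)) (k : Fin (n + 1)) (ε : 𝕀) (t : ℕ → 𝕀) :
    ev ⟨n, face σ k ε⟩ t = ev ⟨n + 1, σ⟩ (ins k ε t) := by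
  simp only [ev, face, ContinuousMap.coe_mk]
  congr 1
  refine funext fun i => ?_
  rcases Fin.eq_self_or_eq_succAbove k i with rfl | ⟨j, rfl⟩
  · simp [ins]
  · rw [Fin.insertNth_apply_succAbove]
    by_cases hj : j.castSucc < k
    · rw [Fin.succAbove_of_castSucc_lt _ _ hj]
      have : (j : ℕ) < k := hj
      simp [ins, this]
    · rw [Fin.succAbove_of_le_castSucc _ _ (not_lt.mp hj)]
      have : (k : ℕ) ≤ j := not_lt.mp hj
      have h1 : ¬ ((j : ℕ) + 1 < k) := by omega
      have h2 : ¬ ((j : ℕ) + 1 = k) := by omega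
      simp [ins, h1, h2]

/-- The face `t_k = ε` of a cube of unspecified dimension. -/
def fc (σ : Cube X) (k : ℕ) (ε : 𝕀) : Cube X :=
  ⟨σ.1 - 1, ⟨fun t => ev σ (ins k ε fun i => if h : i < σ.1 - 1 then t ⟨i, h⟩ else 0), by
    refine σ.2.continuous.comp (continuous_pi fun i => ?_)
    unfold ins
    have : ∀ j : ℕ, Continuous fun t : Fin (σ.1 - 1) → 𝕀 =>
        if h : j < σ.1 - 1 then t ⟨j, h⟩ else 0 := by
      intro j
      split_ifs
      · exact continuous_apply _
      · exact continuous_const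
    split_ifs
    · exact this _
    · exact continuous_const
    · exact this _⟩⟩

theorem ev_fc (σ : Cube X) {k : ℕ} (hk : k < σ.1) (ε : 𝕀) (t : ℕ → 𝕀) :
    ev (fc σ k ε) t = ev σ (ins k ε t) := by
  change ev σ _ = _
  refine ev_congr σ fun i hi => ?_
  have h1 : i < k → i < σ.1 - 1 := by omega
  have h2 : ¬ i < k → ¬ i = k → i - 1 < σ.1 - 1 := by omega
  by_cases h : i < k
  · simp [ins, h, h1 h]
  · by_cases h' : i = k
    · simp [ins, h']
    · simp [ins, h, h', h2 h h']

theorem cubeBoundary_eq (σ : Cube X) : cubeBoundary σ = ∑ k ∈ Finset.range σ.1,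
    (-1 : ℤ) ^ k • (Finsupp.single (fc σ k 1) 1 - Finsupp.single (fc σ k 0) 1) := by
  obtain ⟨n, σ⟩ := σ
  cases n with
  | zero => simp [cubeBoundary]
  | succ n =>
    rw [cubeBoundary, Finset.sum_range]
    refine Finset.sum_congr rfl fun k _ => ?_
    have h : ∀ ε, (⟨n, face σ k ε⟩ : Cube X) = fc ⟨n + 1, σ⟩ k ε := fun ε =>
      cube_ext rfl fun t => by rw [ev_face, ev_fc _ k.2]
    rw [h, h]

theorem isDegenerate_iff (σ : Cube X) :
    IsDegenerate σ ↔ ∃ k < σ.1, ∀ t x, ev σ (Function.update t k x) = ev σ t := by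
  constructor
  · rintro ⟨k, hk⟩
    refine ⟨k, k.2, fun t x => ?_⟩
    refine Eq.trans ?_ (hk (fun i => t i) x)
    unfold ev
    congr 1
    ext i
    by_cases h : i = k
    · subst h; simp
    · have : (i : ℕ) ≠ k := fun h' => h (Fin.ext h')
      simp [h, this]
  · rintro ⟨k, hk, h⟩
    refine ⟨⟨k, hk⟩, fun t x => ?_⟩
    have := h (fun i => if h : i < σ.1 then t ⟨i, h⟩ else 0) x
    simp only [ev] at this
    convert this using 2
    · ext i
      by_cases h : i = ⟨k, hk⟩
      · subst h; simp
      · have : (i : ℕ) ≠ k := fun h' => h (Fin.ext h')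
        simp [h, this]
    · ext i; simp

theorem single_mem_degenerate {σ : Cube X} (h : IsDegenerate σ) :
    (Finsupp.single σ 1 : FreeChains X) ∈ degenerate X :=
  Submodule.subset_span ⟨σ, h, rfl⟩

theorem freeBoundary_single (σ : Cube X) :
    freeBoundary X (Finsupp.single σ 1) = cubeBoundary σ := by
  simp [freeBoundary]

theorem cubeBoundary_mem_degenerate {σ : Cube X} (h : IsDegenerate σ) :
    cubeBoundary σ ∈ degenerate X := by
  obtain ⟨k, hk, h⟩ := (isDegenerate_iff σ).1 h
  rw [cubeBoundary_eq]
  refine Submodule.sum_mem _ fun j hj => Submodule.smul_mem _ _ ?_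
  rw [Finset.mem_range] at hj
  by_cases hjk : j = k
  · subst hjk
    have : fc σ j 1 = fc σ j 0 := by
      refine cube_ext rfl fun t => ?_
      rw [ev_fc σ hk, ev_fc σ hk, ← h (ins j 0 t) 1]
      congr 1
      ext i
      by_cases hi : i = j
      · subst hi; simp [ins]
      · simp [ins, hi]
    rw [this, sub_self]
    exact zero_mem _
  · have key : ∀ ε, IsDegenerate (fc σ j ε) := by
      intro ε
      rw [isDegenerate_iff]
      refine ⟨if k < j then k else k - 1, ?_, fun t x => ?_⟩
      · change _ < σ.1 - 1
        split_ifs <;> omega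
      · rw [ev_fc σ hj, ev_fc σ hj, ← h (ins j ε t) x]
        congr 1
        ext i
        by_cases hi : i = k
        · subst hi
          rcases lt_or_gt_of_ne hjk with hlt | hlt
          · have h1 : ¬ i < j := by omega
            have h2 : ¬ i = j := by omega
            simp [ins, h1, h2]
          · simp [ins, hlt]
        · rw [Function.update_of_ne hi]
          unfold ins
          congr 1
          split_ifs <;> first
            | rfl
            | (rw [Function.update_of_ne]; omega)
    exact Submodule.sub_mem _ (single_mem_degenerate (key 1)) (single_mem_degenerate (key 0))

theorem degenerate_le : degenerate X ≤ (degenerate X).comap (freeBoundary X) := by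
  rw [degenerate, Submodule.span_le]
  rintro _ ⟨σ, h, rfl⟩
  simp only [SetLike.mem_coe, Submodule.mem_comap, freeBoundary_single]
  exact cubeBoundary_mem_degenerate h

theorem mem_fitting (m : ℕ) (f : C(Fin m → 𝕀, 𝕀)) (σ σ₁ σ₂ : Cube X) (h : σ.1 = m + 1)
    (h₁ : σ₁.1 = m + 1) (h₂ : σ₂.1 = m + 1)
    (e₁ : ∀ t, ev σ₁ t = ev σ (Function.update t m (f (fun i => t i) * t m)))
    (e₂ : ∀ t, ev σ₂ t = ev σ (Function.update t m (unitInterval.symm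
      (unitInterval.symm (f fun i => t i) * unitInterval.symm (t m))))) :
    (Finsupp.single σ₁ 1 + Finsupp.single σ₂ 1 - Finsupp.single σ 1 : FreeChains X) ∈
      fitting X := by
  obtain ⟨n, σ⟩ := σ
  obtain rfl : n = m + 1 := h
  have key : ∀ (t : ℕ → 𝕀) (x : 𝕀), (Fin.snoc (α := fun _ => 𝕀) (fun i : Fin m => t i) x :
      Fin (m + 1) → 𝕀) = fun i : Fin (m + 1) => Function.update t m x i := by
    intro t x
    ext i
    refine Fin.lastCases ?_ (fun j => ?_) i
    · simp
    · have : (j : ℕ) ≠ m := j.2.ne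
      simp [this]
  refine Submodule.subset_span ⟨m, σ, f, ?_⟩
  congr 3
  · refine cube_ext h₁ fun t => ?_
    rw [e₁]
    exact congrArg σ (key t _).symm
  · refine cube_ext h₂ fun t => ?_
    rw [e₂]
    exact congrArg σ (key t _).symm

theorem mem_permuting (σ τ : Cube X) (k : ℕ) (hk : k + 1 < σ.1) (h : τ.1 = σ.1)
    (e : ∀ t, ev τ t = ev σ (t ∘ Equiv.swap k (k + 1))) :
    (Finsupp.single σ 1 + Finsupp.single τ 1 : FreeChains X) ∈ permuting X := by
  obtain ⟨n, σ⟩ := σ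
  obtain ⟨m, rfl⟩ : ∃ m, n = m + 1 := ⟨n - 1, by change k + 1 < n at hk; omega⟩
  have hk' : k < m := by change k + 1 < m + 1 at hk; omega
  refine Submodule.subset_span ⟨m, σ, ⟨k, hk'⟩, ?_⟩
  congr 2
  refine cube_ext h fun t => ?_
  rw [e]
  refine congrArg σ (funext fun i => ?_)
  simp only [Function.comp]
  congr 1
  simp only [Equiv.swap_apply_def, Fin.ext_iff, Fin.val_castSucc, Fin.val_succ]
  split_ifs <;> simp

theorem update_ins (t : ℕ → 𝕀) {k m : ℕ} (hk : k < m + 1) (ε x : 𝕀) :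
    Function.update (ins k ε t) (m + 1) x = ins k ε (Function.update t m x) := by
  ext i
  by_cases hi : i = m + 1
  · subst hi
    have h1 : ¬ m + 1 < k := by omega
    have h2 : ¬ m + 1 = k := by omega
    simp [ins, h1, h2]
  · rw [Function.update_of_ne hi]
    unfold ins
    congr 1
    split_ifs <;> first
      | rfl
      | (rw [Function.update_of_ne]; omega)

theorem face_fitting (m : ℕ) (f : C(Fin m → 𝕀, 𝕀)) (σ σ₁ σ₂ : Cube X) (h : σ.1 = m + 1)
    (h₁ : σ₁.1 = m + 1) (h₂ : σ₂.1 = m + 1)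
    (e₁ : ∀ t, ev σ₁ t = ev σ (Function.update t m (f (fun i => t i) * t m)))
    (e₂ : ∀ t, ev σ₂ t = ev σ (Function.update t m (unitInterval.symm
      (unitInterval.symm (f fun i => t i) * unitInterval.symm (t m)))))
    (k : ℕ) (hk : k < m) (ε : 𝕀) :
    (Finsupp.single (fc σ₁ k ε) 1 + Finsupp.single (fc σ₂ k ε) 1 -
      Finsupp.single (fc σ k ε) 1 : FreeChains X) ∈ fitting X := by
  obtain ⟨m, rfl⟩ : ∃ m', m = m' + 1 := ⟨m - 1, by omega⟩
  have key : ∀ t : ℕ → 𝕀, (face f ⟨k, hk⟩ ε) (fun i => t i) = f (fun i => ins k ε t i) :=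
    fun t => ev_face f ⟨k, hk⟩ ε t
  have key' : ∀ t : ℕ → 𝕀, ins k ε t (m + 1) = t m := by
    intro t
    have h1 : ¬ m + 1 < k := by omega
    have h2 : ¬ m + 1 = k := by omega
    simp [ins, h1, h2]
  refine mem_fitting m (face f ⟨k, hk⟩ ε) _ _ _ ?_ ?_ ?_ (fun t => ?_) (fun t => ?_)
  · change σ.1 - 1 = _; omega
  · change σ₁.1 - 1 = _; omega
  · change σ₂.1 - 1 = _; omega
  · rw [ev_fc _ (by omega), ev_fc _ (by omega), e₁, key, key', update_ins _ hk]
  · rw [ev_fc _ (by omega), ev_fc _ (by omega), e₂, key, key', update_ins _ hk]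

theorem ins_last (t : ℕ → 𝕀) (σ : Cube X) {m : ℕ} (h : σ.1 = m + 1) (ε x : 𝕀) :
    ev σ (Function.update (ins m ε t) m x) = ev σ (ins m x t) := by
  refine ev_congr σ fun i hi => ?_
  by_cases him : i = m
  · subst him; simp [ins]
  · have : i < m := by omega
    simp [ins, him, this]

theorem boundary_fitting (m : ℕ) (f : C(Fin m → 𝕀, 𝕀)) (σ σ₁ σ₂ : Cube X) (h : σ.1 = m + 1)
    (h₁ : σ₁.1 = m + 1) (h₂ : σ₂.1 = m + 1)
    (e₁ : ∀ t, ev σ₁ t = ev σ (Function.update t m (f (fun i => t i) * t m)))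
    (e₂ : ∀ t, ev σ₂ t = ev σ (Function.update t m (unitInterval.symm
      (unitInterval.symm (f fun i => t i) * unitInterval.symm (t m))))) :
    cubeBoundary σ₁ + cubeBoundary σ₂ - cubeBoundary σ ∈ fitting X := by
  have hl : ∀ (t : ℕ → 𝕀) (ε : 𝕀), ins m ε t m = ε := fun t ε => by simp [ins]
  have t₁ : fc σ₁ m 0 = fc σ m 0 := by
    refine cube_ext (by change σ₁.1 - 1 = σ.1 - 1; omega) fun t => ?_
    rw [ev_fc _ (by omega), ev_fc _ (by omega), e₁, ins_last _ _ h, hl, mul_zero]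
  have t₂ : fc σ₂ m 1 = fc σ m 1 := by
    refine cube_ext (by change σ₂.1 - 1 = σ.1 - 1; omega) fun t => ?_
    rw [ev_fc _ (by omega), ev_fc _ (by omega), e₂, ins_last _ _ h, hl]
    simp
  have t₃ : fc σ₁ m 1 = fc σ₂ m 0 := by
    refine cube_ext (by change σ₁.1 - 1 = σ₂.1 - 1; omega) fun t => ?_
    rw [ev_fc _ (by omega), ev_fc _ (by omega), e₁, e₂, ins_last _ _ h, ins_last _ _ h, hl, hl]
    have : ∀ ε : 𝕀, (fun i : Fin m => ins m ε t i) = fun i : Fin m => t i := by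
      intro ε; ext i; simp [ins]
    rw [this, this]
    simp
  rw [cubeBoundary_eq, cubeBoundary_eq, cubeBoundary_eq, h, h₁, h₂, Finset.sum_range_succ,
    Finset.sum_range_succ, Finset.sum_range_succ, t₁, t₂, t₃]
  have key : ∀ k ∈ Finset.range m, (-1 : ℤ) ^ k •
      ((Finsupp.single (fc σ₁ k 1) 1 + Finsupp.single (fc σ₂ k 1) 1 -
        Finsupp.single (fc σ k 1) 1 : FreeChains X) -
      (Finsupp.single (fc σ₁ k 0) 1 + Finsupp.single (fc σ₂ k 0) 1 -
        Finsupp.single (fc σ k 0) 1)) ∈ fitting X := fun k hk =>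
    Submodule.smul_mem _ _ (Submodule.sub_mem _
      (face_fitting m f σ σ₁ σ₂ h h₁ h₂ e₁ e₂ k (Finset.mem_range.1 hk) 1)
      (face_fitting m f σ σ₁ σ₂ h h₁ h₂ e₁ e₂ k (Finset.mem_range.1 hk) 0))
  have := Submodule.sum_mem _ key
  convert this using 1
  simp only [smul_sub, smul_add, Finset.sum_sub_distrib, Finset.sum_add_distrib]
  abel

theorem fitting_le : fitting X ≤ (fitting X).comap (freeBoundary X) := by
  rw [fitting, Submodule.span_le]
  rintro _ ⟨m, σ, f, rfl⟩
  simp only [SetLike.mem_coe, Submodule.mem_comap, map_add, map_sub, freeBoundary_single]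
  have key : ∀ (t : ℕ → 𝕀) (x : 𝕀), (Fin.snoc (α := fun _ => 𝕀) (fun i : Fin m => t i) x :
      Fin (m + 1) → 𝕀) = fun i : Fin (m + 1) => Function.update t m x i := by
    intro t x
    ext i
    refine Fin.lastCases ?_ (fun j => ?_) i
    · simp
    · have : (j : ℕ) ≠ m := j.2.ne
      simp [this]
  exact boundary_fitting m f _ _ _ rfl rfl rfl (fun t => congrArg σ (key t _))
    (fun t => congrArg σ (key t _))

theorem boundary_permuting (σ τ : Cube X) (k : ℕ) (hk : k + 1 < σ.1) (h : τ.1 = σ.1)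
    (e : ∀ t, ev τ t = ev σ (t ∘ Equiv.swap k (k + 1))) :
    cubeBoundary σ + cubeBoundary τ ∈ permuting X := by
  have c₁ : ∀ ε, fc τ k ε = fc σ (k + 1) ε := by
    intro ε
    refine cube_ext (by change τ.1 - 1 = σ.1 - 1; omega) fun t => ?_
    rw [ev_fc _ (by omega), ev_fc _ (by omega), e]
    congr 1
    ext i
    simp only [Function.comp, Equiv.swap_apply_def, ins]
    split_ifs <;> first | rfl | omega | (congr 2; omega)
  have c₂ : ∀ ε, fc τ (k + 1) ε = fc σ k ε := by
    intro ε
    refine cube_ext (by change τ.1 - 1 = σ.1 - 1; omega) fun t => ?_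
    rw [ev_fc _ (by omega), ev_fc _ (by omega), e]
    congr 1
    ext i
    simp only [Function.comp, Equiv.swap_apply_def, ins]
    split_ifs <;> first | rfl | omega | (congr 2; omega)
  have key : ∀ j ∈ ((Finset.range σ.1).erase k).erase (k + 1), (-1 : ℤ) ^ j •
      ((Finsupp.single (fc σ j 1) 1 + Finsupp.single (fc τ j 1) 1 : FreeChains X) -
      (Finsupp.single (fc σ j 0) 1 + Finsupp.single (fc τ j 0) 1)) ∈ permuting X := by
    intro j hj
    simp only [Finset.mem_erase, Finset.mem_range] at hj
    obtain ⟨h1, h2, h3⟩ := hj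
    have : ∀ ε, (Finsupp.single (fc σ j ε) 1 + Finsupp.single (fc τ j ε) 1 : FreeChains X) ∈
        permuting X := by
      intro ε
      refine mem_permuting _ _ (if j < k then k - 1 else k) ?_ ?_ fun t => ?_
      · change _ < σ.1 - 1
        split_ifs <;> omega
      · change τ.1 - 1 = σ.1 - 1; omega
      · rw [ev_fc _ (by omega), ev_fc _ (by omega), e]
        congr 1
        ext i
        simp only [Function.comp, Equiv.swap_apply_def, ins]
        split_ifs <;> first | rfl | omega | (congr 2; omega)
    exact Submodule.smul_mem _ _ (Submodule.sub_mem _ (this 1) (this 0))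
  have hk1 : k + 1 ∈ (Finset.range σ.1).erase k := by simp; omega
  have hk0 : k ∈ Finset.range σ.1 := by simp; omega
  have := Submodule.sum_mem _ key
  rw [cubeBoundary_eq, cubeBoundary_eq, h, ← Finset.add_sum_erase _ _ hk0,
    ← Finset.add_sum_erase _ _ hk0, ← Finset.add_sum_erase _ _ hk1,
    ← Finset.add_sum_erase _ _ hk1, c₁, c₁, c₂, c₂]
  convert this using 1
  simp only [smul_sub, smul_add, Finset.sum_sub_distrib, Finset.sum_add_distrib, pow_succ,
    mul_neg, mul_one, neg_smul]
  abel

theorem permuting_le : permuting X ≤ (permuting X).comap (freeBoundary X) := by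
  rw [permuting, Submodule.span_le]
  rintro _ ⟨m, σ, k, rfl⟩
  simp only [SetLike.mem_coe, Submodule.mem_comap, map_add, freeBoundary_single]
  refine boundary_permuting _ _ k (by change (k : ℕ) + 1 < m + 1; omega) rfl fun t => ?_
  refine congrArg σ (funext fun i => ?_)
  simp only [Function.comp]
  congr 1
  simp only [Equiv.swap_apply_def, Fin.ext_iff, Fin.val_castSucc, Fin.val_succ]
  split_ifs <;> simp

theorem relations_le : relations X ≤ (relations X).comap (freeBoundary X) := by
  refine sup_le (degenerate_le.trans (Submodule.comap_mono le_sup_left)) (sup_le ?_ ?_)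
  · exact fitting_le.trans (Submodule.comap_mono (le_sup_left.trans le_sup_right))
  · exact permuting_le.trans (Submodule.comap_mono (le_sup_right.trans le_sup_right))

/-- The degree `n` part of the quotient of the cubical chains by `R`. -/
def chainDegree (R : Submodule ℤ (FreeChains X)) (n : ℕ) : Submodule ℤ (FreeChains X ⧸ R) :=
  (Submodule.span ℤ {c | ∃ σ : C(Fin n → 𝕀, X), c = Finsupp.single ⟨n, σ⟩ 1}).map R.mkQ

/-- The differential induced by the cubical boundary on a quotient of the cubical chains. -/
abbrev chainBoundary {R : Submodule ℤ (FreeChains X)} (h : R ≤ R.comap (freeBoundary X)) :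
    (FreeChains X ⧸ R) →ₗ[ℤ] (FreeChains X ⧸ R) :=
  R.mapQ R (freeBoundary X) h

/-- Cubical homology `H_n(X)`: the homology of the complex `C_*(X)` of cubical chains modulo
degenerate ones. -/
abbrev CubicalHomology (X : Type u) [TopologicalSpace X] (n : ℕ) : Type u :=
  Homology (chainDegree (degenerate X)) (chainBoundary degenerate_le) n

/-- The homology `H_n(C^□(X))` of the quotient `C^□_*(X)` of `C_*(X)` by the two subcomplexes of
fitting and of permuted cubes. -/
abbrev SquareHomology (X : Type u) [TopologicalSpace X] (n : ℕ) : Type u :=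
  Homology (chainDegree (relations X)) (chainBoundary relations_le) n

/-- The span of the cubes contained in `A`. -/
def carried (A : Set X) : Submodule ℤ (FreeChains X) :=
  Submodule.span ℤ {c | ∃ σ : Cube X, (∀ t, σ.2 t ∈ A) ∧ c = Finsupp.single σ 1}

theorem relative_le (A : Set X) :
    degenerate X ⊔ carried A ≤ (degenerate X ⊔ carried A).comap (freeBoundary X) := by
  refine sup_le (degenerate_le.trans (Submodule.comap_mono le_sup_left)) ?_
  refine le_trans ?_ (Submodule.comap_mono le_sup_right)
  rw [carried, Submodule.span_le]
  rintro _ ⟨σ, h, rfl⟩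
  simp only [SetLike.mem_coe, Submodule.mem_comap, freeBoundary_single]
  rw [cubeBoundary_eq]
  refine Submodule.sum_mem _ fun j _ => Submodule.smul_mem _ _ (Submodule.sub_mem _ ?_ ?_)
  · exact Submodule.subset_span ⟨fc σ j 1, fun t => h _, rfl⟩
  · exact Submodule.subset_span ⟨fc σ j 0, fun t => h _, rfl⟩

/-- Relative cubical homology `H_n(X, A)`. -/
abbrev RelativeHomology (X : Type u) [TopologicalSpace X] (A : Set X) (n : ℕ) : Type u :=
  Homology (chainDegree (degenerate X ⊔ carried A)) (chainBoundary (relative_le A)) n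

/-- The map of free chains induced by a continuous map. -/
def push (f : C(X, Y)) : FreeChains X →ₗ[ℤ] FreeChains Y :=
  Finsupp.lmapDomain ℤ ℤ fun σ => ⟨σ.1, f.comp σ.2⟩

theorem push_single (f : C(X, Y)) (σ : Cube X) :
    push f (Finsupp.single σ 1) = Finsupp.single ⟨σ.1, f.comp σ.2⟩ 1 := by
  simp [push]

theorem push_boundary (f : C(X, Y)) : push f ∘ₗ freeBoundary X = freeBoundary Y ∘ₗ push f := by
  ext1 σ
  ext1
  simp only [LinearMap.comp_apply, Finsupp.lsingle_apply, push_single, freeBoundary_single]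
  obtain ⟨m, σ⟩ := σ
  cases m with
  | zero => simp [cubeBoundary]
  | succ m =>
    simp only [cubeBoundary, map_sum, map_smul, map_sub, push_single]
    rfl

/-- The map on homology induced by a degree and boundary preserving map of free chains which is
compatible with the relations. -/
def inducedMap {R : Submodule ℤ (FreeChains X)} (hR : R ≤ R.comap (freeBoundary X))
    {S : Submodule ℤ (FreeChains Y)} (hS : S ≤ S.comap (freeBoundary Y)) (f : C(X, Y))
    (h : R ≤ S.comap (push f))
    (n : ℕ) :
    Homology (chainDegree R) (chainBoundary hR) n →ₗ[ℤ]
      Homology (chainDegree S) (chainBoundary hS) n :=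
  homologyMap (R.mapQ S _ h)
    (by
      rintro n _ ⟨x, hx, rfl⟩
      refine ⟨push f x, ?_, rfl⟩
      refine Submodule.span_induction ?_ ?_ ?_ ?_ hx
      · rintro _ ⟨σ, rfl⟩
        exact Submodule.subset_span ⟨f.comp σ, push_single f _⟩
      · simp
      · intro x y _ _ hx hy
        rw [map_add]
        exact add_mem hx hy
      · intro a x _ hx
        rw [map_smul]
        exact Submodule.smul_mem _ _ hx)
    (by
      ext σ
      have := LinearMap.congr_fun (push_boundary f) (Finsupp.single σ 1)
      exact congrArg S.mkQ this) n

theorem degenerate_push {f : C(X, Y)} : degenerate X ≤ (degenerate Y).comap (push f) := by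
  rw [degenerate, Submodule.span_le]
  rintro _ ⟨σ, ⟨k, h⟩, rfl⟩
  simp only [SetLike.mem_coe, Submodule.mem_comap, push_single]
  exact single_mem_degenerate ⟨k, fun t x => congrArg f (h t x)⟩

/-- The map `H_n(X) → H_n(C^□(Y))` induced by a continuous map `f : X → Y`. -/
def mapToSquare (f : C(X, Y)) (n : ℕ) : CubicalHomology X n →ₗ[ℤ] SquareHomology Y n :=
  inducedMap degenerate_le relations_le f
    (degenerate_push.trans (Submodule.comap_mono le_sup_left)) n

/-- The restriction map `H_n(X) → H_n(X, X ∖ {x})`. -/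
def restrictAt (x : X) (n : ℕ) : CubicalHomology X n →ₗ[ℤ] RelativeHomology X {x}ᶜ n :=
  inducedMap degenerate_le (relative_le _) (ContinuousMap.id X)
    (degenerate_push.trans (Submodule.comap_mono le_sup_left)) n

/-- A fundamental class of an `n`-manifold `X`: a class in `H_n(X)` whose image in the infinite
cyclic group `H_n(X, X ∖ {x})` is a generator for every `x`. -/
def IsFundamentalClass {n : ℕ} (c : CubicalHomology X n) : Prop :=
  ∀ x : X, Submodule.span ℤ {restrictAt x n c} = ⊤

end Cubes

/-! ### Moore loops -/

section Loops

/-- The space of free Moore loops `Map(ℝ/ℤ, Q) × [0, ∞)`, with `ℝ/ℤ` realised as the unit interval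
with its endpoints identified; the second component is the length of the loop. -/
abbrev FreeLoop (Q : Type u) [TopologicalSpace Q] : Type u :=
  {γ : C(𝕀, Q) // γ 0 = γ 1} × ℝ≥0

/-- Moore loops based at `q`, of positive length. -/
abbrev BasedLoop {Q : Type u} [TopologicalSpace Q] (q : Q) : Type u :=
  {p : FreeLoop Q // p.1.1 0 = q ∧ 0 < p.2}

variable {Q : Type u} [TopologicalSpace Q]

/-- The constant loop (of length `0`) at a point. -/
def constLoop (Q : Type u) [TopologicalSpace Q] : C(Q, FreeLoop Q) where
  toFun x := (⟨ContinuousMap.const 𝕀 x, rfl⟩, 0)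
  continuous_toFun := (ContinuousMap.continuous_const'.subtype_mk _).prodMk continuous_const

variable {q : Q}

/-- The inclusion `ι` of based loops in free loops. -/
def inclusion (q : Q) : C(BasedLoop q, FreeLoop Q) := ⟨Subtype.val, continuous_subtype_val⟩

/-- The length of a based loop. -/
def len (γ : BasedLoop q) : ℝ := γ.1.2

theorem len_pos (γ : BasedLoop q) : 0 < len γ := γ.2.2

/-- The value of a loop at the time `s`, when it is parametrised by `[0, len γ]`. -/
def loopAt (γ : BasedLoop q) (s : ℝ) : Q := γ.1.1.1 (Set.projIcc 0 1 zero_le_one (s / len γ))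

theorem at_of_nonpos (γ : BasedLoop q) {s : ℝ} (h : s ≤ 0) : loopAt γ s = q := by
  rw [loopAt, Set.projIcc_of_le_left _ (div_nonpos_of_nonpos_of_nonneg h (len_pos γ).le)]
  exact γ.2.1

theorem at_of_le (γ : BasedLoop q) {s : ℝ} (h : len γ ≤ s) : loopAt γ s = q := by
  rw [loopAt, Set.projIcc_of_right_le _ ((one_le_div (len_pos γ)).2 h)]
  exact γ.1.1.2.symm.trans γ.2.1

theorem continuous_len : Continuous (len : BasedLoop q → ℝ) :=
  NNReal.continuous_coe.comp (continuous_snd.comp continuous_subtype_val)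

theorem continuous_loopAt {T : Type*} [TopologicalSpace T] {g : T → BasedLoop q} {s : T → ℝ}
    (hg : Continuous g) (hs : Continuous s) : Continuous fun x => loopAt (g x) (s x) := by
  unfold loopAt
  refine Continuous.eval ?_ ?_
  · exact continuous_subtype_val.comp (continuous_fst.comp (continuous_subtype_val.comp hg))
  · exact continuous_projIcc.comp (hs.div (continuous_len.comp hg) fun x => (len_pos _).ne')

/-- The point at the time `s` of the loop `α · β`. -/
def concatAt (α β : BasedLoop q) (s : ℝ) : Q :=
  if s ≤ len α then loopAt α s else loopAt β (s - len α)

/-- The point at the time `s` of the loop `α #_t β`, which is the concatenation of `α` and `β` with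
its basepoint moved to the point of `α` at the time `t * len α`. -/
def sharpAt (α β : BasedLoop q) (t : 𝕀) (s : ℝ) : Q :=
  if s ≤ (1 - t) * len α then loopAt α (s + t * len α)
  else if s ≤ (1 - t) * len α + len β then loopAt β (s - (1 - t) * len α)
  else loopAt α (s - len β - (1 - t) * len α)

theorem continuous_concatAt {T : Type*} [TopologicalSpace T] {α β : T → BasedLoop q} {s : T → ℝ}
    (hα : Continuous α) (hβ : Continuous β) (hs : Continuous s) :
    Continuous fun x => concatAt (α x) (β x) (s x) := by
  have hl := continuous_len.comp hα
  refine Continuous.if_le (continuous_loopAt hα hs) (continuous_loopAt hβ (hs.sub hl)) hs hl fun x hx => ?_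
  try simp only [Function.comp] at hx
  rw [at_of_le _ hx.ge, at_of_nonpos _ (by simp [hx])]

theorem continuous_sharpAt {T : Type*} [TopologicalSpace T] {α β : T → BasedLoop q} {t : T → 𝕀}
    {s : T → ℝ} (hα : Continuous α) (hβ : Continuous β) (ht : Continuous t) (hs : Continuous s) :
    Continuous fun x => sharpAt (α x) (β x) (t x) (s x) := by
  have hl := continuous_len.comp hα
  have hl' := continuous_len.comp hβ
  have ht' : Continuous fun x => (t x : ℝ) := continuous_subtype_val.comp ht
  have h1 : Continuous fun x => (1 - (t x : ℝ)) * len (α x) := (continuous_const.sub ht').mul hl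
  refine Continuous.if_le (continuous_loopAt hα (hs.add (ht'.mul hl)))
    (Continuous.if_le (continuous_loopAt hβ (hs.sub h1)) (continuous_loopAt hα ((hs.sub hl').sub h1)) hs (h1.add hl') ?_)
    hs h1 ?_
  · intro x hx
    try simp only [Function.comp] at hx
    rw [at_of_le _ (by linarith), at_of_nonpos _ (by linarith)]
  · intro x hx
    rw [if_pos (by have := len_pos (β x); linarith), at_of_le _ (by linarith),
      at_of_nonpos _ (by linarith)]

theorem concatAt_zero (α β : BasedLoop q) : concatAt α β 0 = q := by
  rw [concatAt, if_pos (len_pos α).le, at_of_nonpos _ le_rfl]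

theorem concatAt_end (α β : BasedLoop q) : concatAt α β (len α + len β) = q := by
  have := len_pos β
  rw [concatAt, if_neg (by linarith), at_of_le _ (by linarith)]

theorem sharpAt_ends (α β : BasedLoop q) (t : 𝕀) :
    sharpAt α β t 0 = sharpAt α β t (len α + len β) := by
  have h1 := len_pos α
  have h2 := len_pos β
  have h3 : 0 ≤ (1 - (t : ℝ)) * len α := mul_nonneg (by linarith [t.2.2]) h1.le
  have h4 : 0 ≤ (t : ℝ) * len α := mul_nonneg t.2.1 h1.le
  rw [sharpAt, sharpAt, if_pos h3, if_neg (by linarith)]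
  split_ifs with h5
  · rw [at_of_nonpos _ (by linarith), at_of_le _ (by linarith)]
  · congr 1; ring

/-- Concatenation `α · β` of based Moore loops. -/
def concat (q : Q) : C(BasedLoop q × BasedLoop q, BasedLoop q) where
  toFun x := ⟨(⟨⟨fun u => concatAt x.1 x.2 (u * (len x.1 + len x.2)),
      continuous_concatAt continuous_const continuous_const
        (continuous_subtype_val.mul continuous_const)⟩, by
        simpa using (concatAt_zero _ _).trans (concatAt_end x.1 x.2).symm⟩, x.1.1.2 + x.2.1.2), by
        simpa using concatAt_zero x.1 x.2, add_pos x.1.2.2 x.2.2.2⟩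
  continuous_toFun := by
    refine Continuous.subtype_mk (Continuous.prodMk (Continuous.subtype_mk
      (ContinuousMap.curry ⟨fun y : (BasedLoop q × BasedLoop q) × 𝕀 =>
        concatAt y.1.1 y.1.2 (y.2 * (len y.1.1 + len y.1.2)), ?_⟩).continuous _) ?_) _
    · have h1 : Continuous fun y : (BasedLoop q × BasedLoop q) × 𝕀 => y.1.1 :=
        continuous_fst.comp continuous_fst
      have h2 : Continuous fun y : (BasedLoop q × BasedLoop q) × 𝕀 => y.1.2 :=
        continuous_snd.comp continuous_fst
      exact continuous_concatAt h1 h2 ((continuous_subtype_val.comp continuous_snd).mul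
        ((continuous_len.comp h1).add (continuous_len.comp h2)))
    · exact (continuous_snd.comp (continuous_subtype_val.comp continuous_fst)).add
        (continuous_snd.comp (continuous_subtype_val.comp continuous_snd))

/-- The map `(α, β, t) ↦ α #_t β` from pairs of based loops to free loops. -/
def sharp (q : Q) : C(BasedLoop q × BasedLoop q × 𝕀, FreeLoop Q) where
  toFun x := (⟨⟨fun u => sharpAt x.1 x.2.1 x.2.2 (u * (len x.1 + len x.2.1)),
      continuous_sharpAt continuous_const continuous_const continuous_const
        (continuous_subtype_val.mul continuous_const)⟩, by
        simpa using sharpAt_ends x.1 x.2.1 x.2.2⟩, x.1.1.2 + x.2.1.1.2)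
  continuous_toFun := by
    refine Continuous.prodMk (Continuous.subtype_mk
      (ContinuousMap.curry ⟨fun y : (BasedLoop q × BasedLoop q × 𝕀) × 𝕀 =>
        sharpAt y.1.1 y.1.2.1 y.1.2.2 (y.2 * (len y.1.1 + len y.1.2.1)), ?_⟩).continuous _) ?_
    · have h1 : Continuous fun y : (BasedLoop q × BasedLoop q × 𝕀) × 𝕀 => y.1.1 :=
        continuous_fst.comp continuous_fst
      have h2 : Continuous fun y : (BasedLoop q × BasedLoop q × 𝕀) × 𝕀 => y.1.2.1 :=
        continuous_fst.comp (continuous_snd.comp continuous_fst)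
      have h3 : Continuous fun y : (BasedLoop q × BasedLoop q × 𝕀) × 𝕀 => y.1.2.2 :=
        continuous_snd.comp (continuous_snd.comp continuous_fst)
      exact continuous_sharpAt h1 h2 h3 ((continuous_subtype_val.comp continuous_snd).mul
        ((continuous_len.comp h1).add (continuous_len.comp h2)))
    · exact (continuous_snd.comp (continuous_subtype_val.comp continuous_fst)).add
        (continuous_snd.comp (continuous_subtype_val.comp (continuous_fst.comp continuous_snd)))

theorem len_concat (α β : BasedLoop q) : len (concat q (α, β)) = len α + len β := rfl

theorem loopAt_concat (α β : BasedLoop q) {s : ℝ} (h0 : 0 ≤ s) (h1 : s ≤ len α + len β) :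
    loopAt (concat q (α, β)) s = concatAt α β s := by
  have hα := len_pos α
  have hβ := len_pos β
  have hs : s / (len α + len β) ∈ Set.Icc (0 : ℝ) 1 :=
    ⟨div_nonneg h0 (by linarith), (div_le_one (by linarith)).2 h1⟩
  rw [loopAt, len_concat, Set.projIcc_of_mem _ hs]
  change concatAt α β (s / (len α + len β) * (len α + len β)) = _
  rw [div_mul_cancel₀ _ (by linarith)]

theorem freeLoop_ext {x y : FreeLoop Q} (h : x.2 = y.2) (h' : ∀ u, x.1.1 u = y.1.1 u) : x = y :=
  Prod.ext (Subtype.ext (ContinuousMap.ext h')) h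

theorem sharp_ext {x y : BasedLoop q × BasedLoop q × 𝕀}
    (h : len x.1 + len x.2.1 = len y.1 + len y.2.1)
    (h' : ∀ s, 0 ≤ s → s ≤ len x.1 + len x.2.1 →
      sharpAt x.1 x.2.1 x.2.2 s = sharpAt y.1 y.2.1 y.2.2 s) : sharp q x = sharp q y := by
  have h1 := len_pos x.1
  have h2 := len_pos x.2.1
  refine freeLoop_ext (NNReal.coe_injective h) fun u => ?_
  change sharpAt _ _ _ _ = sharpAt _ _ _ _
  rw [← h]
  exact h' _ (mul_nonneg u.2.1 (by linarith)) (mul_le_of_le_one_left (by linarith) u.2.2)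

theorem sharp_zero (α β : BasedLoop q) :
    sharp q (α, β, 0) = inclusion q (concat q (α, β)) := by
  have h1 := len_pos α
  have h2 := len_pos β
  refine freeLoop_ext rfl fun u => ?_
  change sharpAt _ _ _ _ = concatAt _ _ _
  have h3 : (u : ℝ) * (len α + len β) ≤ len α + len β :=
    mul_le_of_le_one_left (by linarith) u.2.2
  simp only [sharpAt, concatAt, Set.Icc.coe_zero, sub_zero, one_mul, zero_mul, add_zero, h3,
    if_true]

theorem sharp_one (α β : BasedLoop q) :
    sharp q (α, β, 1) = inclusion q (concat q (β, α)) := by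
  have h1 := len_pos α
  have h2 := len_pos β
  refine freeLoop_ext (add_comm _ _) fun u => ?_
  change sharpAt _ _ _ (_ * (len α + len β)) = concatAt _ _ (_ * (len β + len α))
  rw [add_comm (len β)]
  have h3 : 0 ≤ (u : ℝ) * (len α + len β) := mul_nonneg u.2.1 (by linarith)
  generalize (u : ℝ) * (len α + len β) = s at h3
  simp only [sharpAt, concatAt, Set.Icc.coe_one, sub_self, zero_mul, one_mul, zero_add, sub_zero]
  split_ifs with h4 h5 h5
  · rw [at_of_le _ (by linarith), at_of_nonpos _ (by linarith)]
  · linarith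
  · rfl
  · rfl

/-- The fraction `len α / (len α + len β)`. -/
def frac (α β : BasedLoop q) : 𝕀 :=
  ⟨len α / (len α + len β), by
    have h1 := len_pos α
    have h2 := len_pos β
    exact ⟨div_nonneg h1.le (by linarith), (div_le_one (by linarith)).2 (by linarith)⟩⟩

theorem frac_mul (α β : BasedLoop q) : (frac α β : ℝ) * (len α + len β) = len α := by
  have h1 := len_pos α
  have h2 := len_pos β
  exact div_mul_cancel₀ _ (by linarith)

theorem continuous_frac {T : Type*} [TopologicalSpace T] {α β : T → BasedLoop q}
    (hα : Continuous α) (hβ : Continuous β) : Continuous fun x => frac (α x) (β x) := by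
  have h1 := continuous_len.comp hα
  refine Continuous.subtype_mk (h1.div (h1.add (continuous_len.comp hβ)) fun x => ?_) _
  have h1 := len_pos (α x)
  have h2 := len_pos (β x)
  exact (add_pos h1 h2).ne'

theorem sharp_lower (α β γ : BasedLoop q) (u : 𝕀) :
    sharp q (concat q (α, β), γ, frac α β * u) = sharp q (α, concat q (β, γ), u) := by
  have h1 := len_pos α
  have h2 := len_pos β
  have h3 := len_pos γ
  have h4 : ((frac α β * u : 𝕀) : ℝ) * (len α + len β) = u * len α := by
    rw [Set.Icc.coe_mul, mul_right_comm, frac_mul, mul_comm]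
  have h5 : (1 - ((frac α β * u : 𝕀) : ℝ)) * (len α + len β) = len α + len β - u * len α := by
    rw [sub_mul, h4, one_mul]
  have h6 : (1 - (u : ℝ)) * len α = len α - u * len α := by ring
  have h7 : 0 ≤ (u : ℝ) * len α := mul_nonneg u.2.1 h1.le
  have h8 : (u : ℝ) * len α ≤ len α := mul_le_of_le_one_left h1.le u.2.2
  refine sharp_ext (by simp only [len_concat]; ring) fun s hs hs' => ?_
  simp only [len_concat] at hs' ⊢
  simp only [sharpAt, len_concat, h4, h5, h6]
  generalize (u : ℝ) * len α = v at *
  by_cases c1 : s ≤ len α + len β - v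
  · rw [if_pos c1, loopAt_concat _ _ (by linarith) (by linarith), concatAt]
    by_cases c2 : s ≤ len α - v
    · rw [if_pos c2, if_pos (by linarith)]
    · rw [if_neg c2, if_neg (by linarith), if_pos (by linarith),
        loopAt_concat _ _ (by linarith) (by linarith), concatAt, if_pos (by linarith)]
      congr 1; ring
  · rw [if_neg c1, if_neg (show ¬ s ≤ len α - v by linarith)]
    by_cases c2 : s ≤ len α + len β - v + len γ
    · rw [if_pos c2, if_pos (by linarith), loopAt_concat _ _ (by linarith) (by linarith), concatAt,
        if_neg (by linarith)]
      congr 1; ring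
    · rw [if_neg c2, if_neg (by linarith), loopAt_concat _ _ (by linarith) (by linarith), concatAt,
        if_pos (by linarith)]
      congr 1; ring

theorem sharp_upper (α β γ : BasedLoop q) (u : 𝕀) :
    sharp q (concat q (α, β), γ, unitInterval.symm
      (unitInterval.symm (frac α β) * unitInterval.symm u)) =
      sharp q (β, concat q (γ, α), u) := by
  have h1 := len_pos α
  have h2 := len_pos β
  have h3 := len_pos γ
  have h0 : ((unitInterval.symm (unitInterval.symm (frac α β) * unitInterval.symm u) : 𝕀) : ℝ) *
      (len α + len β) = len α + u * len β := by
    have := frac_mul α β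
    simp only [unitInterval.coe_symm_eq, Set.Icc.coe_mul]
    linear_combination (1 - (u : ℝ)) * this
  generalize unitInterval.symm (unitInterval.symm (frac α β) * unitInterval.symm u) = t at *
  have h5 : (1 - (t : ℝ)) * (len α + len β) = len β - u * len β := by
    rw [sub_mul, h0, one_mul]; ring
  have h6 : (1 - (u : ℝ)) * len β = len β - u * len β := by ring
  have h7 : 0 ≤ (u : ℝ) * len β := mul_nonneg u.2.1 h2.le
  have h8 : (u : ℝ) * len β ≤ len β := mul_le_of_le_one_left h2.le u.2.2
  refine sharp_ext (by simp only [len_concat]; ring) fun s hs hs' => ?_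
  simp only [len_concat] at hs' ⊢
  simp only [sharpAt, len_concat, h0, h5, h6]
  generalize (u : ℝ) * len β = v at *
  by_cases c1 : s ≤ len β - v
  · rw [if_pos c1, if_pos c1, loopAt_concat _ _ (by linarith) (by linarith), concatAt]
    split_ifs with c2
    · rw [at_of_le _ (by linarith), at_of_nonpos _ (by linarith)]
    · congr 1; ring
  · rw [if_neg c1, if_neg c1]
    by_cases c2 : s ≤ len β - v + len γ
    · rw [if_pos c2, if_pos (by linarith), loopAt_concat _ _ (by linarith) (by linarith), concatAt,
        if_pos (by linarith)]
    · rw [if_neg c2, loopAt_concat _ _ (by linarith) (by linarith), concatAt]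
      by_cases c3 : s ≤ len β - v + (len γ + len α)
      · rw [if_pos c3, loopAt_concat _ _ (by linarith) (by linarith), concatAt,
          if_pos (by linarith), if_neg (by linarith)]
        congr 1; ring
      · rw [if_neg c3, if_neg (by linarith)]
        congr 1; ring

end Loops

/-! ### The cyclic bar complex of chains on the based loop space -/

section Hochschild

variable {Q : Type u} [TopologicalSpace Q] {q : Q}

/-- The product `σ · τ` of cubes of based loops. -/
def cubeMul (σ τ : Cube (BasedLoop q)) : Cube (BasedLoop q) :=
  ⟨σ.1 + τ.1, (concat q).comp
    ⟨fun t => (σ.2 fun i => t (Fin.castAdd τ.1 i), τ.2 fun i => t (Fin.natAdd σ.1 i)), by fun_prop⟩⟩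

/-- The cube `σ ⊻ τ` of free loops: concatenate and use the last coordinate to move the basepoint
around the first loop. -/
def cubeVee (σ τ : Cube (BasedLoop q)) : Cube (FreeLoop Q) :=
  ⟨σ.1 + τ.1 + 1, (sharp q).comp
    ⟨fun t => (σ.2 fun i => t (Fin.castAdd τ.1 i).castSucc,
      τ.2 fun i => t (Fin.natAdd σ.1 i).castSucc, t (Fin.last _)), by fun_prop⟩⟩

/-- The operations `μ_j(σ_j, …, σ_1)` of the `A_∞`-algebra of chains on the based loop space, as a
function of the list `[σ_1, …, σ_j]`: here `μ_1 σ = ∂ σ`, `μ_2(σ_2, σ_1) = (-1)^|σ_1| σ_1 · σ_2`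
and all others vanish. -/
def mu : List (Cube (BasedLoop q)) → FreeChains (BasedLoop q)
  | [σ] => cubeBoundary σ
  | [σ₁, σ₂] => (-1 : ℤ) ^ σ₁.1 • Finsupp.single (cubeMul σ₁ σ₂) 1
  | _ => 0

/-- The free abelian group on words in cubes of based loops. The word `a_d ⊗ ⋯ ⊗ a_1` is
represented by the list `[a_1, …, a_d]`. -/
abbrev FreeWords (q : Q) : Type u := List (Cube (BasedLoop q)) →₀ ℤ

/-- The sum of the reduced degrees of the letters of a word (up to parity). -/
def reducedDegree (w : List (Cube (BasedLoop q))) : ℕ := (w.map fun σ => σ.1 + 1).sum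

/-- The linear map which puts a chain at a given place of a word. -/
def insertChain (pre post : List (Cube (BasedLoop q))) :
    FreeChains (BasedLoop q) →ₗ[ℤ] FreeWords q :=
  Finsupp.lmapDomain ℤ ℤ fun σ => pre ++ σ :: post

/-- The Hochschild differential of a word `a_d ⊗ ⋯ ⊗ a_1`: the sum of
`± a_d ⊗ ⋯ ⊗ μ_j(a_{i+j}, …, a_{i+1}) ⊗ a_i ⊗ ⋯ ⊗ a_1` and of
`± μ_{d-j}(a_i, …, a_1, a_d, …, a_{i+j+1}) ⊗ a_{i+j} ⊗ ⋯ ⊗ a_{i+1}` over all `i + j < d`. -/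
def wordBoundary (w : List (Cube (BasedLoop q))) : FreeWords q :=
  ∑ i ∈ Finset.range w.length, ∑ j ∈ Finset.range (w.length - i),
    ((-1 : ℤ) ^ reducedDegree (w.take i) •
        insertChain (w.take i) (w.drop (i + j)) (mu ((w.drop i).take j)) +
      (-1 : ℤ) ^ (reducedDegree (w.take i) * (1 + reducedDegree (w.drop i)) +
          reducedDegree (w.drop (i + j)).dropLast +
          reducedDegree ((w.drop i).take j) + 1) •
        insertChain ((w.drop i).take j) [] (mu (w.drop (i + j) ++ w.take i)))

/-- The span of the words in which some letter is a degenerate cube. -/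
def degenerateWords (q : Q) : Submodule ℤ (FreeWords q) :=
  Submodule.span ℤ {c | ∃ w : List (Cube (BasedLoop q)), (∃ σ ∈ w, IsDegenerate σ) ∧
    c = Finsupp.single w 1}

/-- The value on a word of the ad hoc Goodwillie map. -/
def goodwillieWord : List (Cube (BasedLoop q)) → FreeChains (FreeLoop Q)
  | [σ] => (-1 : ℤ) ^ σ.1 • Finsupp.single ⟨σ.1, (inclusion q).comp σ.2⟩ 1
  | [σ₁, σ₂] => - Finsupp.single (cubeVee σ₁ σ₂) 1
  | _ => 0

/-- The Hochschild differential on the free abelian group on words. -/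
def freeWordBoundary (q : Q) : FreeWords q →ₗ[ℤ] FreeWords q :=
  Finsupp.linearCombination ℤ wordBoundary

/-- The ad hoc Goodwillie map on the free abelian group on words. -/
def freeGoodwillie (q : Q) : FreeWords q →ₗ[ℤ] FreeChains (FreeLoop Q) :=
  Finsupp.linearCombination ℤ goodwillieWord

/-! Compatibility of these operators with the relations. -/

theorem ev_cubeMul (σ τ : Cube (BasedLoop q)) (t : ℕ → 𝕀) :
    ev (cubeMul σ τ) t = concat q (ev σ t, ev τ fun i => t (σ.1 + i)) := rfl

theorem ev_cubeVee (σ τ : Cube (BasedLoop q)) (t : ℕ → 𝕀) :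
    ev (cubeVee σ τ) t = sharp q (ev σ t, ev τ (fun i => t (σ.1 + i)), t (σ.1 + τ.1)) := rfl

theorem ev_update_of_le (σ : Cube (BasedLoop q)) (t : ℕ → 𝕀) {k : ℕ} (h : σ.1 ≤ k) (x : 𝕀) :
    ev σ (Function.update t k x) = ev σ t :=
  ev_congr σ fun i hi => Function.update_of_ne (by omega) _ _

theorem update_shift (t : ℕ → 𝕀) (n k : ℕ) (x : 𝕀) :
    (fun i => Function.update t (n + k) x (n + i)) = Function.update (fun i => t (n + i)) k x := by
  ext i
  by_cases h : i = k
  · subst h; simp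
  · rw [Function.update_of_ne h, Function.update_of_ne (by omega)]

theorem update_shift_lt (t : ℕ → 𝕀) {n k : ℕ} (h : k < n) (x : 𝕀) :
    (fun i => Function.update t k x (n + i)) = fun i => t (n + i) := by
  ext i
  rw [Function.update_of_ne (by omega)]

theorem isDegenerate_cubeMul {σ τ : Cube (BasedLoop q)} (h : IsDegenerate σ ∨ IsDegenerate τ) :
    IsDegenerate (cubeMul σ τ) := by
  rw [isDegenerate_iff] at h ⊢
  rcases h with h | h
  · obtain ⟨k, hk, h⟩ := h
    refine ⟨k, by change k < σ.1 + τ.1; omega, fun t x => ?_⟩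
    rw [ev_cubeMul, ev_cubeMul, h, update_shift_lt _ hk]
  · obtain ⟨k, hk, h⟩ := (isDegenerate_iff _).1 h
    refine ⟨σ.1 + k, by change σ.1 + k < σ.1 + τ.1; omega, fun t x => ?_⟩
    rw [ev_cubeMul, ev_cubeMul, update_shift, h, ev_update_of_le _ _ (by omega)]

theorem isDegenerate_cubeVee {σ τ : Cube (BasedLoop q)} (h : IsDegenerate σ ∨ IsDegenerate τ) :
    IsDegenerate (cubeVee σ τ) := by
  rw [isDegenerate_iff] at h ⊢
  rcases h with h | h
  · obtain ⟨k, hk, h⟩ := h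
    refine ⟨k, by change k < σ.1 + τ.1 + 1; omega, fun t x => ?_⟩
    rw [ev_cubeVee, ev_cubeVee, h, update_shift_lt _ hk, Function.update_of_ne (by omega)]
  · obtain ⟨k, hk, h⟩ := (isDegenerate_iff _).1 h
    refine ⟨σ.1 + k, by change σ.1 + k < σ.1 + τ.1 + 1; omega, fun t x => ?_⟩
    rw [ev_cubeVee, ev_cubeVee, update_shift, h, ev_update_of_le _ _ (by omega),
      Function.update_of_ne (by omega)]

theorem mu_mem {w : List (Cube (BasedLoop q))} (h : ∃ σ ∈ w, IsDegenerate σ) :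
    mu w ∈ degenerate (BasedLoop q) := by
  match w, h with
  | [], _ => exact zero_mem _
  | [σ], h => exact cubeBoundary_mem_degenerate (by simpa using h)
  | [σ, τ], h =>
    exact Submodule.smul_mem _ _ (single_mem_degenerate (isDegenerate_cubeMul (by simpa using h)))
  | _ :: _ :: _ :: _, _ => exact zero_mem _

theorem insertChain_single (pre post : List (Cube (BasedLoop q))) (σ : Cube (BasedLoop q)) :
    insertChain pre post (Finsupp.single σ 1) = Finsupp.single (pre ++ σ :: post) 1 := by
  simp [insertChain]

theorem insertChain_mem_of_mem (pre post : List (Cube (BasedLoop q)))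
    {x : FreeChains (BasedLoop q)} (h : x ∈ degenerate (BasedLoop q)) :
    insertChain pre post x ∈ degenerateWords q := by
  have : degenerate (BasedLoop q) ≤ (degenerateWords q).comap (insertChain pre post) := by
    rw [degenerate, Submodule.span_le]
    rintro _ ⟨σ, h, rfl⟩
    simp only [SetLike.mem_coe, Submodule.mem_comap, insertChain_single]
    exact Submodule.subset_span ⟨_, ⟨σ, by simp, h⟩, rfl⟩
  exact this h

theorem insertChain_mem {pre post : List (Cube (BasedLoop q))}
    (h : ∃ σ, (σ ∈ pre ∨ σ ∈ post) ∧ IsDegenerate σ) (x : FreeChains (BasedLoop q)) :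
    insertChain pre post x ∈ degenerateWords q := by
  obtain ⟨σ, h, h'⟩ := h
  induction x using Finsupp.induction_linear with
  | zero => simp
  | add x y hx hy => rw [map_add]; exact add_mem hx hy
  | single τ a =>
    have : (Finsupp.single τ a : FreeChains (BasedLoop q)) = a • Finsupp.single τ 1 := by simp
    rw [this, map_smul, insertChain_single]
    exact Submodule.smul_mem _ _ (Submodule.subset_span
      ⟨_, ⟨σ, by rcases h with h | h <;> simp [h], h'⟩, rfl⟩)

theorem degenerateWords_le :
    degenerateWords q ≤ (degenerateWords q).comap (freeWordBoundary q) := by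
  rw [degenerateWords, Submodule.span_le]
  rintro _ ⟨w, ⟨σ, hσ, h⟩, rfl⟩
  simp only [SetLike.mem_coe, Submodule.mem_comap, freeWordBoundary,
    Finsupp.linearCombination_single, one_smul]
  refine Submodule.sum_mem _ fun i _ => Submodule.sum_mem _ fun j _ =>
    add_mem (Submodule.smul_mem _ _ ?_) (Submodule.smul_mem _ _ ?_)
  all_goals
    have hw : w.take i ++ ((w.drop i).take j ++ w.drop (i + j)) = w := by
      rw [← List.drop_drop, List.take_append_drop, List.take_append_drop]
    rw [← hw] at hσ
    simp only [List.mem_append] at hσ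
  · rcases hσ with hσ | hσ | hσ
    · exact insertChain_mem ⟨σ, Or.inl hσ, h⟩ _
    · exact insertChain_mem_of_mem _ _ (mu_mem ⟨σ, hσ, h⟩)
    · exact insertChain_mem ⟨σ, Or.inr hσ, h⟩ _
  · rcases hσ with hσ | hσ | hσ
    · exact insertChain_mem_of_mem _ _ (mu_mem ⟨σ, by simp [hσ], h⟩)
    · exact insertChain_mem ⟨σ, Or.inl hσ, h⟩ _
    · exact insertChain_mem_of_mem _ _ (mu_mem ⟨σ, by simp [hσ], h⟩)

theorem freeGoodwillie_single (w : List (Cube (BasedLoop q))) :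
    freeGoodwillie q (Finsupp.single w 1) = goodwillieWord w := by
  simp [freeGoodwillie]

theorem degenerateWords_le_goodwillie :
    degenerateWords q ≤ (relations (FreeLoop Q)).comap (freeGoodwillie q) := by
  rw [degenerateWords, Submodule.span_le]
  rintro _ ⟨w, h, rfl⟩
  simp only [SetLike.mem_coe, Submodule.mem_comap, freeGoodwillie_single]
  refine (le_sup_left : degenerate _ ≤ relations _) ?_
  match w, h with
  | [], _ => exact zero_mem _
  | [σ], h =>
    have h : IsDegenerate σ := by simpa using h
    obtain ⟨k, h⟩ := h
    exact Submodule.smul_mem _ _ (single_mem_degenerate ⟨k, fun t x => congrArg (inclusion q) (h t x)⟩)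
  | [σ, τ], h =>
    exact Submodule.neg_mem _ (single_mem_degenerate (isDegenerate_cubeVee (by simpa using h)))
  | _ :: _ :: _ :: _, _ => exact zero_mem _

/-! Reordering blocks of coordinates. -/

def blockSwap (p i j : ℕ) (l : ℕ) : ℕ :=
  if l < p then l else if l < p + i then l + j else if l < p + i + j then l - i else l

/-- The cube obtained from `σ` by the substitution of coordinates `r`. -/
def reCube {X : Type u} [TopologicalSpace X] (σ : Cube X) (r : ℕ → ℕ) : Cube X :=
  ⟨σ.1, ⟨fun t => ev σ fun l => if h : r l < σ.1 then t ⟨r l, h⟩ else 0, by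
    refine σ.2.continuous.comp (continuous_pi fun i => ?_)
    change Continuous fun t : Fin σ.1 → 𝕀 => if h : r i < σ.1 then t ⟨r i, h⟩ else 0
    split_ifs
    · exact continuous_apply _
    · exact continuous_const⟩⟩

theorem ev_reCube {X : Type u} [TopologicalSpace X] (σ : Cube X) (r : ℕ → ℕ)
    (h : ∀ l < σ.1, r l < σ.1) (t : ℕ → 𝕀) : ev (reCube σ r) t = ev σ (t ∘ r) := by
  change ev σ (fun l => if _ : r l < σ.1 then t (r l) else 0) = _
  exact ev_congr σ fun i hi => by simp [h i hi]

theorem blockSwap_lt {p i j n : ℕ} (h : p + i + j ≤ n) (l : ℕ) (hl : l < n) :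
    blockSwap p i j l < n := by
  unfold blockSwap
  split_ifs <;> omega

theorem blockSwap_one {X : Type u} [TopologicalSpace X] (i : ℕ) : ∀ (p : ℕ) (σ τ : Cube X),
    p + i + 1 ≤ σ.1 → τ.1 = σ.1 → (∀ t, ev τ t = ev σ (t ∘ blockSwap p i 1)) →
    (Finsupp.single τ 1 - (-1 : ℤ) ^ i • Finsupp.single σ 1 : FreeChains X) ∈ permuting X := by
  induction i with
  | zero =>
    intro p σ τ _ h e
    have : τ = σ := by
      refine cube_ext h fun t => ?_
      rw [e]
      congr 1
      ext l
      simp only [Function.comp, blockSwap]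
      split_ifs <;> first | rfl | omega
    simp [this]
  | succ i ih =>
    intro p σ τ hp h e
    have h1 := ih (p + 1) σ (reCube σ (blockSwap (p + 1) i 1)) (by omega) rfl
      (ev_reCube _ _ (blockSwap_lt (by omega)))
    have h2 := mem_permuting (reCube σ (blockSwap (p + 1) i 1)) τ p
      (by change p + 1 < σ.1; omega) h (fun t => by
        rw [e, ev_reCube _ _ (blockSwap_lt (by omega))]
        congr 1
        ext l
        simp only [Function.comp, blockSwap, Equiv.swap_apply_def]
        split_ifs <;> first | rfl | omega | (congr 2; omega))
    have := sub_mem h2 h1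
    convert this using 1
    rw [pow_succ, mul_neg_one, neg_smul]
    abel

theorem blockSwap_mem {X : Type u} [TopologicalSpace X] (j : ℕ) : ∀ (i p : ℕ) (σ τ : Cube X),
    p + i + j ≤ σ.1 → τ.1 = σ.1 → (∀ t, ev τ t = ev σ (t ∘ blockSwap p i j)) →
    (Finsupp.single τ 1 - (-1 : ℤ) ^ (i * j) • Finsupp.single σ 1 : FreeChains X) ∈
      permuting X := by
  induction j with
  | zero =>
    intro i p σ τ _ h e
    have : τ = σ := by
      refine cube_ext h fun t => ?_
      rw [e]
      congr 1
      ext l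
      simp only [Function.comp, blockSwap]
      split_ifs <;> first | rfl | omega
    simp [this]
  | succ j ih =>
    intro i p σ τ hp h e
    have h1 := blockSwap_one i p σ (reCube σ (blockSwap p i 1)) (by omega) rfl
      (ev_reCube _ _ (blockSwap_lt (by omega)))
    have h2 := ih i (p + 1) (reCube σ (blockSwap p i 1)) τ
      (by change p + 1 + i + j ≤ σ.1; omega) h (fun t => by
        rw [e, ev_reCube _ _ (blockSwap_lt (by omega))]
        congr 1
        ext l
        simp only [Function.comp, blockSwap]
        split_ifs <;> first | rfl | omega | (congr 2; omega))
    have := add_mem h2 (Submodule.smul_mem _ ((-1 : ℤ) ^ (i * j)) h1)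
    convert this using 1
    rw [smul_sub, smul_smul, ← pow_add, mul_add, mul_one]
    abel

/-! The chain map equation. -/

theorem mkQ_blockSwap {X : Type u} [TopologicalSpace X] {p i j : ℕ} {σ τ : Cube X}
    (hp : p + i + j ≤ σ.1) (h : τ.1 = σ.1) (e : ∀ t, ev τ t = ev σ (t ∘ blockSwap p i j)) :
    (relations X).mkQ (Finsupp.single τ 1) =
      (-1 : ℤ) ^ (i * j) • (relations X).mkQ (Finsupp.single σ 1) := by
  rw [← map_smul, ← sub_eq_zero, ← map_sub, Submodule.mkQ_apply, Submodule.Quotient.mk_eq_zero]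
  exact (le_sup_right.trans le_sup_right : permuting X ≤ relations X)
    (blockSwap_mem j i p σ τ hp h e)

theorem sharp_congr {α β α' β' : BasedLoop q} {t t' : 𝕀} (h1 : α = α') (h2 : β = β')
    (h3 : t = t') : sharp q (α, β, t) = sharp q (α', β', t') := by
  rw [h1, h2, h3]

theorem concat_congr {α β α' β' : BasedLoop q} (h1 : α = α') (h2 : β = β') :
    concat q (α, β) = concat q (α', β') := by
  rw [h1, h2]

theorem vee_last_one (σ τ : Cube (BasedLoop q)) : (relations (FreeLoop Q)).mkQ
    (Finsupp.single (fc (cubeVee σ τ) (σ.1 + τ.1) 1) 1) =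
      (-1 : ℤ) ^ (σ.1 * τ.1) • (relations (FreeLoop Q)).mkQ (Finsupp.single
        ⟨(cubeMul τ σ).1, (inclusion q).comp (cubeMul τ σ).2⟩ 1) := by
  rw [mul_comm]
  refine mkQ_blockSwap (p := 0) (i := τ.1) (j := σ.1) (by change _ ≤ τ.1 + σ.1; omega)
    (by change σ.1 + τ.1 + 1 - 1 = τ.1 + σ.1; omega) fun t => ?_
  rw [ev_fc _ (by change _ < σ.1 + τ.1 + 1; omega), ev_cubeVee]
  have h : ins (σ.1 + τ.1) 1 t (σ.1 + τ.1) = 1 := by simp [ins]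
  rw [h, sharp_one]
  change _ = inclusion q (ev (cubeMul τ σ) _)
  rw [ev_cubeMul]
  congr 3
  · refine ev_congr _ fun i hi => ?_
    have h1 : i < 0 + τ.1 := by omega
    have h2 : σ.1 + i < σ.1 + τ.1 := by omega
    simp [ins, blockSwap, hi, h2, add_comm i]
  · refine ev_congr _ fun i hi => ?_
    have h1 : i < σ.1 + τ.1 := by omega
    have h2 : τ.1 + i < τ.1 + σ.1 := by omega
    simp [ins, blockSwap, hi, h1]

theorem vee_last_zero (σ τ : Cube (BasedLoop q)) : fc (cubeVee σ τ) (σ.1 + τ.1) 0 =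
    ⟨(cubeMul σ τ).1, (inclusion q).comp (cubeMul σ τ).2⟩ := by
  refine cube_ext rfl fun t => ?_
  rw [ev_fc _ (show σ.1 + τ.1 < (cubeVee σ τ).1 from Nat.lt_succ_self _), ev_cubeVee]
  have h : ins (σ.1 + τ.1) 0 t (σ.1 + τ.1) = 0 := by simp [ins]
  rw [h, sharp_zero]
  change _ = inclusion q (ev (cubeMul σ τ) _)
  rw [ev_cubeMul]
  congr 3
  · refine ev_congr _ fun i hi => ?_
    have h1 : i < σ.1 + τ.1 := by omega
    simp [ins, h1]
  · refine ev_congr _ fun i hi => ?_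
    simp [ins, hi]

theorem vee_left (σ τ : Cube (BasedLoop q)) {k : ℕ} (hk : k < σ.1) (ε : 𝕀) :
    fc (cubeVee σ τ) k ε = cubeVee (fc σ k ε) τ := by
  have h0 : (fc σ k ε).1 = σ.1 - 1 := rfl
  refine cube_ext (by change σ.1 + τ.1 + 1 - 1 = σ.1 - 1 + τ.1 + 1; omega) fun t => ?_
  rw [ev_fc _ (by change _ < σ.1 + τ.1 + 1; omega), ev_cubeVee, ev_cubeVee, ev_fc _ hk, h0]
  refine sharp_congr rfl ?_ ?_
  · refine ev_congr _ fun i hi => ?_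
    have h1 : ¬ σ.1 + i < k := by omega
    have h2 : ¬ σ.1 + i = k := by omega
    simp only [ins, h1, h2, if_false]
    congr 1; omega
  · have h1 : ¬ σ.1 + τ.1 < k := by omega
    have h2 : ¬ σ.1 + τ.1 = k := by omega
    simp only [ins, h1, h2, if_false]
    congr 1; omega

theorem vee_right (σ τ : Cube (BasedLoop q)) {k : ℕ} (hk : k < τ.1) (ε : 𝕀) :
    fc (cubeVee σ τ) (σ.1 + k) ε = cubeVee σ (fc τ k ε) := by
  have h0 : (fc τ k ε).1 = τ.1 - 1 := rfl
  refine cube_ext (by change σ.1 + τ.1 + 1 - 1 = σ.1 + (τ.1 - 1) + 1; omega) fun t => ?_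
  rw [ev_fc _ (by change _ < σ.1 + τ.1 + 1; omega), ev_cubeVee, ev_cubeVee, ev_fc _ hk, h0]
  refine sharp_congr ?_ ?_ ?_
  · refine ev_congr _ fun i hi => ?_
    have h1 : i < σ.1 + k := by omega
    simp [ins, h1]
  · congr 1
    ext i
    simp only [ins]
    split_ifs <;> first | rfl | omega | (congr 2; omega)
  · have h1 : ¬ σ.1 + τ.1 < σ.1 + k := by omega
    have h2 : ¬ σ.1 + τ.1 = σ.1 + k := by omega
    simp only [ins, h1, h2, if_false]
    congr 1; omega

theorem continuous_ev {X : Type u} [TopologicalSpace X] (σ : Cube X) {T : Type*}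
    [TopologicalSpace T] {g : T → ℕ → 𝕀} (hg : ∀ i, Continuous fun x => g x i) :
    Continuous fun x => ev σ (g x) := by
  have : Continuous fun x => fun i : Fin σ.1 => g x i := continuous_pi fun i => hg i
  exact σ.2.continuous.comp this

theorem vee_mul (α β γ : Cube (BasedLoop q)) :
    (relations (FreeLoop Q)).mkQ (Finsupp.single (cubeVee (cubeMul α β) γ) 1) =
      (relations (FreeLoop Q)).mkQ (Finsupp.single (cubeVee α (cubeMul β γ)) 1) +
      (-1 : ℤ) ^ (α.1 * (β.1 + γ.1)) •
        (relations (FreeLoop Q)).mkQ (Finsupp.single (cubeVee β (cubeMul γ α)) 1) := by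
  set m := α.1 + β.1 + γ.1 with hm
  have hαβ : (cubeMul α β).1 = α.1 + β.1 := rfl
  have hβγ : (cubeMul β γ).1 = β.1 + γ.1 := rfl
  have hγα : (cubeMul γ α).1 = γ.1 + α.1 := rfl
  let x : (Fin m → 𝕀) → ℕ → 𝕀 := fun t i => if h : i < m then t ⟨i, h⟩ else 0
  have hx : ∀ i, Continuous fun t => x t i := by
    intro i
    simp only [x]
    split_ifs
    · exact continuous_apply _
    · exact continuous_const
  let f : C(Fin m → 𝕀, 𝕀) :=
    ⟨fun t => frac (ev α (x t)) (ev β fun i => x t (α.1 + i)),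
      continuous_frac (continuous_ev α fun i => hx i) (continuous_ev β fun i => hx _)⟩
  have hf : ∀ t : ℕ → 𝕀, f (fun i => t i) = frac (ev α t) (ev β fun i => t (α.1 + i)) := by
    intro t
    change frac (ev α _) (ev β _) = _
    congr 1
    · refine ev_congr _ fun i hi => ?_
      have : i < m := by omega
      simp [x, this]
    · refine ev_congr _ fun i hi => ?_
      have : α.1 + i < m := by omega
      simp [x, this]
  have evW : ∀ (t : ℕ → 𝕀) (y : 𝕀), ev (cubeVee (cubeMul α β) γ) (Function.update t m y) =
      sharp q (concat q (ev α t, ev β fun i => t (α.1 + i)),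
        ev γ fun i => t (α.1 + β.1 + i), y) := by
    intro t y
    rw [ev_cubeVee, ev_cubeMul, hαβ, ← hm, Function.update_self]
    refine sharp_congr (concat_congr ?_ ?_) ?_ rfl
    · exact ev_update_of_le _ _ (by omega) _
    · exact ev_congr _ fun i hi => Function.update_of_ne (by omega) _ _
    · exact ev_congr _ fun i hi => Function.update_of_ne (by omega) _ _
  let U := reCube (cubeVee β (cubeMul γ α)) (blockSwap 0 (β.1 + γ.1) α.1)
  have hU : ∀ t, ev U t = ev (cubeVee β (cubeMul γ α)) (t ∘ blockSwap 0 (β.1 + γ.1) α.1) :=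
    ev_reCube _ _ (blockSwap_lt (by change _ ≤ β.1 + (γ.1 + α.1) + 1; omega))
  have key := mem_fitting m f (cubeVee (cubeMul α β) γ) (cubeVee α (cubeMul β γ)) U rfl
    (by change α.1 + (β.1 + γ.1) + 1 = _; omega)
    (by change β.1 + (γ.1 + α.1) + 1 = _; omega)
    (fun t => by
      rw [evW, hf, sharp_lower, ev_cubeVee, ev_cubeMul, hβγ]
      refine sharp_congr rfl (concat_congr rfl ?_) ?_
      · exact ev_congr _ fun i hi => congrArg t (by omega)
      · exact congrArg t (by omega))
    (fun t => by
      rw [evW, hf, sharp_upper, hU, ev_cubeVee, ev_cubeMul, hγα]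
      refine sharp_congr ?_ (concat_congr ?_ ?_) ?_
      · refine ev_congr _ fun i hi => ?_
        have h1 : i < 0 + (β.1 + γ.1) := by omega
        simp only [Function.comp, blockSwap, h1, if_true, Nat.not_lt_zero, if_false]
        congr 1
        omega
      · refine ev_congr _ fun i hi => ?_
        have h1 : β.1 + i < 0 + (β.1 + γ.1) := by omega
        simp only [Function.comp, blockSwap, h1, if_true, Nat.not_lt_zero, if_false]
        congr 1
        omega
      · refine ev_congr _ fun i hi => ?_
        have h1 : ¬ β.1 + (γ.1 + i) < 0 + (β.1 + γ.1) := by omega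
        have h2 : β.1 + (γ.1 + i) < 0 + (β.1 + γ.1) + α.1 := by omega
        simp only [Function.comp, blockSwap, h1, h2, if_true, Nat.not_lt_zero, if_false]
        congr 1
        omega
      · have h1 : ¬ β.1 + (γ.1 + α.1) < 0 + (β.1 + γ.1) := by omega
        have h2 : ¬ β.1 + (γ.1 + α.1) < 0 + (β.1 + γ.1) + α.1 := by omega
        simp only [Function.comp, blockSwap, h1, h2, Nat.not_lt_zero, if_false]
        congr 1
        omega)
  have key' : (relations (FreeLoop Q)).mkQ (Finsupp.single U 1) = (-1 : ℤ) ^ (α.1 * (β.1 + γ.1)) •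
        (relations (FreeLoop Q)).mkQ (Finsupp.single (cubeVee β (cubeMul γ α)) 1) := by
    rw [mul_comm]
    exact mkQ_blockSwap (by change _ ≤ β.1 + (γ.1 + α.1) + 1; omega) rfl hU
  rw [← key', ← map_add, eq_comm, ← sub_eq_zero, ← map_sub, Submodule.mkQ_apply,
    Submodule.Quotient.mk_eq_zero]
  exact (le_sup_left.trans le_sup_right : fitting _ ≤ relations _) key

theorem freeGoodwillie_insert_nil (τ : Cube (BasedLoop q)) :
    freeGoodwillie q (insertChain [] [] (Finsupp.single τ 1)) =
      (-1 : ℤ) ^ τ.1 • push (inclusion q) (Finsupp.single τ 1) := by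
  rw [insertChain_single, freeGoodwillie_single, push_single]
  rfl

theorem freeGoodwillie_insert_right (σ τ : Cube (BasedLoop q)) :
    freeGoodwillie q (insertChain [] [σ] (Finsupp.single τ 1)) =
      - Finsupp.single (cubeVee τ σ) 1 := by
  rw [insertChain_single, freeGoodwillie_single]
  rfl

theorem freeGoodwillie_insert_left (σ τ : Cube (BasedLoop q)) :
    freeGoodwillie q (insertChain [σ] [] (Finsupp.single τ 1)) =
      - Finsupp.single (cubeVee σ τ) 1 := by
  rw [insertChain_single, freeGoodwillie_single]
  rfl

theorem freeGoodwillie_insert_long {pre post : List (Cube (BasedLoop q))}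
    (h : 2 ≤ pre.length + post.length) (x : FreeChains (BasedLoop q)) :
    freeGoodwillie q (insertChain pre post x) = 0 := by
  have key : ∀ σ : Cube (BasedLoop q), goodwillieWord (pre ++ σ :: post) = 0 := by
    intro σ
    match pre, post, h with
    | [], [], h => simp at h
    | [], [_], h => simp at h
    | [], _ :: _ :: _, _ => rfl
    | [_], [], h => simp at h
    | [_], _ :: _, _ => rfl
    | [_, _], _, _ => simp [goodwillieWord]
    | _ :: _ :: _ :: _, _, _ => rfl
  induction x using Finsupp.induction_linear with
  | zero => simp
  | add x y hx hy => rw [map_add, map_add, hx, hy, add_zero]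
  | single τ a =>
    have : (Finsupp.single τ a : FreeChains (BasedLoop q)) = a • Finsupp.single τ 1 := by simp
    rw [this, map_smul, map_smul, insertChain_single, freeGoodwillie_single, key, smul_zero]

theorem freeGoodwillie_boundary_nil (σ : Cube (BasedLoop q)) :
    freeGoodwillie q (insertChain [] [] (cubeBoundary σ)) =
      - ((-1 : ℤ) ^ σ.1 • push (inclusion q) (cubeBoundary σ)) := by
  rw [cubeBoundary_eq]
  simp only [map_sum, map_smul, map_sub]
  rw [Finset.smul_sum, ← Finset.sum_neg_distrib]
  refine Finset.sum_congr rfl fun k hk => ?_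
  rw [Finset.mem_range] at hk
  have h : (-1 : ℤ) ^ σ.1 = - (-1) ^ (σ.1 - 1) := by
    obtain ⟨n, hn⟩ : ∃ n, σ.1 = n + 1 := ⟨σ.1 - 1, by omega⟩
    rw [hn, pow_succ]
    simp
  have h' : ∀ ε, (fc σ k ε).1 = σ.1 - 1 := fun _ => rfl
  rw [freeGoodwillie_insert_nil, freeGoodwillie_insert_nil, h', h', h, ← smul_sub, neg_smul,
    neg_neg, smul_comm]

theorem mu_long {w : List (Cube (BasedLoop q))} (h : 3 ≤ w.length) : mu w = 0 := by
  match w, h with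
  | _ :: _ :: _ :: _, _ => rfl

theorem goodwillieWord_long {w : List (Cube (BasedLoop q))} (h : 3 ≤ w.length) :
    goodwillieWord w = 0 := by
  match w, h with
  | _ :: _ :: _ :: _, _ => rfl

theorem wordBoundary_one (σ : Cube (BasedLoop q)) :
    wordBoundary [σ] = - insertChain [] [] (cubeBoundary σ) := by
  simp [wordBoundary, mu, reducedDegree]

theorem wordBoundary_two (σ τ : Cube (BasedLoop q)) :
    wordBoundary [σ, τ] = insertChain [] [τ] (cubeBoundary σ) +
      (-1 : ℤ) ^ σ.1 • insertChain [σ] [] (cubeBoundary τ) +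
      insertChain [] [] (Finsupp.single (cubeMul σ τ) 1) +
      (-1 : ℤ) ^ (σ.1 * τ.1 + 1) • insertChain [] [] (Finsupp.single (cubeMul τ σ) 1) := by
  have e1 : (-1 : ℤ) ^ (σ.1 + 1 + 1) * (-1) ^ σ.1 = 1 := by
    rw [← pow_add]
    exact Even.neg_one_pow ⟨σ.1 + 1, by ring⟩
  have e2 : (-1 : ℤ) ^ (σ.1 + 1 + 1) = (-1) ^ σ.1 := by
    rw [pow_succ, pow_succ]; ring
  have e3 : (-1 : ℤ) ^ ((σ.1 + 1) * (1 + (τ.1 + 1)) + 1) * (-1) ^ τ.1 =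
      (-1) ^ (σ.1 * τ.1 + 1) := by
    rw [← pow_add, show (σ.1 + 1) * (1 + (τ.1 + 1)) + 1 + τ.1 =
      (σ.1 * τ.1 + 1) + 2 * (σ.1 + τ.1 + 1) by ring, pow_add _ _ (2 * _), pow_mul]
    simp
  simp [-Finsupp.smul_single, wordBoundary, mu, reducedDegree, Finset.sum_range_succ]
  rw [smul_smul, smul_smul, e1, e2, e3, one_smul]
  abel

theorem wordBoundary_three (α β γ : Cube (BasedLoop q)) :
    freeGoodwillie q (wordBoundary [α, β, γ]) =
      - ((-1 : ℤ) ^ α.1 • Finsupp.single (cubeVee (cubeMul α β) γ) 1) +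
      (-1 : ℤ) ^ α.1 • Finsupp.single (cubeVee α (cubeMul β γ)) 1 +
      (-1 : ℤ) ^ (α.1 + α.1 * (β.1 + γ.1)) • Finsupp.single (cubeVee β (cubeMul γ α)) 1 := by
  have e1 : (-1 : ℤ) ^ (β.1 + 1 + (α.1 + 1) + 1) * (-1) ^ β.1 = - (-1) ^ α.1 := by
    rw [← pow_add, show β.1 + 1 + (α.1 + 1) + 1 + β.1 = α.1 + 1 + 2 * (β.1 + 1) by ring,
      pow_add _ _ (2 * _), pow_mul, pow_succ]
    simp
  have e3 : (-1 : ℤ) ^ ((α.1 + 1) * (1 + (β.1 + 1 + (γ.1 + 1))) + (β.1 + 1) + 1) *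
      (-1) ^ γ.1 = - (-1) ^ (α.1 + α.1 * (β.1 + γ.1)) := by
    rw [← pow_add, show (α.1 + 1) * (1 + (β.1 + 1 + (γ.1 + 1))) + (β.1 + 1) + 1 + γ.1 =
      α.1 + α.1 * (β.1 + γ.1) + 1 + 2 * (α.1 + β.1 + γ.1 + 2) by ring,
      pow_add _ _ (2 * _), pow_mul, pow_succ]
    simp
  simp [-Finsupp.smul_single, wordBoundary, mu, reducedDegree, Finset.sum_range_succ,
    freeGoodwillie_insert_long, freeGoodwillie_insert_left, freeGoodwillie_insert_right]
  rw [smul_smul, smul_smul, e1, e3, neg_smul, neg_smul]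
  abel

theorem wordBoundary_long {w : List (Cube (BasedLoop q))} (h : 4 ≤ w.length) :
    freeGoodwillie q (wordBoundary w) = 0 := by
  rw [wordBoundary, map_sum]
  refine Finset.sum_eq_zero fun i hi => ?_
  rw [map_sum]
  refine Finset.sum_eq_zero fun j hj => ?_
  rw [Finset.mem_range] at hi hj
  rw [map_add, map_smul, map_smul]
  have h1 : freeGoodwillie q (insertChain (w.take i) (w.drop (i + j))
      (mu ((w.drop i).take j))) = 0 := by
    by_cases hj2 : j ≤ 2
    · exact freeGoodwillie_insert_long (by simp; omega) _
    · rw [mu_long (by simp; omega), map_zero, map_zero]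
  have h2 : freeGoodwillie q (insertChain ((w.drop i).take j) []
      (mu (w.drop (i + j) ++ w.take i))) = 0 := by
    by_cases hj2 : 2 ≤ j
    · exact freeGoodwillie_insert_long (by simp; omega) _
    · rw [mu_long (by simp; omega), map_zero, map_zero]
  rw [h1, h2, smul_zero, smul_zero, add_zero]

theorem boundary_vee (σ τ : Cube (BasedLoop q)) :
    (relations (FreeLoop Q)).mkQ (cubeBoundary (cubeVee σ τ)) =
      - (relations (FreeLoop Q)).mkQ (freeGoodwillie q (wordBoundary [σ, τ])) := by
  have hl : freeGoodwillie q (insertChain [] [τ] (cubeBoundary σ)) =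
      - ∑ k ∈ Finset.range σ.1, (-1 : ℤ) ^ k • (Finsupp.single (fc (cubeVee σ τ) k 1) 1 -
        Finsupp.single (fc (cubeVee σ τ) k 0) 1) := by
    rw [cubeBoundary_eq]
    simp only [map_sum, map_smul, map_sub, freeGoodwillie_insert_right]
    rw [← Finset.sum_neg_distrib]
    refine Finset.sum_congr rfl fun k hk => ?_
    rw [Finset.mem_range] at hk
    rw [vee_left _ _ hk, vee_left _ _ hk, ← smul_neg]
    congr 1
    abel
  have hr : freeGoodwillie q ((-1 : ℤ) ^ σ.1 • insertChain [σ] [] (cubeBoundary τ)) =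
      - ∑ k ∈ Finset.range τ.1, (-1 : ℤ) ^ (σ.1 + k) •
        (Finsupp.single (fc (cubeVee σ τ) (σ.1 + k) 1) 1 -
          Finsupp.single (fc (cubeVee σ τ) (σ.1 + k) 0) 1) := by
    rw [cubeBoundary_eq]
    simp only [map_sum, map_smul, map_sub, freeGoodwillie_insert_left]
    rw [← Finset.sum_neg_distrib, Finset.smul_sum]
    refine Finset.sum_congr rfl fun k hk => ?_
    rw [Finset.mem_range] at hk
    rw [vee_right _ _ hk, vee_right _ _ hk, ← smul_neg, smul_smul, ← pow_add]
    congr 1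
    abel
  have hm : (cubeMul σ τ).1 = σ.1 + τ.1 := rfl
  have hm' : (cubeMul τ σ).1 = σ.1 + τ.1 := add_comm _ _
  rw [wordBoundary_two, map_add (freeGoodwillie q), map_add (freeGoodwillie q),
    map_add (freeGoodwillie q), hl, hr, cubeBoundary_eq,
    show (cubeVee σ τ).1 = σ.1 + τ.1 + 1 from rfl, Finset.sum_range_succ, Finset.sum_range_add]
  simp only [map_add, map_sub, map_neg, map_smul, vee_last_one, vee_last_zero,
    freeGoodwillie_insert_nil, push_single, hm, hm', smul_sub, smul_smul, pow_succ, pow_add]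
  simp only [mul_neg, mul_one, neg_mul, neg_smul]
  rw [show (-1 : ℤ) ^ (σ.1 * τ.1) * ((-1) ^ σ.1 * (-1) ^ τ.1) =
    (-1) ^ σ.1 * (-1) ^ τ.1 * (-1) ^ (σ.1 * τ.1) by ring]
  abel

theorem goodwillie_chain_map : (relations (FreeLoop Q)).mkQ ∘ₗ freeGoodwillie q ∘ₗ
    freeWordBoundary q = (relations (FreeLoop Q)).mkQ ∘ₗ freeBoundary (FreeLoop Q) ∘ₗ
      freeGoodwillie q := by
  ext1 w
  ext1
  simp only [LinearMap.comp_apply, Finsupp.lsingle_apply, freeGoodwillie_single]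
  rw [show freeWordBoundary q (Finsupp.single w 1) = wordBoundary w by simp [freeWordBoundary]]
  match w with
  | [] => simp [wordBoundary, goodwillieWord]
  | [σ] =>
    rw [wordBoundary_one, map_neg, freeGoodwillie_boundary_nil, neg_neg, goodwillieWord,
      ← push_single, map_smul, map_smul, map_smul]
    have := LinearMap.congr_fun (push_boundary (inclusion q)) (Finsupp.single σ 1)
    simp only [LinearMap.comp_apply, freeBoundary_single] at this
    rw [this]
  | [σ, τ] =>
    rw [goodwillieWord, map_neg, map_neg, freeBoundary_single, boundary_vee, neg_neg]
  | [α, β, γ] =>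
    rw [wordBoundary_three, goodwillieWord_long (by simp), map_zero, map_zero]
    simp only [map_add, map_neg, map_smul, vee_mul, smul_add, smul_smul, pow_add]
    abel
  | a :: b :: c :: d :: l =>
    rw [wordBoundary_long (by simp), goodwillieWord_long (by simp), map_zero, map_zero, map_zero]

/-- The degree of the word `a_d ⊗ ⋯ ⊗ a_1`, where `a_d` has its usual degree and the other letters
have their shifted degree. Degrees are homological, so that a letter of dimension `i`, which has
cohomological degree `-i`, contributes `i` if it is `a_d` and `i + 1` otherwise. -/
def wordDegree (w : List (Cube (BasedLoop q))) : ℕ := (w.map fun σ => σ.1).sum + (w.length - 1)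

/-- The cyclic bar complex `CC_*(C_{-*}(Ω_q Q))`, the direct sum over `d ≥ 1` of the tensor powers
`A ⊗ A[1]^{⊗ (d - 1)}` of `A = C_{-*}(Ω_q Q)`. As `A` is the free abelian group on all cubes modulo
the degenerate ones, its `d`-th tensor power is the free abelian group on words of length `d` modulo
those with a degenerate letter. (The empty word is excluded in the definition of the graded
pieces.) -/
abbrev CyclicBar (q : Q) : Type u := FreeWords q ⧸ degenerateWords q

/-- The part of the cyclic bar complex spanned by the nonempty words of degree `n`. -/
def cyclicBarDegree (q : Q) (n : ℕ) : Submodule ℤ (CyclicBar q) :=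
  (Submodule.span ℤ {c | ∃ w : List (Cube (BasedLoop q)), w ≠ [] ∧ wordDegree w = n ∧
    c = Finsupp.single w 1}).map (degenerateWords q).mkQ

/-- The Hochschild differential of the cyclic bar complex. -/
def cyclicBarBoundary (q : Q) : CyclicBar q →ₗ[ℤ] CyclicBar q :=
  (degenerateWords q).mapQ (degenerateWords q) (freeWordBoundary q) degenerateWords_le

/-- The Hochschild homology of `C_{-*}(Ω_q Q)` in homological degree `n`. -/
abbrev HochschildHomology (q : Q) (n : ℕ) : Type u :=
  Homology (cyclicBarDegree q) (cyclicBarBoundary q) n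

/-- The chain map `𝒢 : CC_*(C_{-*}(Ω_q Q)) → C^□_{-*}(ℒQ)`. -/
def goodwillieChain (q : Q) :
    CyclicBar q →ₗ[ℤ] (FreeChains (FreeLoop Q) ⧸ relations (FreeLoop Q)) :=
  (degenerateWords q).mapQ (relations (FreeLoop Q)) (freeGoodwillie q) degenerateWords_le_goodwillie

theorem goodwillieWord_mem {w : List (Cube (BasedLoop q))} (h : w ≠ []) :
    goodwillieWord w ∈ Submodule.span ℤ {c | ∃ σ : C(Fin (wordDegree w) → 𝕀, FreeLoop Q),
      c = Finsupp.single (⟨wordDegree w, σ⟩ : Cube (FreeLoop Q)) 1} := by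
  match w, h with
  | [σ], _ =>
    have hn : wordDegree [σ] = σ.1 := by simp [wordDegree]
    rw [hn]
    exact Submodule.smul_mem _ _ (Submodule.subset_span ⟨_, rfl⟩)
  | [σ, τ], _ =>
    have hn : wordDegree [σ, τ] = σ.1 + τ.1 + 1 := by simp [wordDegree]
    rw [hn]
    exact Submodule.neg_mem _ (Submodule.subset_span ⟨_, rfl⟩)
  | _ :: _ :: _ :: _, _ => exact zero_mem _

/-- The map `H(𝒢)` from the Hochschild homology of the chains on the based loop space to the
homology of the free loop space. -/
def goodwillieMap (q : Q) (n : ℕ) :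
    HochschildHomology q n →ₗ[ℤ] SquareHomology (FreeLoop Q) n :=
  homologyMap (goodwillieChain q)
    (by
      rintro n _ ⟨x, hx, rfl⟩
      refine ⟨freeGoodwillie q x, ?_, rfl⟩
      refine Submodule.span_induction ?_ ?_ ?_ ?_ hx
      · rintro _ ⟨w, hw, rfl, rfl⟩
        rw [freeGoodwillie_single]
        exact goodwillieWord_mem hw
      · simp
      · intro x y _ _ hx hy
        rw [map_add]
        exact add_mem hx hy
      · intro a x _ hx
        rw [map_smul]
        exact Submodule.smul_mem _ _ hx)
    (by
      refine LinearMap.ext fun x => ?_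
      obtain ⟨x, rfl⟩ := (degenerateWords q).mkQ_surjective x
      exact LinearMap.congr_fun goodwillie_chain_map x) n

end Hochschild

end

end LoopHochschild

namespace LoopHochschild

universe u v w

local notation "𝕀" => unitInterval

set_option linter.unusedSectionVars false

/-! At chain level, the inclusion of constant loops factors through 𝒢 up to homotopy, by way of a
chain map built from Adams' cubes of paths.

A connected manifold is path-connected, so every point can be joined to q. Moving the vertices of
all cubes along chosen paths deforms a cycle of Q, compatibly with faces, into one whose cubes have
all their vertices at q (`vertexRetraction`, `boundary_deformChain`). It remains to find, for such
cubes and compatibly with faces, a chain map W to the cyclic bar complex and a homotopy from 𝒢 ∘ W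
to the constant loops.

Let f : E → Q be a map on a linear space, and let u 0, …, u m be points over q. A path from u 0 to u
m carries out the m displacements u (i + 1) - u i, each in one unit of time, at starting times with
successive differences t k in [0, 1]. If t k = 0, two displacements are simultaneous and a vertex is
forgotten; if t k = 1, the path passes through that vertex and is a concatenation. The images in Q
form a cube of based loops of dimension m - 1 with the boundary of the cobar construction
(`cubeBoundary_edgeCube`). The signed sum over all ways of cutting a sequence of vertices into
letters is an element on which the bar differential is the alternating sum over omitted inner
vertices (`barDifferential_bars`). Cutting a closed polygon v 0, …, v (N - 1) in the same way, with
the letter that contains the edge from v (N - 1) to v 0 in the distinguished last place, gives a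
Hochschild chain whose differential is the full simplicial boundary
(`freeWordBoundary_cyclicChain`). A natural triangulation of the cube by ordered simplices turns
this into W.

Since 𝒢 kills words with three or more letters, 𝒢 ∘ W involves only two kinds of loops around the
polygon: those that start at a vertex and those that start on an arc between two vertices. Both are
images of closed paths in E. They form a chain `cycleChain` which, modulo the relations, again has
the simplicial boundary (`mkQ_boundary_cycleChain`) and which represents the image under 𝒢
(`mkQ_freeGoodwillie_cyclicChain`). Paths in a linear space form a contractible space, so the method
of acyclic models joins this chain to the constant loops, by induction over the standard cubes
(`boundary_modelHomotopy`). Transport to Q gives the homotopy (`mkQ_boundary_homotopy`).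

The deformation and W need not respect degenerate cubes. They are therefore defined on free chains,
and a homology class is first represented by a chain whose boundary is zero and not merely
degenerate (`exists_cycle_of_boundary_mem`). -/

noncomputable section

/-! ### Cubes in infinitely many coordinates, degrees, functoriality -/

section CubeTools

variable {X : Type u} {Y : Type v} {Z : Type w} [TopologicalSpace X] [TopologicalSpace Y]
  [TopologicalSpace Z]

/-- Extension of a finite sequence of coordinates by zeros. -/
def extendCoords (n : ℕ) (t : Fin n → 𝕀) : ℕ → 𝕀 := fun i => if h : i < n then t ⟨i, h⟩ else 0

theorem continuous_extendCoords (n : ℕ) : Continuous (extendCoords n) := by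
  refine continuous_pi fun i => ?_
  unfold extendCoords
  split_ifs
  · exact continuous_apply _
  · exact continuous_const

theorem extendCoords_apply {n : ℕ} (t : Fin n → 𝕀) {i : ℕ} (h : i < n) :
    extendCoords n t i = t ⟨i, h⟩ := dif_pos h

/-- The `n`-cube given by the first `n` coordinates of a function of infinitely many coordinates. -/
def cubeOf (n : ℕ) (φ : C(ℕ → 𝕀, X)) : Cube X :=
  ⟨n, φ.comp ⟨extendCoords n, continuous_extendCoords n⟩⟩

/-- In `cubeOf` the coordinates from the n-th on are replaced by zero, which is harmless if φ does
not read them. -/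
theorem ev_cubeOf (n : ℕ) (φ : C(ℕ → 𝕀, X)) (h : ∀ s t : ℕ → 𝕀, (∀ i < n, s i = t i) → φ s = φ t)
    (t : ℕ → 𝕀) : ev (cubeOf n φ) t = φ t :=
  h _ _ fun _ hi => extendCoords_apply (fun i : Fin n => t i) hi

/-- The homogeneous part of degree `n` of the free abelian group on cubes. -/
def degreePart (X : Type u) [TopologicalSpace X] (n : ℕ) : Submodule ℤ (FreeChains X) :=
  Submodule.span ℤ {c | ∃ σ : C(Fin n → 𝕀, X), c = Finsupp.single ⟨n, σ⟩ 1}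

theorem single_mem_degreePart {σ : Cube X} {n : ℕ} (h : σ.1 = n) :
    (Finsupp.single σ 1 : FreeChains X) ∈ degreePart X n := by
  obtain ⟨m, σ⟩ := σ
  obtain rfl : m = n := h
  exact Submodule.subset_span ⟨σ, rfl⟩

theorem degreePart_induction {n : ℕ} {p : FreeChains X → Prop}
    (single : ∀ σ : Cube X, σ.1 = n → p (Finsupp.single σ 1)) (zero : p 0)
    (add : ∀ x y, p x → p y → p (x + y)) (smul : ∀ (a : ℤ) x, p x → p (a • x))
    {x : FreeChains X} (hx : x ∈ degreePart X n) : p x := by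
  refine Submodule.span_induction ?_ zero (fun x y _ _ => add x y) (fun a x _ => smul a x) hx
  rintro _ ⟨σ, rfl⟩
  exact single _ rfl

theorem map_mem_of_mem_degreePart {n : ℕ} {M : Type*} [AddCommGroup M] (f : FreeChains X →ₗ[ℤ] M)
    {S : Submodule ℤ M} (h : ∀ σ : Cube X, σ.1 = n → f (Finsupp.single σ 1) ∈ S)
    {x : FreeChains X} (hx : x ∈ degreePart X n) : f x ∈ S :=
  degreePart_induction (p := fun x => f x ∈ S) h (by simp)
    (fun x y hx hy => by rw [map_add]; exact add_mem hx hy)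
    (fun a x hx => by rw [map_smul]; exact S.smul_mem a hx) hx

/-- Two linear maps which agree on cubes agree. -/
theorem chain_hom_ext {M : Type*} [AddCommGroup M] {f g : FreeChains X →ₗ[ℤ] M}
    (h : ∀ σ : Cube X, f (Finsupp.single σ 1) = g (Finsupp.single σ 1)) : f = g := by
  ext1 σ
  ext1
  exact h σ

/-- The image of a cube under a continuous map. -/
def mapCube (f : C(X, Y)) (σ : Cube X) : Cube Y := ⟨σ.1, f.comp σ.2⟩

theorem ev_mapCube (f : C(X, Y)) (σ : Cube X) (t : ℕ → 𝕀) : ev (mapCube f σ) t = f (ev σ t) := rfl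

/-- The map of free chains induced by a continuous map, between arbitrary universes. -/
def mapChain (f : C(X, Y)) : FreeChains X →ₗ[ℤ] FreeChains Y :=
  Finsupp.lmapDomain ℤ ℤ (mapCube f)

theorem mapChain_single (f : C(X, Y)) (σ : Cube X) :
    mapChain f (Finsupp.single σ 1) = Finsupp.single (mapCube f σ) 1 := by
  simp [mapChain]

theorem mapChain_comp (g : C(Y, Z)) (f : C(X, Y)) (x : FreeChains X) :
    mapChain (g.comp f) x = mapChain g (mapChain f x) := by
  have : mapChain (g.comp f) = mapChain g ∘ₗ mapChain f := chain_hom_ext fun σ => by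
    simp only [LinearMap.comp_apply, mapChain_single]
    rfl
  exact LinearMap.congr_fun this x

theorem mapChain_boundary (f : C(X, Y)) (x : FreeChains X) :
    freeBoundary Y (mapChain f x) = mapChain f (freeBoundary X x) := by
  have : freeBoundary Y ∘ₗ mapChain f = mapChain f ∘ₗ freeBoundary X := chain_hom_ext fun σ => by
    simp only [LinearMap.comp_apply, mapChain_single, freeBoundary_single, cubeBoundary_eq,
      map_sum, map_smul, map_sub]
    rfl
  exact LinearMap.congr_fun this x

theorem mapChain_degreePart (f : C(X, Y)) {n : ℕ} {x : FreeChains X} (hx : x ∈ degreePart X n) :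
    mapChain f x ∈ degreePart Y n :=
  map_mem_of_mem_degreePart (mapChain f) (fun σ hσ => by
    rw [mapChain_single]; exact single_mem_degreePart hσ) hx

theorem boundary_degreePart {n : ℕ} {x : FreeChains X} (hx : x ∈ degreePart X (n + 1)) :
    freeBoundary X x ∈ degreePart X n :=
  map_mem_of_mem_degreePart (freeBoundary X) (fun σ hσ => by
    rw [freeBoundary_single, cubeBoundary_eq]
    have h : ∀ k ε, (fc σ k ε).1 = n := fun k ε => by change σ.1 - 1 = n; omega
    exact Submodule.sum_mem _ fun k _ => Submodule.smul_mem _ _ (Submodule.sub_mem _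
      (single_mem_degreePart (h _ _)) (single_mem_degreePart (h _ _)))) hx

theorem boundary_degreePart_zero {x : FreeChains X} (hx : x ∈ degreePart X 0) :
    freeBoundary X x = 0 := by
  have := map_mem_of_mem_degreePart (S := ⊥) (freeBoundary X) (fun σ hσ => by
    rw [freeBoundary_single, cubeBoundary_eq, hσ]
    simp) hx
  simpa using this

theorem mapChain_relations (f : C(X, Y)) {x : FreeChains X} (hx : x ∈ relations X) :
    mapChain f x ∈ relations Y := by
  have h : relations X ≤ (relations Y).comap (mapChain f) := by
    refine sup_le ?_ (sup_le ?_ ?_)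
    · rw [degenerate, Submodule.span_le]
      rintro _ ⟨σ, ⟨k, h⟩, rfl⟩
      simp only [SetLike.mem_coe, Submodule.mem_comap, mapChain_single]
      exact (le_sup_left : degenerate _ ≤ relations _)
        (single_mem_degenerate ⟨k, fun t x => congrArg f (h t x)⟩)
    · rw [fitting, Submodule.span_le]
      rintro _ ⟨m, σ, g, rfl⟩
      simp only [SetLike.mem_coe, Submodule.mem_comap, map_sub, map_add, mapChain_single]
      exact (le_sup_left.trans le_sup_right : fitting _ ≤ relations _)
        (Submodule.subset_span ⟨m, f.comp σ, g, rfl⟩)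
    · rw [permuting, Submodule.span_le]
      rintro _ ⟨m, σ, k, rfl⟩
      simp only [SetLike.mem_coe, Submodule.mem_comap, map_add, mapChain_single]
      exact (le_sup_right.trans le_sup_right : permuting _ ≤ relations _)
        (Submodule.subset_span ⟨m, f.comp σ, k, rfl⟩)
  exact h hx

end CubeTools

/-! ### Cones along a homotopy and acyclicity of contractible spaces -/

section Cone

variable {X : Type u} [TopologicalSpace X]

/-- The cone on a cube along a homotopy `h`; the parameter of the homotopy is the first
coordinate. -/
def coneCube (h : C(𝕀 × X, X)) (σ : Cube X) : Cube X :=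
  ⟨σ.1 + 1, h.comp ⟨fun t => (t 0, σ.2 fun i => t i.succ), by fun_prop⟩⟩

theorem ev_coneCube (h : C(𝕀 × X, X)) (σ : Cube X) (t : ℕ → 𝕀) :
    ev (coneCube h σ) t = h (t 0, ev σ fun i => t (i + 1)) := by
  rfl

/-- The cone operator. -/
def coneChain (h : C(𝕀 × X, X)) : FreeChains X →ₗ[ℤ] FreeChains X :=
  Finsupp.lmapDomain ℤ ℤ (coneCube h)

theorem coneChain_single (h : C(𝕀 × X, X)) (σ : Cube X) :
    coneChain h (Finsupp.single σ 1) = Finsupp.single (coneCube h σ) 1 := by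
  simp [coneChain]

theorem coneChain_degreePart (h : C(𝕀 × X, X)) {n : ℕ} {x : FreeChains X}
    (hx : x ∈ degreePart X n) : coneChain h x ∈ degreePart X (n + 1) :=
  map_mem_of_mem_degreePart (coneChain h) (fun σ hσ => by
    rw [coneChain_single]; exact single_mem_degreePart (by rw [← hσ]; rfl)) hx

theorem fc_coneCube_zero (h : C(𝕀 × X, X)) (σ : Cube X) (ε : 𝕀) (t : ℕ → 𝕀) :
    ev (fc (coneCube h σ) 0 ε) t = h (ε, ev σ t) := by
  rw [ev_fc _ (Nat.succ_pos _), ev_coneCube]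
  rfl

theorem fc_coneCube_succ (h : C(𝕀 × X, X)) (σ : Cube X) {k : ℕ} (hk : k < σ.1) (ε : 𝕀) :
    fc (coneCube h σ) (k + 1) ε = coneCube h (fc σ k ε) := by
  refine cube_ext (by change σ.1 + 1 - 1 = σ.1 - 1 + 1; omega) fun t => ?_
  rw [ev_fc _ (by change k + 1 < σ.1 + 1; omega), ev_coneCube, ev_coneCube, ev_fc _ hk]
  congr 2
  refine ev_congr _ fun i _ => ?_
  simp only [ins]
  split_ifs <;> first | rfl | omega | (congr 1; omega)

/-- The cone parameter is the first coordinate, so the k-th face of σ appears as face k + 1 with the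
opposite sign. The two faces in direction 0 are the ends of the homotopy. -/
theorem boundary_coneCube (h : C(𝕀 × X, X)) (h1 : ∀ x, h (1, x) = x) (σ : Cube X) :
    cubeBoundary (coneCube h σ) = Finsupp.single σ 1 -
      Finsupp.single (fc (coneCube h σ) 0 0) 1 - coneChain h (cubeBoundary σ) := by
  have h2 : fc (coneCube h σ) 0 1 = σ := cube_ext rfl fun t => by rw [fc_coneCube_zero, h1]
  rw [cubeBoundary_eq, show (coneCube h σ).1 = σ.1 + 1 from rfl, Finset.sum_range_succ', h2,
    cubeBoundary_eq, map_sum, pow_zero, one_smul, sub_eq_add_neg _ (Finset.sum _ _), add_comm,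
    ← Finset.sum_neg_distrib]
  congr 1
  refine Finset.sum_congr rfl fun k hk => ?_
  rw [Finset.mem_range] at hk
  rw [fc_coneCube_succ _ _ hk, fc_coneCube_succ _ _ hk, map_smul, map_sub, coneChain_single,
    coneChain_single, pow_succ, mul_neg_one, neg_smul]

/-- Because the cone parameter comes first, the last coordinate of σ, along which the fitting
relation subdivides, remains the last one. -/
theorem coneChain_relations (h : C(𝕀 × X, X)) {x : FreeChains X} (hx : x ∈ relations X) :
    coneChain h x ∈ relations X := by
  have key : relations X ≤ (relations X).comap (coneChain h) := by
    refine sup_le ?_ (sup_le ?_ ?_)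
    · rw [degenerate, Submodule.span_le]
      rintro _ ⟨σ, hσ, rfl⟩
      simp only [SetLike.mem_coe, Submodule.mem_comap, coneChain_single]
      refine (le_sup_left : degenerate _ ≤ relations _) (single_mem_degenerate ?_)
      obtain ⟨k, hk, hσ⟩ := (isDegenerate_iff σ).1 hσ
      refine (isDegenerate_iff _).2 ⟨k + 1, Nat.succ_lt_succ hk, fun t x => ?_⟩
      rw [ev_coneCube, ev_coneCube, ← hσ (fun i => t (i + 1)) x]
      refine congrArg h (congrArg _ (congrArg (ev σ) (funext fun i => ?_)))
      by_cases hi : i = k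
      · subst hi; simp
      · rw [Function.update_of_ne hi, Function.update_of_ne (by omega)]
    · rw [fitting, Submodule.span_le]
      rintro _ ⟨m, σ, f, rfl⟩
      simp only [SetLike.mem_coe, Submodule.mem_comap, map_sub, map_add, coneChain_single]
      have kin : ∀ (t : ℕ → 𝕀) (x : 𝕀), (Fin.snoc (α := fun _ => 𝕀) (fun i : Fin m => t i) x :
          Fin (m + 1) → 𝕀) = fun i : Fin (m + 1) => Function.update t m x i := by
        intro t x
        ext i
        refine Fin.lastCases ?_ (fun j => ?_) i
        · simp
        · have : (j : ℕ) ≠ m := j.2.ne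
          simp [this]
      have upd : ∀ (t : ℕ → 𝕀) (x : 𝕀), (fun i => Function.update t (m + 1) x (i + 1)) =
          Function.update (fun i => t (i + 1)) m x := by
        intro t x
        ext i
        by_cases hi : i = m
        · subst hi; simp
        · rw [Function.update_of_ne hi, Function.update_of_ne (by omega)]
      refine (le_sup_left.trans le_sup_right : fitting _ ≤ relations _)
        (mem_fitting (m + 1) ⟨fun t => f fun i => t i.succ, by fun_prop⟩ _ _ _ rfl rfl rfl
          (fun t => ?_) (fun t => ?_))
      · rw [ev_coneCube, ev_coneCube, upd]
        simp only [ContinuousMap.coe_mk, Fin.val_succ]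
        rw [Function.update_of_ne (by omega)]
        congr 2
        exact congrArg σ (kin (fun i => t (i + 1)) _)
      · rw [ev_coneCube, ev_coneCube, upd]
        simp only [ContinuousMap.coe_mk, Fin.val_succ]
        rw [Function.update_of_ne (by omega)]
        congr 2
        exact congrArg σ (kin (fun i => t (i + 1)) _)
    · rw [permuting, Submodule.span_le]
      rintro _ ⟨m, σ, k, rfl⟩
      simp only [SetLike.mem_coe, Submodule.mem_comap, map_add, coneChain_single]
      refine (le_sup_right.trans le_sup_right : permuting _ ≤ relations _)
        (mem_permuting _ _ (k + 1) (by change (k : ℕ) + 1 + 1 < m + 1 + 1; omega) rfl fun t => ?_)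
      rw [ev_coneCube, ev_coneCube]
      congr 2
      refine congrArg σ (funext fun i => ?_)
      simp only [Function.comp]
      simp only [Equiv.swap_apply_def, Fin.ext_iff, Fin.val_castSucc, Fin.val_succ]
      split_ifs <;> simp_all
  exact key hx

/-- Contractible spaces are acyclic in positive degrees. -/
theorem boundary_coneChain_sub_mem {h : C(𝕀 × X, X)} (h1 : ∀ x, h (1, x) = x) {x₀ : X}
    (h0 : ∀ x, h (0, x) = x₀) {n : ℕ} {x : FreeChains X} (hx : x ∈ degreePart X (n + 1))
    (hd : freeBoundary X x ∈ relations X) :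
    freeBoundary X (coneChain h x) - x ∈ relations X := by
  have key : ∀ x ∈ degreePart X (n + 1), freeBoundary X (coneChain h x) +
      coneChain h (freeBoundary X x) - x ∈ relations X := fun x hx => by
    have := map_mem_of_mem_degreePart (S := relations X) (freeBoundary X ∘ₗ coneChain h + coneChain h ∘ₗ freeBoundary X -
      LinearMap.id) (fun σ hσ => ?_) hx
    · simpa using this
    simp only [LinearMap.sub_apply, LinearMap.add_apply, LinearMap.comp_apply, LinearMap.id_apply,
      coneChain_single, freeBoundary_single, boundary_coneCube h h1]
    -- In positive degree the end of the contraction is a constant cube of positive dimension.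
    have : IsDegenerate (fc (coneCube h σ) 0 0) := by
      refine (isDegenerate_iff _).2 ⟨0, by change 0 < σ.1 + 1 - 1; omega, fun t x => ?_⟩
      rw [fc_coneCube_zero, fc_coneCube_zero, h0, h0]
    rw [sub_add_cancel, sub_sub_cancel_left]
    exact Submodule.neg_mem _ ((le_sup_left : degenerate _ ≤ relations X)
      (single_mem_degenerate this))
  have := sub_mem (key x hx) (coneChain_relations h hd)
  convert this using 1
  abel

/-- In degree zero the constant end is a point and not degenerate. It cancels in the difference of
two points. -/
theorem boundary_coneChain_point {h : C(𝕀 × X, X)} (h1 : ∀ x, h (1, x) = x) {x₀ : X}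
    (h0 : ∀ x, h (0, x) = x₀) {σ τ : Cube X} (hσ : σ.1 = 0) (hτ : τ.1 = 0) :
    freeBoundary X (coneChain h (Finsupp.single σ 1 - Finsupp.single τ 1)) =
      Finsupp.single σ 1 - Finsupp.single τ 1 := by
  have hz : ∀ ρ : Cube X, ρ.1 = 0 → cubeBoundary ρ = 0 := fun ρ hρ => by
    rw [cubeBoundary_eq, hρ]; simp
  have : fc (coneCube h σ) 0 0 = fc (coneCube h τ) 0 0 :=
    cube_ext (by change σ.1 + 1 - 1 = τ.1 + 1 - 1; omega) fun t => by
      rw [fc_coneCube_zero, fc_coneCube_zero, h0, h0]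
  simp only [map_sub, coneChain_single, freeBoundary_single, boundary_coneCube h h1, hz _ hσ,
    hz _ hτ, map_zero, this]
  abel

end Cone

/-! ### Faces of faces in a precubical set -/

section Precubical

/-- The double sum over the faces of the faces of a cell of a precubical set vanishes. -/
theorem sum_faces_faces {C : ℕ → Type*} {M : Type*} [AddCommGroup M]
    (d : ∀ n, ℕ → Bool → C (n + 1) → C n)
    (hd : ∀ (n j k : ℕ) (ε η : Bool) (σ : C (n + 2)), j ≤ k → k < n + 1 →
      d n j ε (d (n + 1) (k + 1) η σ) = d n k η (d (n + 1) j ε σ))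
    {n : ℕ} (g : C n → M) (σ : C (n + 2)) :
    ∑ k ∈ Finset.range (n + 2), (-1 : ℤ) ^ k • (
      (∑ j ∈ Finset.range (n + 1), (-1 : ℤ) ^ j •
        (g (d n j true (d (n + 1) k true σ)) - g (d n j false (d (n + 1) k true σ)))) -
      (∑ j ∈ Finset.range (n + 1), (-1 : ℤ) ^ j •
        (g (d n j true (d (n + 1) k false σ)) - g (d n j false (d (n + 1) k false σ))))) = 0 := by
  set F : ℕ → ℕ → M := fun k j => (-1 : ℤ) ^ (k + j) •
    ((g (d n j true (d (n + 1) k true σ)) - g (d n j false (d (n + 1) k true σ))) -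
      (g (d n j true (d (n + 1) k false σ)) - g (d n j false (d (n + 1) k false σ)))) with hF
  -- The precubical identity pairs the entry (k + 1, j) with (j, k), with opposite signs.
  have h1 : ∀ j k, j ≤ k → k < n + 1 → F (k + 1) j = - F j k := by
    intro j k h h'
    simp only [hF]
    rw [hd _ _ _ _ _ _ h h', hd _ _ _ _ _ _ h h', hd _ _ _ _ _ _ h h', hd _ _ _ _ _ _ h h',
      ← neg_smul, show (-1 : ℤ) ^ (k + 1 + j) = - (-1) ^ (j + k) by ring]
    congr 1
    abel
  have h2 : ∑ k ∈ Finset.range (n + 2), ∑ j ∈ Finset.range (n + 1), F k j = 0 := by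
    -- Passing from m to m + 1 adds one row and one column to the rectangle, and these cancel by
    -- `h1`.
    have : ∀ m ≤ n + 1, ∑ k ∈ Finset.range (m + 1), ∑ j ∈ Finset.range m, F k j = 0 := by
      intro m
      induction m with
      | zero => simp
      | succ m ih =>
        intro hm
        rw [Finset.sum_range_succ]
        simp only [fun k => Finset.sum_range_succ (F k) m, Finset.sum_add_distrib]
        rw [ih (by omega), zero_add, Finset.sum_congr rfl (fun j hj => h1 j m (by simp at hj; omega) (by omega)),
          h1 m m le_rfl (by omega), Finset.sum_neg_distrib, Finset.sum_range_succ]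
        abel
    exact this _ le_rfl
  rw [← h2]
  refine Finset.sum_congr rfl fun k _ => ?_
  rw [← Finset.sum_sub_distrib, Finset.smul_sum]
  refine Finset.sum_congr rfl fun j _ => ?_
  rw [← smul_sub, smul_smul, ← pow_add]

end Precubical

/-! ### Adams' families of paths in a linear space -/

section Paths

/-- The enumeration of the natural numbers different from `p`. -/
def skip (p i : ℕ) : ℕ := if i < p then i else i + 1

theorem skip_of_lt {p i : ℕ} (h : i < p) : skip p i = i := if_pos h

theorem skip_of_le {p i : ℕ} (h : p ≤ i) : skip p i = i + 1 := if_neg (by omega)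

/-- Truncation of a real number to the unit interval. -/
def clamp (x : ℝ) : ℝ := max 0 (min 1 x)

theorem clamp_of_nonpos {x : ℝ} (h : x ≤ 0) : clamp x = 0 :=
  max_eq_left ((min_le_right _ _).trans h)

theorem clamp_of_one_le {x : ℝ} (h : 1 ≤ x) : clamp x = 1 := by
  rw [clamp, min_eq_left h, max_eq_right zero_le_one]

theorem continuous_clamp : Continuous clamp := continuous_const.max (continuous_const.min continuous_id)

/-- The sum of the first `i` coordinates. -/
def startTime (t : ℕ → 𝕀) (i : ℕ) : ℝ := ∑ j ∈ Finset.range i, (t j : ℝ)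

theorem startTime_nonneg (t : ℕ → 𝕀) (i : ℕ) : 0 ≤ startTime t i :=
  Finset.sum_nonneg fun j _ => (t j).2.1

theorem startTime_mono (t : ℕ → 𝕀) {i j : ℕ} (h : i ≤ j) : startTime t i ≤ startTime t j :=
  Finset.sum_le_sum_of_subset_of_nonneg (by simpa using h) fun j _ _ => (t j).2.1

theorem startTime_congr {s t : ℕ → 𝕀} {i : ℕ} (h : ∀ j < i, s j = t j) :
    startTime s i = startTime t i :=
  Finset.sum_congr rfl fun j hj => by rw [h j (Finset.mem_range.1 hj)]

theorem startTime_add (t : ℕ → 𝕀) (i j : ℕ) :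
    startTime t (i + j) = startTime t i + startTime (fun l => t (i + l)) j :=
  Finset.sum_range_add _ _ _

theorem startTime_succ (t : ℕ → 𝕀) (i : ℕ) : startTime t (i + 1) = startTime t i + t i :=
  Finset.sum_range_succ _ _

theorem continuous_startTime (i : ℕ) : Continuous fun t : ℕ → 𝕀 => startTime t i :=
  continuous_finsetSum _ fun j _ => continuous_subtype_val.comp (continuous_apply j)

theorem ins_lt {k i : ℕ} (ε : 𝕀) (t : ℕ → 𝕀) (h : i < k) : ins k ε t i = t i := if_pos h

theorem ins_self (k : ℕ) (ε : 𝕀) (t : ℕ → 𝕀) : ins k ε t k = ε := by simp [ins]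

theorem ins_add (k : ℕ) (ε : 𝕀) (t : ℕ → 𝕀) (i : ℕ) : ins k ε t (k + 1 + i) = t (k + i) := by
  have h1 : ¬ k + 1 + i < k := by omega
  have h2 : ¬ k + 1 + i = k := by omega
  simp only [ins, h1, h2, if_false]
  congr 1
  omega

theorem startTime_ins_le {k i : ℕ} (ε : 𝕀) (t : ℕ → 𝕀) (h : i ≤ k) :
    startTime (ins k ε t) i = startTime t i :=
  startTime_congr fun _ hj => ins_lt _ _ (by omega)

theorem startTime_ins_add (k : ℕ) (ε : 𝕀) (t : ℕ → 𝕀) (i : ℕ) :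
    startTime (ins k ε t) (k + 1 + i) = startTime t (k + i) + ε := by
  rw [startTime_add, startTime_succ, startTime_ins_le _ _ le_rfl, ins_self, startTime_add]
  simp only [ins_add]
  ring

/-- The length of the path with `m` arrows. -/
def pathLen (t : ℕ → 𝕀) (m : ℕ) : ℝ := 1 + startTime t (m - 1)

theorem pathLen_pos (t : ℕ → 𝕀) (m : ℕ) : 0 < pathLen t m :=
  add_pos_of_pos_of_nonneg one_pos (startTime_nonneg _ _)

theorem pathLen_ins_zero (t : ℕ → 𝕀) {p m : ℕ} (h : p < m) :
    pathLen (ins p 0 t) (m + 1) = pathLen t m := by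
  obtain ⟨r, rfl⟩ : ∃ r, m = p + 1 + r := ⟨m - p - 1, by omega⟩
  rw [pathLen, pathLen, Nat.add_sub_cancel, startTime_ins_add,
    show p + 1 + r - 1 = p + r by omega]
  simp

/-- The inserted coordinate 1 supplies the constant unit in the length of one of the two paths. -/
theorem pathLen_ins_one (t : ℕ → 𝕀) (c d : ℕ) (h : 0 < d) :
    pathLen (ins c 1 t) (c + 1 + d) = pathLen t (c + 1) + pathLen (fun i => t (c + i)) d := by
  obtain ⟨r, rfl⟩ : ∃ r, d = r + 1 := ⟨d - 1, by omega⟩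
  rw [pathLen, pathLen, pathLen, show c + 1 + (r + 1) - 1 = c + 1 + r by omega, startTime_ins_add,
    startTime_add]
  simp only [Nat.add_sub_cancel, Set.Icc.coe_one]
  ring

theorem pathLen_congr {s t : ℕ → 𝕀} {m : ℕ} (h : ∀ j < m - 1, s j = t j) :
    pathLen s m = pathLen t m := by
  rw [pathLen, pathLen, startTime_congr h]

theorem continuous_pathLen (m : ℕ) : Continuous fun t : ℕ → 𝕀 => pathLen t m :=
  continuous_const.add (continuous_startTime _)

variable {E : Type*} [AddCommGroup E] [Module ℝ E] [TopologicalSpace E]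
  [IsTopologicalAddGroup E] [ContinuousSMul ℝ E]

/-- The path from `u 0` to `u m` in which the motion along the vector `u (i + 1) - u i` takes place
in the unit of time after `t 0 + ⋯ + t (i - 1)`. -/
def pathAt (u : ℕ → E) (t : ℕ → 𝕀) (m : ℕ) (τ : ℝ) : E :=
  u 0 + ∑ i ∈ Finset.range m, clamp (τ - startTime t i) • (u (i + 1) - u i)

theorem pathAt_of_nonpos (u : ℕ → E) (t : ℕ → 𝕀) (m : ℕ) {τ : ℝ} (h : τ ≤ 0) :
    pathAt u t m τ = u 0 := by
  rw [pathAt, Finset.sum_eq_zero, add_zero]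
  intro i _
  have := startTime_nonneg t i
  rw [clamp_of_nonpos (by linarith), zero_smul]

/-- The last motion starts at `startTime t (m - 1)`, so at the time `pathLen t m` every motion is
complete and the displacements telescope. -/
theorem pathAt_of_le (u : ℕ → E) (t : ℕ → 𝕀) (m : ℕ) {τ : ℝ} (h : pathLen t m ≤ τ) :
    pathAt u t m τ = u m := by
  rw [pathAt, Finset.sum_congr rfl (g := fun i => u (i + 1) - u i), Finset.sum_range_sub]
  · abel
  · intro i hi
    rw [Finset.mem_range] at hi
    have := startTime_mono t (show i ≤ m - 1 by omega)
    rw [pathLen] at h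
    rw [clamp_of_one_le (by linarith), one_smul]

theorem pathAt_congr {u u' : ℕ → E} {s t : ℕ → 𝕀} {m : ℕ} (hu : ∀ i ≤ m, u i = u' i)
    (h : ∀ j < m - 1, s j = t j) (τ : ℝ) : pathAt u s m τ = pathAt u' t m τ := by
  rw [pathAt, pathAt, hu 0 (Nat.zero_le _)]
  congr 1
  refine Finset.sum_congr rfl fun i hi => ?_
  rw [Finset.mem_range] at hi
  rw [hu i (by omega), hu (i + 1) (by omega), startTime_congr fun j hj => h j (by omega)]

/-- With zero delay the motions p and p + 1 run simultaneously and their vectors add up to u (p + 2)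
- u p. The vertex p + 1 is forgotten. -/
theorem pathAt_ins_zero (u : ℕ → E) (t : ℕ → 𝕀) {p m : ℕ} (h : p < m) (τ : ℝ) :
    pathAt u (ins p 0 t) (m + 1) τ = pathAt (u ∘ skip (p + 1)) t m τ := by
  obtain ⟨r, rfl⟩ : ∃ r, m = p + 1 + r := ⟨m - p - 1, by omega⟩
  rw [pathAt, pathAt, show p + 1 + r + 1 = p + 1 + 1 + r by omega, Finset.sum_range_add,
    Finset.sum_range_succ, Finset.sum_range_succ, Finset.sum_range_add, Finset.sum_range_succ]
  have e0 : startTime (ins p 0 t) (p + 1) = startTime t p := by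
    have := startTime_ins_add p 0 t 0
    simpa using this
  have e1 : (u ∘ skip (p + 1)) (p + 1) = u (p + 2) := by simp [skip]
  have e2 : ∀ i ≤ p, (u ∘ skip (p + 1)) i = u i := fun i hi => by
    simp [skip, Nat.lt_succ_of_le hi]
  rw [e0, startTime_ins_le _ _ le_rfl, e1, e2 _ le_rfl, e2 _ (Nat.zero_le _)]
  have h1 : ∑ i ∈ Finset.range p, clamp (τ - startTime (ins p 0 t) i) • (u (i + 1) - u i) =
      ∑ i ∈ Finset.range p, clamp (τ - startTime t i) •
        ((u ∘ skip (p + 1)) (i + 1) - (u ∘ skip (p + 1)) i) := by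
    refine Finset.sum_congr rfl fun i hi => ?_
    rw [Finset.mem_range] at hi
    rw [startTime_ins_le _ _ hi.le, e2 _ (by omega), e2 _ (by omega)]
  have h2 : ∑ i ∈ Finset.range r, clamp (τ - startTime (ins p 0 t) (p + 1 + 1 + i)) •
      (u (p + 1 + 1 + i + 1) - u (p + 1 + 1 + i)) =
      ∑ i ∈ Finset.range r, clamp (τ - startTime t (p + 1 + i)) •
        ((u ∘ skip (p + 1)) (p + 1 + i + 1) - (u ∘ skip (p + 1)) (p + 1 + i)) := by
    refine Finset.sum_congr rfl fun i _ => ?_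
    have e3 := startTime_ins_add p 0 t (1 + i)
    rw [show p + 1 + (1 + i) = p + 1 + 1 + i by omega, show p + (1 + i) = p + 1 + i by omega] at e3
    rw [e3]
    simp only [Function.comp, skip_of_le (show p + 1 ≤ p + 1 + i by omega),
      skip_of_le (show p + 1 ≤ p + 1 + i + 1 by omega), Set.Icc.coe_zero, add_zero]
    congr 3 <;> omega
  rw [h1, h2]
  module

/-- With delay one, all motions up to c are complete when motion c + 1 starts. The path is the first
part followed by the second; u (c + 1) is subtracted because both parts count it. -/
theorem pathAt_ins_one (u : ℕ → E) (t : ℕ → 𝕀) (c d : ℕ) (τ : ℝ) :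
    pathAt u (ins c 1 t) (c + 1 + d) τ = pathAt u t (c + 1) τ +
      pathAt (fun i => u (c + 1 + i)) (fun i => t (c + i)) d (τ - pathLen t (c + 1)) -
        u (c + 1) := by
  rw [pathAt, Finset.sum_range_add, ← add_assoc]
  change pathAt u (ins c 1 t) (c + 1) τ + _ = _
  rw [pathAt_congr (s := ins c 1 t) (t := t) (fun _ _ => rfl) fun j hj => ins_lt _ _ (by omega),
    pathAt.eq_1 (fun i => u (c + 1 + i)), add_sub_assoc, add_zero, add_sub_cancel_left]
  congr 1
  refine Finset.sum_congr rfl fun i _ => ?_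
  rw [startTime_ins_add, pathLen, Nat.add_sub_cancel, startTime_add]
  congr 2
  simp only [Set.Icc.coe_one]
  ring

theorem continuous_pathAt {T : Type*} [TopologicalSpace T] (u : ℕ → E) (m : ℕ)
    {t : T → ℕ → 𝕀} {τ : T → ℝ} (ht : Continuous t) (hτ : Continuous τ) :
    Continuous fun x => pathAt u (t x) m (τ x) :=
  continuous_const.add (continuous_finsetSum _ fun i _ =>
    (continuous_clamp.comp (hτ.sub ((continuous_startTime i).comp ht))).smul continuous_const)

end Paths

/-! ### Cubes of based loops from sequences of points over q -/

section Letters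

variable {E : Type v} [AddCommGroup E] [Module ℝ E] [TopologicalSpace E]
  [IsTopologicalAddGroup E] [ContinuousSMul ℝ E] {Q : Type u} [TopologicalSpace Q]
  {q : Q} {f : C(E, Q)}

theorem basedLoop_ext {α β : BasedLoop q} (h : len α = len β)
    (h' : ∀ s, 0 ≤ s → s ≤ len α → loopAt α s = loopAt β s) : α = β := by
  refine Subtype.ext (freeLoop_ext (NNReal.coe_injective h) fun w => ?_)
  have h1 := len_pos α
  have := h' (w * len α) (mul_nonneg w.2.1 h1.le) (mul_le_of_le_one_left h1.le w.2.2)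
  rw [loopAt, loopAt, ← h, mul_div_cancel_right₀ _ h1.ne', Set.projIcc_val] at this
  exact this

/-- The based loop which is the image of the path `pathAt u t m`. -/
def edgeLoop (u : ℕ → {x : E // f x = q}) (m : ℕ) (t : ℕ → 𝕀) : BasedLoop q :=
  ⟨(⟨⟨fun w => f (pathAt (fun i => (u i : E)) t m (w * pathLen t m)),
      f.continuous.comp (continuous_pathAt _ _ continuous_const
        (continuous_subtype_val.mul continuous_const))⟩, by
      simp only [ContinuousMap.coe_mk, Set.Icc.coe_zero, zero_mul, Set.Icc.coe_one, one_mul]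
      rw [pathAt_of_nonpos _ _ _ le_rfl, pathAt_of_le _ _ _ le_rfl, (u 0).2, (u m).2]⟩,
      ⟨pathLen t m, (pathLen_pos t m).le⟩), by
      simp only [ContinuousMap.coe_mk, Set.Icc.coe_zero, zero_mul]
      rw [pathAt_of_nonpos _ _ _ le_rfl, (u 0).2], pathLen_pos t m⟩

theorem len_edgeLoop (u : ℕ → {x : E // f x = q}) (m : ℕ) (t : ℕ → 𝕀) :
    len (edgeLoop u m t) = pathLen t m := rfl

/-- Outside the time interval the path rests at an endpoint over q, so no bounds on s are needed. -/
theorem loopAt_edgeLoop (u : ℕ → {x : E // f x = q}) (m : ℕ) (t : ℕ → 𝕀) (s : ℝ) :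
    loopAt (edgeLoop u m t) s = f (pathAt (fun i => (u i : E)) t m s) := by
  have h := pathLen_pos t m
  rcases le_total s 0 with h0 | h0
  · rw [at_of_nonpos _ h0, pathAt_of_nonpos _ _ _ h0, (u 0).2]
  rcases le_total (pathLen t m) s with h1 | h1
  · rw [at_of_le _ h1, pathAt_of_le _ _ _ h1, (u m).2]
  · rw [loopAt, len_edgeLoop, Set.projIcc_of_mem _ ⟨div_nonneg h0 h.le, (div_le_one h).2 h1⟩]
    change f (pathAt _ _ _ (s / pathLen t m * pathLen t m)) = _
    rw [div_mul_cancel₀ _ h.ne']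

theorem continuous_edgeLoop (u : ℕ → {x : E // f x = q}) (m : ℕ) :
    Continuous (edgeLoop u m) := by
  refine Continuous.subtype_mk (Continuous.prodMk (Continuous.subtype_mk
    (ContinuousMap.curry ⟨fun y : (ℕ → 𝕀) × 𝕀 =>
      f (pathAt (fun i => (u i : E)) y.1 m (y.2 * pathLen y.1 m)), ?_⟩).continuous _)
      (Continuous.subtype_mk (continuous_pathLen m) _)) _
  exact f.continuous.comp (continuous_pathAt _ _ continuous_fst
    ((continuous_subtype_val.comp continuous_snd).mul ((continuous_pathLen m).comp continuous_fst)))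

theorem edgeLoop_congr {u u' : ℕ → {x : E // f x = q}} {s t : ℕ → 𝕀} {m : ℕ}
    (hu : ∀ i ≤ m, u i = u' i) (h : ∀ j < m - 1, s j = t j) : edgeLoop u m s = edgeLoop u' m t := by
  refine basedLoop_ext (pathLen_congr h) fun τ _ _ => ?_
  rw [loopAt_edgeLoop, loopAt_edgeLoop, pathAt_congr (fun i hi => by rw [hu i hi]) h]

theorem edgeLoop_ins_zero (u : ℕ → {x : E // f x = q}) (t : ℕ → 𝕀) {p m : ℕ} (h : p < m) :
    edgeLoop u (m + 1) (ins p 0 t) = edgeLoop (u ∘ skip (p + 1)) m t := by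
  refine basedLoop_ext (pathLen_ins_zero t h) fun τ _ _ => ?_
  rw [loopAt_edgeLoop, loopAt_edgeLoop, pathAt_ins_zero _ _ h]
  rfl

theorem edgeLoop_ins_one (u : ℕ → {x : E // f x = q}) (t : ℕ → 𝕀) (c d : ℕ) (hd : 0 < d) :
    edgeLoop u (c + 1 + d) (ins c 1 t) = concat q (edgeLoop u (c + 1) t,
      edgeLoop (fun i => u (c + 1 + i)) d fun i => t (c + i)) := by
  have hl := pathLen_ins_one t c d hd
  refine basedLoop_ext hl fun τ h0 h1 => ?_
  rw [len_edgeLoop, hl] at h1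
  rw [loopAt_edgeLoop, pathAt_ins_one, loopAt_concat _ _ h0 (by exact h1), concatAt,
    loopAt_edgeLoop, loopAt_edgeLoop, len_edgeLoop]
  split_ifs with h2
  · rw [pathAt_of_nonpos _ _ d (by linarith)]
    simp
  · rw [pathAt_of_le _ _ (c + 1) (by linarith)]
    simp

/-- The cube of based loops formed by the paths `pathAt u t m`. -/
def edgeCube (u : ℕ → {x : E // f x = q}) (m : ℕ) : Cube (BasedLoop q) :=
  cubeOf (m - 1) ⟨edgeLoop u m, continuous_edgeLoop u m⟩

theorem dim_edgeCube (u : ℕ → {x : E // f x = q}) (m : ℕ) : (edgeCube u m).1 = m - 1 := rfl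

theorem ev_edgeCube (u : ℕ → {x : E // f x = q}) (m : ℕ) (t : ℕ → 𝕀) :
    ev (edgeCube u m) t = edgeLoop u m t :=
  ev_cubeOf _ _ (fun _ _ h => edgeLoop_congr (fun _ _ => rfl) h) t

theorem edgeCube_congr {u u' : ℕ → {x : E // f x = q}} {m : ℕ} (h : ∀ i ≤ m, u i = u' i) :
    edgeCube u m = edgeCube u' m :=
  cube_ext rfl fun t => by
    rw [ev_edgeCube, ev_edgeCube]
    exact edgeLoop_congr h fun _ _ => rfl

theorem fc_edgeCube_zero (u : ℕ → {x : E // f x = q}) {k m : ℕ} (h : k < m - 1) :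
    fc (edgeCube u m) k 0 = edgeCube (u ∘ skip (k + 1)) (m - 1) := by
  refine cube_ext rfl fun t => ?_
  obtain ⟨m, rfl⟩ : ∃ m', m = m' + 1 := ⟨m - 1, by omega⟩
  rw [ev_fc _ h, ev_edgeCube, ev_edgeCube, Nat.add_sub_cancel, edgeLoop_ins_zero _ _ (by omega)]

theorem fc_edgeCube_one (u : ℕ → {x : E // f x = q}) {k m : ℕ} (h : k < m - 1) :
    fc (edgeCube u m) k 1 = cubeMul (edgeCube u (k + 1))
      (edgeCube (fun i => u (k + 1 + i)) (m - (k + 1))) := by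
  obtain ⟨d, rfl⟩ : ∃ d, m = k + 1 + d := ⟨m - (k + 1), by omega⟩
  rw [Nat.add_sub_cancel_left]
  refine cube_ext (by change k + 1 + d - 1 - 1 = k + 1 - 1 + (d - 1); omega) fun t => ?_
  rw [ev_fc _ h, ev_edgeCube, edgeLoop_ins_one _ _ _ _ (by omega), ev_cubeMul, ev_edgeCube,
    ev_edgeCube]
  rfl

/-- This is the differential of the cobar construction of a simplex: at each inner vertex the
sequence is either cut into a product or shortened by omission. -/
theorem cubeBoundary_edgeCube (u : ℕ → {x : E // f x = q}) (m : ℕ) :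
    cubeBoundary (edgeCube u m) = ∑ k ∈ Finset.range (m - 1), (-1 : ℤ) ^ k •
      (Finsupp.single (cubeMul (edgeCube u (k + 1))
        (edgeCube (fun i => u (k + 1 + i)) (m - (k + 1)))) 1 -
        Finsupp.single (edgeCube (u ∘ skip (k + 1)) (m - 1)) 1) := by
  rw [cubeBoundary_eq]
  refine Finset.sum_congr rfl fun k hk => ?_
  rw [Finset.mem_range] at hk
  rw [fc_edgeCube_zero _ hk, fc_edgeCube_one _ hk]

end Letters

/-! ### The Hochschild differential in terms of the bar differential -/

section Words

variable {Q : Type u} [TopologicalSpace Q] {q : Q}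

theorem neg_one_pow_congr_mod {a b : ℕ} (h : a % 2 = b % 2) : (-1 : ℤ) ^ a = (-1) ^ b := by
  rw [← Nat.div_add_mod a 2, ← Nat.div_add_mod b 2, h, pow_add, pow_add, pow_mul, pow_mul]
  simp

theorem neg_one_pow_succ_mod {a b : ℕ} (h : a % 2 = (b + 1) % 2) : (-1 : ℤ) ^ a = - (-1) ^ b := by
  rw [neg_one_pow_congr_mod h, pow_succ, mul_neg_one]

/-- Concatenation of words. -/
def appendWords : FreeWords q →ₗ[ℤ] FreeWords q →ₗ[ℤ] FreeWords q :=
  Finsupp.linearCombination ℤ fun l => Finsupp.lmapDomain ℤ ℤ fun l' => l ++ l'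

local notation:70 x:70 " ⋆ " y:71 => appendWords x y

theorem append_single (l l' : List (Cube (BasedLoop q))) :
    (Finsupp.single l 1 : FreeWords q) ⋆ Finsupp.single l' 1 = Finsupp.single (l ++ l') 1 := by
  simp [appendWords]

theorem words_induction {p : FreeWords q → Prop} (x : FreeWords q) (zero : p 0)
    (add : ∀ x y, p x → p y → p (x + y)) (smul : ∀ (a : ℤ) x, p x → p (a • x))
    (single : ∀ l, p (Finsupp.single l 1)) : p x := by
  induction x using Finsupp.induction_linear with
  | zero => exact zero
  | add x y hx hy => exact add x y hx hy
  | single l a =>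
    have : (Finsupp.single l a : FreeWords q) = a • Finsupp.single l 1 := by simp
    rw [this]
    exact smul a _ (single l)

/-- The empty word. -/
def emptyWord (q : Q) : FreeWords q := Finsupp.single [] 1

/-- The word with one letter. -/
def letter (σ : Cube (BasedLoop q)) : FreeWords q := Finsupp.single [σ] 1

theorem empty_append (x : FreeWords q) : emptyWord q ⋆ x = x := by
  induction x using words_induction with
  | zero => simp
  | add x y hx hy => rw [map_add, hx, hy]
  | smul a x hx => rw [map_smul, hx]
  | single l => rw [emptyWord, append_single]; rfl

theorem append_empty (x : FreeWords q) : x ⋆ emptyWord q = x := by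
  induction x using words_induction with
  | zero => simp
  | add x y hx hy => rw [map_add, LinearMap.add_apply, hx, hy]
  | smul a x hx => rw [map_smul, LinearMap.smul_apply, hx]
  | single l => rw [emptyWord, append_single, List.append_nil]

theorem append_assoc (x y z : FreeWords q) : x ⋆ y ⋆ z = x ⋆ (y ⋆ z) := by
  induction x using words_induction with
  | zero => simp
  | add x x' hx hy => simp only [map_add, LinearMap.add_apply, hx, hy]
  | smul a x hx => simp only [map_smul, LinearMap.smul_apply, hx]
  | single l =>
    induction y using words_induction with
    | zero => simp
    | add x x' hx hy => simp only [map_add, LinearMap.add_apply, hx, hy]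
    | smul a x hx => simp only [map_smul, LinearMap.smul_apply, hx]
    | single l' =>
      induction z using words_induction with
      | zero => simp
      | add x x' hx hy => simp only [map_add, hx, hy]
      | smul a x hx => simp only [map_smul, hx]
      | single l'' => simp only [append_single, List.append_assoc]

theorem letter_append_single (σ : Cube (BasedLoop q)) (l : List (Cube (BasedLoop q))) :
    letter σ ⋆ Finsupp.single l 1 = Finsupp.single (σ :: l) 1 := append_single _ _

/-- Chains as words with one letter. -/
def letters : FreeChains (BasedLoop q) →ₗ[ℤ] FreeWords q := insertChain [] []

theorem letters_single (σ : Cube (BasedLoop q)) : letters (Finsupp.single σ 1) = letter σ :=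
  insertChain_single _ _ _

theorem insertChain_eq (pre post : List (Cube (BasedLoop q))) (x : FreeChains (BasedLoop q)) :
    insertChain pre post x = Finsupp.single pre 1 ⋆ letters x ⋆ Finsupp.single post 1 := by
  have : insertChain pre post = (appendWords.flip (Finsupp.single post 1)) ∘ₗ
      (appendWords (Finsupp.single pre 1)) ∘ₗ letters := chain_hom_ext fun σ => by
    simp only [LinearMap.comp_apply, letters_single, LinearMap.flip_apply, letter, append_single,
      insertChain_single, List.append_assoc, List.singleton_append]
  exact LinearMap.congr_fun this x

/-- The multiplication of a letter with the first letter of a word. -/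
def mergeHeadWord (σ : Cube (BasedLoop q)) : List (Cube (BasedLoop q)) → FreeWords q
  | [] => 0
  | τ :: l => (-1 : ℤ) ^ σ.1 • Finsupp.single (cubeMul σ τ :: l) 1

/-- The differential of the bar construction. -/
def barWord : List (Cube (BasedLoop q)) → FreeWords q
  | [] => 0
  | σ :: l => insertChain [] l (cubeBoundary σ) + mergeHeadWord σ l +
      (-1 : ℤ) ^ (σ.1 + 1) • (letter σ ⋆ barWord l)

/-- The product of the last letter of a word with `x`, as the last letter of a word. -/
def mergeLastWord (x : Cube (BasedLoop q)) (l : List (Cube (BasedLoop q))) : FreeWords q :=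
  match l.reverse with
  | [] => 0
  | y :: r => (-1 : ℤ) ^ reducedDegree r • Finsupp.single (r.reverse ++ [cubeMul y x]) 1

/-- The product of `x` with the first letter of a word, as the last letter of a word. -/
def mergeFirstWord (x : Cube (BasedLoop q)) : List (Cube (BasedLoop q)) → FreeWords q
  | [] => 0
  | y :: l => (-1 : ℤ) ^ (y.1 * x.1 + y.1 * reducedDegree l + 1) •
      Finsupp.single (l ++ [cubeMul x y]) 1

theorem reducedDegree_cons (σ : Cube (BasedLoop q)) (l : List (Cube (BasedLoop q))) :
    reducedDegree (σ :: l) = σ.1 + 1 + reducedDegree l := by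
  simp [reducedDegree]

theorem reducedDegree_append (l l' : List (Cube (BasedLoop q))) :
    reducedDegree (l ++ l') = reducedDegree l + reducedDegree l' := by
  simp [reducedDegree]

theorem reducedDegree_reverse (l : List (Cube (BasedLoop q))) :
    reducedDegree l.reverse = reducedDegree l := by
  simp [reducedDegree]

/-- The operations on no letters and on three or more letters vanish, which leaves j = 1 and j = 2.
-/
theorem sum_mu_eq {M : Type*} [AddCommGroup M]
    (F : ℕ → FreeChains (BasedLoop q) →ₗ[ℤ] M) (y z x : Cube (BasedLoop q))
    (l : List (Cube (BasedLoop q))) :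
    ∑ j ∈ Finset.range (l.length + 3), F j (mu ((y :: z :: (l ++ [x])).take j)) =
      F 1 (cubeBoundary y) + F 2 ((-1 : ℤ) ^ y.1 • Finsupp.single (cubeMul y z) 1) := by
  rw [Finset.sum_range_succ', Finset.sum_range_succ', Finset.sum_range_succ', Finset.sum_eq_zero]
  · simp [mu]
    abel
  · intro j _
    rw [mu_long, map_zero]
    simp

/-- In this half of the Hochschild differential i + j stays below the length of the word, so the
operations never reach the last letter x. They act on l alone and form the bar differential. -/
theorem barWord_append (l : List (Cube (BasedLoop q))) (x : Cube (BasedLoop q)) :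
    ∑ i ∈ Finset.range (l ++ [x]).length, ∑ j ∈ Finset.range ((l ++ [x]).length - i),
      (-1 : ℤ) ^ reducedDegree ((l ++ [x]).take i) •
        insertChain ((l ++ [x]).take i) ((l ++ [x]).drop (i + j)) (mu (((l ++ [x]).drop i).take j)) =
      barWord l ⋆ letter x := by
  induction l with
  | nil => simp [barWord, mu]
  | cons y l ih =>
    rw [List.cons_append, List.length_cons, Finset.sum_range_succ', barWord, map_add, map_add,
      map_smul, LinearMap.add_apply, LinearMap.add_apply, LinearMap.smul_apply, append_assoc, ← ih,
      add_comm]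
    congr 1
    · simp only [List.take_zero, List.drop_zero, zero_add, reducedDegree, List.map_nil,
        List.sum_nil, pow_zero, one_smul, Nat.sub_zero]
      match l with
      | [] =>
        simp [Finset.sum_range_succ, mu, mergeHeadWord, insertChain_eq, append_assoc, letter,
          append_single]
      | z :: l =>
        rw [show ((z :: l) ++ [x]).length + 1 = l.length + 3 by simp]
        rw [List.cons_append, sum_mu_eq
          (fun j => insertChain [] ((y :: z :: (l ++ [x])).drop j))]
        simp only [List.drop_succ_cons, List.drop_zero, mergeHeadWord, map_smul,
          LinearMap.smul_apply, letters_single, letter, append_single, insertChain_eq,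
          append_assoc, List.nil_append, List.cons_append]
    · simp only [map_sum, Finset.smul_sum]
      refine Finset.sum_congr rfl fun i _ => ?_
      rw [show (l ++ [x]).length + 1 - (i + 1) = (l ++ [x]).length - i by omega]
      refine Finset.sum_congr rfl fun j _ => ?_
      rw [map_smul, smul_smul, List.take_succ_cons, reducedDegree_cons, pow_add,
        show i + 1 + j = i + j + 1 by omega, List.drop_succ_cons, List.drop_succ_cons,
        insertChain_eq, insertChain_eq, ← append_assoc, ← append_assoc, letter_append_single]

/-- The other half applies an operation to a cyclic block that contains the last letter. As only μ₁
and μ₂ are nonzero, this is the boundary of x or the product of x with one of its two cyclic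
neighbours. If l is a single letter, it is both neighbours. -/
theorem wordBoundary_append (l : List (Cube (BasedLoop q))) (x : Cube (BasedLoop q)) :
    wordBoundary (l ++ [x]) = barWord l ⋆ letter x -
      (-1 : ℤ) ^ reducedDegree l • (Finsupp.single l 1 ⋆ letters (cubeBoundary x)) +
        mergeLastWord x l + mergeFirstWord x l := by
  simp only [wordBoundary, Finset.sum_add_distrib]
  rw [barWord_append, add_assoc, sub_add_eq_add_sub, add_sub_assoc]
  congr 1
  rcases l.eq_nil_or_concat with rfl | ⟨l', y, hl⟩
  · simp [mergeLastWord, mergeFirstWord, reducedDegree, mu, insertChain_eq]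
    rw [← emptyWord, empty_append, append_empty]
  rw [List.concat_eq_append] at hl
  obtain ⟨z, r, hl'⟩ : ∃ z r, l = z :: r := by
    cases l with
    | nil => simp at hl
    | cons z r => exact ⟨z, r, rfl⟩
  have hlen : (l ++ [x]).length = l'.length + 2 := by rw [hl]; simp
  have hlenr : r.length = l'.length := by
    have := congrArg List.length (hl.symm.trans hl')
    simpa using this.symm
  set B : ℕ → ℕ → FreeWords q := fun i j =>
    (-1 : ℤ) ^ (reducedDegree ((l ++ [x]).take i) * (1 + reducedDegree ((l ++ [x]).drop i)) +
      reducedDegree ((l ++ [x]).drop (i + j)).dropLast +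
      reducedDegree (((l ++ [x]).drop i).take j) + 1) •
        insertChain (((l ++ [x]).drop i).take j) [] (mu ((l ++ [x]).drop (i + j) ++ (l ++ [x]).take i))
    with hB
  -- `B i j` applies an operation to all but j letters of a word with `l'.length + 2` letters, hence
  -- to at least three of them.
  have hzero : ∀ i j, i + j < l'.length + 2 → j < l'.length → B i j = 0 := by
    intro i j h1 h2
    simp only [hB]
    rw [mu_long, map_zero, smul_zero]
    rw [List.length_append, List.length_drop, List.length_take, hlen]
    omega
  -- Three blocks survive: x alone, the last letter y of l followed by x, and x followed by the
  -- first letter z of l.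
  have h00 : B 0 (l'.length + 1) = -
      ((-1 : ℤ) ^ reducedDegree l • (Finsupp.single l 1 ⋆ letters (cubeBoundary x))) := by
    have e1 : (l ++ [x]).drop (l'.length + 1) = [x] := by
      rw [List.drop_append_of_le_length (by rw [hl]; simp), hl]
      simp
    have e2 : (l ++ [x]).take (l'.length + 1) = l := by
      rw [List.take_append_of_le_length (by rw [hl]; simp), hl]
      simp
    simp only [hB, List.take_zero, List.drop_zero, zero_add, e1, e2, List.append_nil]
    rw [show mu [x] = cubeBoundary x from rfl, insertChain_eq, ← emptyWord, append_empty, ← neg_smul,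
      neg_one_pow_succ_mod (b := reducedDegree l)]
    simp [reducedDegree]
  have h01 : B 0 l'.length = mergeLastWord x l := by
    have e1 : (l ++ [x]).drop l'.length = [y, x] := by
      rw [hl]; simp
    have e2 : (l ++ [x]).take l'.length = l' := by
      rw [hl]; simp
    simp only [hB, List.take_zero, List.drop_zero, zero_add, e1, e2, List.append_nil]
    rw [show mu [y, x] = (-1 : ℤ) ^ y.1 • Finsupp.single (cubeMul y x) 1 from rfl, map_smul,
      insertChain_single, smul_smul, ← pow_add, mergeLastWord, hl]
    simp only [List.reverse_append, List.reverse_cons, List.reverse_nil, List.nil_append,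
      List.singleton_append, List.reverse_reverse, reducedDegree_reverse]
    congr 1
    refine neg_one_pow_congr_mod ?_
    simp [reducedDegree]
    omega
  have h11 : B 1 l'.length = mergeFirstWord x l := by
    have e1 : (l ++ [x]).drop (1 + l'.length) = [x] := by
      rw [add_comm, List.drop_append_of_le_length (by rw [hl]; simp), hl]
      simp
    have e3 : (l ++ [x]).take 1 = [z] := by rw [hl']; simp
    have e4 : (l ++ [x]).drop 1 = r ++ [x] := by rw [hl']; simp
    have e2 : (r ++ [x]).take l'.length = r := by
      rw [List.take_append_of_le_length hlenr.ge, ← hlenr, List.take_length]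
    simp only [hB, e1, e3, e4, e2]
    rw [show mu ([x] ++ [z]) = (-1 : ℤ) ^ x.1 • Finsupp.single (cubeMul x z) 1 from rfl, map_smul,
      insertChain_single, smul_smul, ← pow_add, hl', mergeFirstWord]
    congr 1
    refine neg_one_pow_congr_mod ?_
    rw [reducedDegree_append, reducedDegree_cons, reducedDegree_cons]
    simp only [show reducedDegree ([] : List (Cube (BasedLoop q))) = 0 from rfl,
      show reducedDegree [x].dropLast = 0 from rfl]
    have : (z.fst + 1 + 0) * (1 + (reducedDegree r + (x.fst + 1 + 0))) =
      z.1 * x.1 + z.1 * reducedDegree r + 2 * z.1 + x.1 + reducedDegree r + 2 := by ring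
    omega
  change ∑ i ∈ Finset.range (l ++ [x]).length, ∑ j ∈ Finset.range ((l ++ [x]).length - i), B i j = _
  have s0 : ∑ j ∈ Finset.range (l'.length + 2), B 0 j = B 0 l'.length + B 0 (l'.length + 1) := by
    rw [Finset.sum_range_succ, Finset.sum_range_succ, Finset.sum_eq_zero, zero_add]
    intro j hj
    rw [Finset.mem_range] at hj
    exact hzero _ _ (by omega) hj
  have s1 : ∑ j ∈ Finset.range (l'.length + 1), B 1 j = B 1 l'.length := by
    rw [Finset.sum_range_succ, Finset.sum_eq_zero, zero_add]
    intro j hj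
    rw [Finset.mem_range] at hj
    exact hzero _ _ (by omega) hj
  rw [hlen, Finset.sum_range_succ', Finset.sum_range_succ', Finset.sum_eq_zero, zero_add,
    Nat.sub_zero, s0]
  · change ∑ j ∈ Finset.range (l'.length + 1), B 1 j + _ = _
    rw [s1, h00, h01, h11]
    abel
  · intro i hi
    refine Finset.sum_eq_zero fun j hj => ?_
    rw [Finset.mem_range] at hi hj
    exact hzero _ _ (by omega) (by omega)

/-- The sign operator of the reduced degree. -/
def wordSign : FreeWords q →ₗ[ℤ] FreeWords q :=
  Finsupp.linearCombination ℤ fun l => (-1 : ℤ) ^ reducedDegree l • Finsupp.single l 1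

/-- The differential of the bar construction. -/
def barDifferential : FreeWords q →ₗ[ℤ] FreeWords q := Finsupp.linearCombination ℤ barWord

/-- The linear extension of `mergeHeadWord`. -/
def mergeHead (σ : Cube (BasedLoop q)) : FreeWords q →ₗ[ℤ] FreeWords q :=
  Finsupp.linearCombination ℤ (mergeHeadWord σ)

/-- The linear extension of `mergeLastWord`. -/
def mergeLast (x : Cube (BasedLoop q)) : FreeWords q →ₗ[ℤ] FreeWords q :=
  Finsupp.linearCombination ℤ (mergeLastWord x)

/-- The linear extension of `mergeFirstWord`. -/
def mergeFirst (x : Cube (BasedLoop q)) : FreeWords q →ₗ[ℤ] FreeWords q :=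
  Finsupp.linearCombination ℤ (mergeFirstWord x)

theorem wordSign_single (l : List (Cube (BasedLoop q))) :
    wordSign (Finsupp.single l 1) = (-1 : ℤ) ^ reducedDegree l • Finsupp.single l 1 := by
  simp [wordSign]

theorem barDifferential_single (l : List (Cube (BasedLoop q))) :
    barDifferential (Finsupp.single l 1) = barWord l := by
  simp [barDifferential]

theorem mergeHead_single (σ : Cube (BasedLoop q)) (l : List (Cube (BasedLoop q))) :
    mergeHead σ (Finsupp.single l 1) = mergeHeadWord σ l := by
  simp [mergeHead]

theorem mergeLast_single (σ : Cube (BasedLoop q)) (l : List (Cube (BasedLoop q))) :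
    mergeLast σ (Finsupp.single l 1) = mergeLastWord σ l := by
  simp [mergeLast]

theorem mergeFirst_single (σ : Cube (BasedLoop q)) (l : List (Cube (BasedLoop q))) :
    mergeFirst σ (Finsupp.single l 1) = mergeFirstWord σ l := by
  simp [mergeFirst]

theorem freeWordBoundary_append (w : FreeWords q) (x : Cube (BasedLoop q)) :
    freeWordBoundary q (w ⋆ letter x) = barDifferential w ⋆ letter x -
      wordSign w ⋆ letters (cubeBoundary x) + mergeLast x w + mergeFirst x w := by
  induction w using words_induction with
  | zero => simp
  | add x y hx hy =>
    simp only [map_add, LinearMap.add_apply, hx, hy]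
    abel
  | smul a x hx => simp only [map_smul, LinearMap.smul_apply, hx, smul_add, smul_sub]
  | single l =>
    rw [letter, append_single, freeWordBoundary, Finsupp.linearCombination_single, one_smul,
      wordBoundary_append, wordSign_single, barDifferential_single, mergeLast_single,
      mergeFirst_single, map_smul, LinearMap.smul_apply, letter]

theorem wordSign_empty : wordSign (emptyWord q) = emptyWord q := by
  rw [emptyWord, wordSign_single]
  simp [reducedDegree]

theorem barDifferential_empty : barDifferential (emptyWord q) = 0 := barDifferential_single _

theorem mergeHead_empty (σ : Cube (BasedLoop q)) : mergeHead σ (emptyWord q) = 0 :=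
  mergeHead_single _ _

theorem mergeLast_empty (σ : Cube (BasedLoop q)) : mergeLast σ (emptyWord q) = 0 :=
  mergeLast_single _ _

theorem mergeFirst_empty (σ : Cube (BasedLoop q)) : mergeFirst σ (emptyWord q) = 0 :=
  mergeFirst_single _ _

theorem wordSign_letter_append (σ : Cube (BasedLoop q)) (w : FreeWords q) :
    wordSign (letter σ ⋆ w) = (-1 : ℤ) ^ (σ.1 + 1) • (letter σ ⋆ wordSign w) := by
  induction w using words_induction with
  | zero => simp
  | add x y hx hy => simp only [map_add, hx, hy, smul_add]
  | smul a x hx => simp only [map_smul, hx, smul_comm a]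
  | single l =>
    rw [letter_append_single, wordSign_single, wordSign_single, reducedDegree_cons, map_smul,
      letter_append_single, smul_smul, pow_add]

theorem barDifferential_letter_append (σ : Cube (BasedLoop q)) (w : FreeWords q) :
    barDifferential (letter σ ⋆ w) = letters (cubeBoundary σ) ⋆ w + mergeHead σ w +
      (-1 : ℤ) ^ (σ.1 + 1) • (letter σ ⋆ barDifferential w) := by
  induction w using words_induction with
  | zero => simp
  | add x y hx hy => simp only [map_add, hx, hy, smul_add]; abel
  | smul a x hx => simp only [map_smul, hx, smul_add, smul_comm a]
  | single l =>
    rw [letter_append_single, barDifferential_single, barWord, insertChain_eq, ← emptyWord,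
      empty_append, mergeHead_single, barDifferential_single]

theorem mergeHead_letter_append (σ τ : Cube (BasedLoop q)) (w : FreeWords q) :
    mergeHead σ (letter τ ⋆ w) = (-1 : ℤ) ^ σ.1 • (letter (cubeMul σ τ) ⋆ w) := by
  induction w using words_induction with
  | zero => simp
  | add x y hx hy => simp only [map_add, hx, hy, smul_add]
  | smul a x hx => simp only [map_smul, hx, smul_comm a]
  | single l => rw [letter_append_single, letter_append_single, mergeHead_single, mergeHeadWord]

theorem mergeLast_append_letter (x y : Cube (BasedLoop q)) (w : FreeWords q) :
    mergeLast x (w ⋆ letter y) = wordSign w ⋆ letter (cubeMul y x) := by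
  induction w using words_induction with
  | zero => simp
  | add x y hx hy => simp only [map_add, LinearMap.add_apply, hx, hy]
  | smul a x hx => simp only [map_smul, LinearMap.smul_apply, hx]
  | single l =>
    rw [letter, append_single, mergeLast_single, wordSign_single, map_smul, LinearMap.smul_apply,
      letter, append_single, mergeLastWord]
    simp [reducedDegree_reverse]

/-- Moving y past w costs a sign which depends on the reduced degree of w; by hypothesis w is
homogeneous modulo 2. Writing the sign as the operator `wordSign ^ y.1` makes the formula linear in
w, so that single words suffice. -/
theorem mergeFirst_letter_append (x y : Cube (BasedLoop q)) {w : FreeWords q} {r : ℕ}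
    (hw : wordSign w = (-1 : ℤ) ^ r • w) :
    mergeFirst x (letter y ⋆ w) = (-1 : ℤ) ^ (y.1 * x.1 + y.1 * r + 1) •
      (w ⋆ letter (cubeMul x y)) := by
  have key : ∀ w : FreeWords q, mergeFirst x (letter y ⋆ w) = (-1 : ℤ) ^ (y.1 * x.1 + 1) •
      ((wordSign ^ y.1) w ⋆ letter (cubeMul x y)) := by
    intro w
    induction w using words_induction with
    | zero => simp
    | add x y hx hy => simp only [map_add, LinearMap.add_apply, hx, hy, smul_add]
    | smul a x hx => simp only [map_smul, LinearMap.smul_apply, hx, smul_comm a]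
    | single l =>
      have : ∀ k : ℕ, (wordSign ^ k) (Finsupp.single l 1 : FreeWords q) =
          (-1 : ℤ) ^ (k * reducedDegree l) • Finsupp.single l 1 := by
        intro k
        induction k with
        | zero => simp
        | succ k ih =>
          rw [pow_succ', Module.End.mul_apply, ih, map_smul, wordSign_single, smul_smul, ← pow_add,
            Nat.succ_mul]
      rw [letter_append_single, mergeFirst_single, mergeFirstWord, this, map_smul,
        LinearMap.smul_apply, smul_smul, ← pow_add, letter, append_single,
        show y.1 * x.1 + y.1 * reducedDegree l + 1 = y.1 * x.1 + 1 + y.1 * reducedDegree l by ring]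
  have : ∀ k : ℕ, (wordSign ^ k) w = (-1 : ℤ) ^ (k * r) • w := by
    intro k
    induction k with
    | zero => simp
    | succ k ih =>
      rw [pow_succ', Module.End.mul_apply, ih, map_smul, hw, smul_smul, ← pow_add, Nat.succ_mul]
  rw [key, this, map_smul, LinearMap.smul_apply, smul_smul, ← pow_add,
    show y.1 * x.1 + y.1 * r + 1 = y.1 * x.1 + 1 + y.1 * r by ring]

end Words

/-! ### Sums over all decompositions of a sequence of points -/

section BarSum

variable {E : Type v} [AddCommGroup E] [Module ℝ E] [TopologicalSpace E]
  [IsTopologicalAddGroup E] [ContinuousSMul ℝ E] {Q : Type u} [TopologicalSpace Q]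
  {q : Q} {f : C(E, Q)}

local notation:70 x:70 " ⋆ " y:71 => appendWords x y

/-- The cube of loops which lead from `u i` to `u j`. -/
def segment (u : ℕ → {x : E // f x = q}) (i j : ℕ) : Cube (BasedLoop q) :=
  edgeCube (fun l => u (i + l)) (j - i)

theorem dim_segment (u : ℕ → {x : E // f x = q}) (i j : ℕ) : (segment u i j).1 = j - i - 1 := rfl

theorem segment_congr {u u' : ℕ → {x : E // f x = q}} {i j i' j' : ℕ} (h : j - i = j' - i')
    (hu : ∀ l ≤ j - i, u (i + l) = u' (i' + l)) : segment u i j = segment u' i' j' := by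
  rw [segment, segment, ← h]
  exact edgeCube_congr hu

/-- The direction k of the cube belongs to the inner vertex p = i + 1 + k, whence the sign. -/
theorem cubeBoundary_segment (u : ℕ → {x : E // f x = q}) (i j : ℕ) :
    letters (cubeBoundary (segment u i j)) = ∑ p ∈ Finset.Ico (i + 1) j, (-1 : ℤ) ^ (p + i + 1) •
      (letter (cubeMul (segment u i p) (segment u p j)) -
        letter (segment (u ∘ skip p) i (j - 1))) := by
  rw [segment, cubeBoundary_edgeCube, map_sum,
    Finset.sum_Ico_eq_sum_range, show j - i - 1 = j - (i + 1) by omega]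
  refine Finset.sum_congr rfl fun k hk => ?_
  rw [Finset.mem_range] at hk
  rw [map_smul, map_sub, letters_single, letters_single,
    neg_one_pow_congr_mod (a := k) (b := i + 1 + k + i + 1) (by omega)]
  have e1 : segment u i (i + 1 + k) = edgeCube (fun l => u (i + l)) (k + 1) := by
    rw [segment, show i + 1 + k - i = k + 1 by omega]
  have e2 : segment u (i + 1 + k) j = edgeCube (fun l => u (i + (k + 1 + l))) (j - i - (k + 1)) := by
    rw [segment, show j - (i + 1 + k) = j - i - (k + 1) by omega]
    exact edgeCube_congr fun l _ => congrArg u (by omega)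
  have e3 : segment (u ∘ skip (i + 1 + k)) i (j - 1) =
      edgeCube ((fun l => u (i + l)) ∘ skip (k + 1)) (j - (i + 1)) := by
    rw [segment, show j - 1 - i = j - (i + 1) by omega]
    refine edgeCube_congr fun l _ => congrArg u ?_
    simp only [skip]
    split_ifs <;> omega
  rw [e1, e2, e3]

/-- The alternating sum over all decompositions of the sequence `u 0, …, u n`. -/
def barSum : ℕ → (ℕ → {x : E // f x = q}) → FreeWords q
  | 0, _ => emptyWord q
  | n + 1, u => - ∑ c : Fin (n + 1),
      letter (edgeCube u (c + 1)) ⋆ barSum (n - c) fun l => u (c + 1 + l)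

theorem barSum_congr (n : ℕ) : ∀ {u u' : ℕ → {x : E // f x = q}}, (∀ l ≤ n, u l = u' l) →
    barSum n u = barSum n u' := by
  induction n using Nat.strong_induction_on with
  | _ n ih =>
    intro u u' h
    cases n with
    | zero => rw [barSum, barSum]
    | succ n =>
      rw [barSum, barSum]
      refine congrArg _ (Finset.sum_congr rfl fun c _ => ?_)
      have hc := c.2
      rw [edgeCube_congr fun l hl => h l (by omega),
        ih (n - c) (by omega) fun l hl => h (c + 1 + l) (by omega)]

/-- The alternating sum over all decompositions of the sequence `u i, …, u j`. -/
def bars (u : ℕ → {x : E // f x = q}) (i j : ℕ) : FreeWords q := barSum (j - i) fun l => u (i + l)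

theorem bars_congr {u u' : ℕ → {x : E // f x = q}} {i j i' j' : ℕ} (h : j - i = j' - i')
    (hu : ∀ l ≤ j - i, u (i + l) = u' (i' + l)) : bars u i j = bars u' i' j' := by
  rw [bars, bars, ← h]
  exact barSum_congr _ hu

theorem bars_self (u : ℕ → {x : E // f x = q}) (i : ℕ) : bars u i i = emptyWord q := by
  rw [bars, Nat.sub_self, barSum]

theorem bars_left (u : ℕ → {x : E // f x = q}) {i j : ℕ} (h : i < j) :
    bars u i j = - ∑ c ∈ Finset.Ico (i + 1) (j + 1), letter (segment u i c) ⋆ bars u c j := by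
  obtain ⟨n, rfl⟩ : ∃ n, j = i + n + 1 := ⟨j - i - 1, by omega⟩
  rw [bars, show i + n + 1 - i = n + 1 by omega, barSum, Finset.sum_Ico_eq_sum_range,
    show i + n + 1 + 1 - (i + 1) = n + 1 by omega, Finset.sum_range]
  refine congrArg _ (Finset.sum_congr rfl fun c _ => ?_)
  have hc := c.2
  rw [segment, bars, show i + 1 + (c : ℕ) - i = c + 1 by omega,
    show i + n + 1 - (i + 1 + (c : ℕ)) = n - c by omega]
  congr 2
  refine funext fun l => congrArg u (by omega)

/-- A decomposition can be read from its last letter as well as from its first. Expanding both sides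
once more gives the same double sum over the first and the last cut. -/
theorem bars_right (u : ℕ → {x : E // f x = q}) {i j : ℕ} (h : i < j) :
    bars u i j = - ∑ c ∈ Finset.Ico i j, bars u i c ⋆ letter (segment u c j) := by
  obtain ⟨n, hn⟩ : ∃ n, n = j - i := ⟨_, rfl⟩
  induction n using Nat.strong_induction_on generalizing i with
  | _ n ih =>
    -- The shorter tail from c is expanded by induction from its right end, the head before d by
    -- definition from its left end.
    have h1 : ∀ c ∈ Finset.Ico (i + 1) j, letter (segment u i c) ⋆ bars u c j =
        - ∑ d ∈ Finset.Ico c j, letter (segment u i c) ⋆ bars u c d ⋆ letter (segment u d j) := by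
      intro c hc
      rw [Finset.mem_Ico] at hc
      rw [ih (j - c) (by omega) hc.2 rfl, map_neg, map_sum]
      simp only [append_assoc]
    have h2 : ∀ d ∈ Finset.Ico (i + 1) j, bars u i d ⋆ letter (segment u d j) =
        - ∑ c ∈ Finset.Ico (i + 1) (d + 1),
          letter (segment u i c) ⋆ bars u c d ⋆ letter (segment u d j) := by
      intro d hd
      rw [Finset.mem_Ico] at hd
      rw [bars_left u (show i < d by omega), map_neg, map_sum, LinearMap.neg_apply,
        LinearMap.sum_apply]
    rw [bars_left u h, Finset.sum_Ico_succ_top (by omega), Finset.sum_congr rfl h1,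
      Finset.sum_eq_sum_Ico_succ_bot h, Finset.sum_congr rfl h2, bars_self, bars_self,
      empty_append, append_empty, Finset.sum_neg_distrib, Finset.sum_neg_distrib, add_comm]
    congr 3
    refine Finset.sum_comm' fun x y => ?_
    simp only [Finset.mem_Ico]
    omega

/-- A letter from i to c has dimension c - i - 1 and thus reduced degree c - i, so every word of the
sum has reduced degree j - i. -/
theorem wordSign_bars (u : ℕ → {x : E // f x = q}) {i j : ℕ} (h : i ≤ j) :
    wordSign (bars u i j) = (-1 : ℤ) ^ (i + j) • bars u i j := by
  obtain ⟨n, hn⟩ : ∃ n, n = j - i := ⟨_, rfl⟩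
  induction n using Nat.strong_induction_on generalizing i with
  | _ n ih =>
    rcases h.eq_or_lt with rfl | h
    · rw [bars_self, wordSign_empty, ← two_mul, pow_mul]
      simp
    · rw [bars_left u h, map_neg, map_sum, smul_neg, Finset.smul_sum]
      refine congrArg _ (Finset.sum_congr rfl fun c hc => ?_)
      rw [Finset.mem_Ico] at hc
      rw [wordSign_letter_append, ih (j - c) (by omega) (by omega) rfl, map_smul, smul_smul,
        ← pow_add, dim_segment]
      congr 1
      exact neg_one_pow_congr_mod (by omega)

theorem segment_skip_of_lt (u : ℕ → {x : E // f x = q}) {i j p : ℕ} (hij : i ≤ j) (h : j < p) :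
    segment (u ∘ skip p) i j = segment u i j :=
  segment_congr rfl fun l hl => congrArg u (skip_of_lt (by omega))

theorem bars_skip_of_le (u : ℕ → {x : E // f x = q}) {i j p : ℕ} (h : p ≤ i) :
    bars (u ∘ skip p) i j = bars u (i + 1) (j + 1) :=
  bars_congr (by omega) fun l hl => congrArg u (by rw [skip_of_le (by omega)]; omega)

/-- The faces of a letter at an inner vertex p are a product of two letters and a letter that omits
p. The same product arises by multiplying neighbouring letters in the decomposition which is also
cut at p. That decomposition has one more letter, hence the opposite sign, and the products cancel.
Only the omissions remain. -/
theorem barDifferential_bars (u : ℕ → {x : E // f x = q}) {i j : ℕ} (h : i ≤ j) :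
    barDifferential (bars u i j) = ∑ p ∈ Finset.Ico (i + 1) j,
      (-1 : ℤ) ^ (p + i) • bars (u ∘ skip p) i (j - 1) := by
  obtain ⟨n, hn⟩ : ∃ n, n = j - i := ⟨_, rfl⟩
  induction n using Nat.strong_induction_on generalizing i with
  | _ n ih =>
    rcases h.eq_or_lt with rfl | h
    · rw [bars_self, barDifferential_empty, Finset.Ico_eq_empty (by omega), Finset.sum_empty]
    -- The first letter ends at c. The induction hypothesis covers the rest of the word, so only the
    -- faces of this letter and its product with the next one are new.
    have step : ∀ c ∈ Finset.Ico (i + 1) (j + 1),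
        barDifferential (letter (segment u i c) ⋆ bars u c j) =
        ∑ p ∈ Finset.Ico (i + 1) c, (-1 : ℤ) ^ (p + i + 1) •
          (letter (cubeMul (segment u i p) (segment u p c)) ⋆ bars u c j) -
        ∑ p ∈ Finset.Ico (i + 1) c, (-1 : ℤ) ^ (p + i + 1) •
          (letter (segment (u ∘ skip p) i (c - 1)) ⋆ bars u c j) -
        ∑ d ∈ Finset.Ico (c + 1) (j + 1), (-1 : ℤ) ^ (c + i + 1) •
          (letter (cubeMul (segment u i c) (segment u c d)) ⋆ bars u d j) +
        ∑ p ∈ Finset.Ico (c + 1) j, (-1 : ℤ) ^ (p + i) •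
          (letter (segment u i c) ⋆ bars (u ∘ skip p) c (j - 1)) := by
      intro c hc
      rw [Finset.mem_Ico] at hc
      have e1 : mergeHead (segment u i c) (bars u c j) =
          - ∑ d ∈ Finset.Ico (c + 1) (j + 1), (-1 : ℤ) ^ (c + i + 1) •
            (letter (cubeMul (segment u i c) (segment u c d)) ⋆ bars u d j) := by
        rcases (show c ≤ j by omega).eq_or_lt with rfl | hcj
        · rw [bars_self, mergeHead_empty, Finset.Ico_eq_empty (by omega), Finset.sum_empty, neg_zero]
        · rw [bars_left u hcj, map_neg, map_sum]
          refine congrArg _ (Finset.sum_congr rfl fun d _ => ?_)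
          rw [mergeHead_letter_append, dim_segment]
          congr 1
          exact neg_one_pow_congr_mod (by omega)
      rw [barDifferential_letter_append, cubeBoundary_segment, e1,
        ih (j - c) (by omega) (by omega) rfl, map_sum, map_sum, LinearMap.sum_apply,
        Finset.smul_sum, ← sub_eq_add_neg, ← Finset.sum_sub_distrib]
      congr 2
      · refine Finset.sum_congr rfl fun p _ => ?_
        rw [map_smul, LinearMap.smul_apply, map_sub, LinearMap.sub_apply, smul_sub]
      · refine funext fun p => ?_
        rw [map_smul, smul_smul, ← pow_add, dim_segment]
        congr 1
        exact neg_one_pow_congr_mod (by omega)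
    -- A cut p introduced by a face of the first letter up to c is the same as a first cut that is
    -- removed by multiplication.
    have hcancel : ∑ c ∈ Finset.Ico (i + 1) (j + 1), ∑ p ∈ Finset.Ico (i + 1) c,
        (-1 : ℤ) ^ (p + i + 1) •
          (letter (cubeMul (segment u i p) (segment u p c)) ⋆ bars u c j) =
        ∑ c ∈ Finset.Ico (i + 1) (j + 1), ∑ d ∈ Finset.Ico (c + 1) (j + 1),
          (-1 : ℤ) ^ (c + i + 1) •
            (letter (cubeMul (segment u i c) (segment u c d)) ⋆ bars u d j) := by
      refine Finset.sum_comm' fun x y => ?_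
      simp only [Finset.mem_Ico]
      omega
    have h2 : ∑ c ∈ Finset.Ico (i + 1) (j + 1), ∑ p ∈ Finset.Ico (i + 1) c,
        (-1 : ℤ) ^ (p + i + 1) • (letter (segment (u ∘ skip p) i (c - 1)) ⋆ bars u c j) =
        ∑ p ∈ Finset.Ico (i + 1) j, ∑ c ∈ Finset.Ico (p + 1) (j + 1),
          (-1 : ℤ) ^ (p + i + 1) • (letter (segment (u ∘ skip p) i (c - 1)) ⋆ bars u c j) := by
      refine Finset.sum_comm' fun x y => ?_
      simp only [Finset.mem_Ico]
      omega
    have h4 : ∑ c ∈ Finset.Ico (i + 1) (j + 1), ∑ p ∈ Finset.Ico (c + 1) j,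
        (-1 : ℤ) ^ (p + i) • (letter (segment u i c) ⋆ bars (u ∘ skip p) c (j - 1)) =
        ∑ p ∈ Finset.Ico (i + 1) j, ∑ c ∈ Finset.Ico (i + 1) p,
          (-1 : ℤ) ^ (p + i) • (letter (segment u i c) ⋆ bars (u ∘ skip p) c (j - 1)) := by
      refine Finset.sum_comm' fun x y => ?_
      simp only [Finset.mem_Ico]
      omega
    rw [bars_left u h, map_neg, map_sum, Finset.sum_congr rfl step, Finset.sum_add_distrib,
      Finset.sum_sub_distrib, Finset.sum_sub_distrib, hcancel, sub_right_comm, sub_self, h2, h4,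
      zero_sub, ← Finset.sum_neg_distrib, ← Finset.sum_add_distrib, ← Finset.sum_neg_distrib]
    refine Finset.sum_congr rfl fun p hp => ?_
    rw [Finset.mem_Ico] at hp
    -- Cuts c ≥ p of the sequence without p are the cuts c + 1 > p of the original sequence.
    have e5 : ∑ c ∈ Finset.Ico p j, letter (segment (u ∘ skip p) i c) ⋆ bars (u ∘ skip p) c (j - 1) =
        ∑ c ∈ Finset.Ico (p + 1) (j + 1),
          letter (segment (u ∘ skip p) i (c - 1)) ⋆ bars u c j := by
      rw [← Finset.sum_Ico_add' (fun c => letter (segment (u ∘ skip p) i (c - 1)) ⋆ bars u c j) p j 1]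
      refine Finset.sum_congr rfl fun c hc => ?_
      rw [Finset.mem_Ico] at hc
      rw [bars_skip_of_le _ hc.1, Nat.add_sub_cancel, Nat.sub_add_cancel (by omega)]
    have e6 : ∑ c ∈ Finset.Ico (i + 1) p,
          letter (segment (u ∘ skip p) i c) ⋆ bars (u ∘ skip p) c (j - 1) =
        ∑ c ∈ Finset.Ico (i + 1) p, letter (segment u i c) ⋆ bars (u ∘ skip p) c (j - 1) := by
      refine Finset.sum_congr rfl fun c hc => ?_
      rw [Finset.mem_Ico] at hc
      rw [segment_skip_of_lt _ (by omega) hc.2]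
    rw [bars_left _ (show i < j - 1 by omega), show j - 1 + 1 = j by omega,
      ← Finset.sum_Ico_consecutive _ hp.1 hp.2.le, e5, e6, ← Finset.smul_sum, ← Finset.smul_sum,
      pow_succ]
    module

end BarSum

/-! ### The Hochschild chain of a closed polygon and its boundary -/

section CyclicChain

variable {E : Type v} [AddCommGroup E] [Module ℝ E] [TopologicalSpace E]
  [IsTopologicalAddGroup E] [ContinuousSMul ℝ E] {Q : Type u} [TopologicalSpace Q]
  {q : Q} {f : C(E, Q)}

local notation:70 x:70 " ⋆ " y:71 => appendWords x y

/-- Two periods of the periodic sequence with period `v 0, …, v (N - 1)`. -/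
def cyc {Y : Type*} (v : ℕ → Y) (N i : ℕ) : Y := if i < N then v i else v (i - N)

theorem cyc_of_lt {Y : Type*} (v : ℕ → Y) {N i : ℕ} (h : i < N) : cyc v N i = v i := if_pos h

theorem cyc_of_le {Y : Type*} (v : ℕ → Y) {N i : ℕ} (h : N ≤ i) : cyc v N i = v (i - N) :=
  if_neg (by omega)

theorem cyc_add {Y : Type*} (v : ℕ → Y) (N i : ℕ) : cyc v N (N + i) = v i := by
  rw [cyc_of_le _ (by omega), Nat.add_sub_cancel_left]

/-- The Hochschild chain of a sequence `v 0, …, v (N - 1)` of points. -/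
def cyclicChain (N : ℕ) (v : ℕ → {x : E // f x = q}) : FreeWords q :=
  ∑ b ∈ Finset.range N, ∑ a ∈ Finset.range (b + 1), (-1 : ℤ) ^ (b + N + 1 + a * N) •
    (bars (cyc v N) a b ⋆ letter (segment (cyc v N) b (N + a)))

/-- Omitting a vertex p different from the cuts a ≤ b leaves cuts of a sequence with one vertex
less, each index dropping by one if it exceeds p. For every p, each pair of cuts of the shorter
sequence arises exactly once. -/
theorem sum_cyclic_faces {M : Type*} [AddCommGroup M] (G : ℕ → ℕ → ℕ → M) (N : ℕ) :
    ∑ b ∈ Finset.range N, ∑ a ∈ Finset.range (b + 1), (∑ p ∈ Finset.Ico (a + 1) b, G p a (b - 1) +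
      ∑ p ∈ Finset.Ico (b + 1) N, G p a b + ∑ p ∈ Finset.range a, G p (a - 1) (b - 1)) =
    ∑ p ∈ Finset.range N, ∑ b ∈ Finset.range (N - 1), ∑ a ∈ Finset.range (b + 1), G p a b := by
  induction N with
  | zero => simp
  | succ N ih =>
    cases N with
    | zero => simp
    | succ N =>
      have h1 : ∀ b ∈ Finset.range (N + 1), ∑ a ∈ Finset.range (b + 1),
          (∑ p ∈ Finset.Ico (a + 1) b, G p a (b - 1) + ∑ p ∈ Finset.Ico (b + 1) (N + 1 + 1), G p a b +
            ∑ p ∈ Finset.range a, G p (a - 1) (b - 1)) =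
          ∑ a ∈ Finset.range (b + 1), (∑ p ∈ Finset.Ico (a + 1) b, G p a (b - 1) +
            ∑ p ∈ Finset.Ico (b + 1) (N + 1), G p a b +
            ∑ p ∈ Finset.range a, G p (a - 1) (b - 1)) +
          ∑ a ∈ Finset.range (b + 1), G (N + 1) a b := by
        intro b hb
        rw [Finset.mem_range] at hb
        rw [← Finset.sum_add_distrib]
        refine Finset.sum_congr rfl fun a _ => ?_
        rw [Finset.sum_Ico_succ_top (by omega)]
        abel
      -- If b is the new last vertex, the omitted vertices between a and b and, after a shift of a,
      -- those below a together fill a complete range.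
      have h2 : ∑ a ∈ Finset.range (N + 1 + 1), (∑ p ∈ Finset.Ico (a + 1) (N + 1), G p a (N + 1 - 1) +
          ∑ p ∈ Finset.Ico (N + 1 + 1) (N + 1 + 1), G p a (N + 1) +
            ∑ p ∈ Finset.range a, G p (a - 1) (N + 1 - 1)) =
          ∑ p ∈ Finset.range (N + 1), ∑ a ∈ Finset.range (N + 1), G p a N := by
        simp only [Finset.Ico_self, Finset.sum_empty, add_zero, Nat.add_sub_cancel,
          Finset.sum_add_distrib]
        rw [Finset.sum_range_succ, Finset.Ico_eq_empty (by omega), Finset.sum_empty, add_zero,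
          Finset.sum_range_succ' _ (N + 1), Finset.range_zero, Finset.sum_empty, add_zero,
          ← Finset.sum_add_distrib, Finset.sum_comm]
        refine Finset.sum_congr rfl fun a ha => ?_
        rw [Finset.mem_range] at ha
        rw [add_comm, Nat.add_sub_cancel, Finset.range_eq_Ico, Finset.range_eq_Ico,
          Finset.sum_Ico_consecutive _ (by omega) (by omega)]
      rw [Finset.sum_range_succ, Finset.sum_congr rfl h1, Finset.sum_add_distrib, ih, h2,
        Finset.sum_range_succ _ (N + 1)]
      simp only [Nat.add_sub_cancel]
      have h3 : ∀ p, ∑ b ∈ Finset.range (N + 1), ∑ a ∈ Finset.range (b + 1), G p a b =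
          ∑ b ∈ Finset.range N, ∑ a ∈ Finset.range (b + 1), G p a b +
            ∑ a ∈ Finset.range (N + 1), G p a N := fun p => Finset.sum_range_succ _ _
      simp only [h3, Finset.sum_add_distrib]
      abel

/-- The five sums are, in order, the bar differential of the first letters, the faces at 1 and at 0
of the last letter, its product with the letter before it, and its product with the first letter,
which follows it in cyclic order. -/
theorem freeWordBoundary_bars_append (v : ℕ → {x : E // f x = q}) {N a b : ℕ} (hab : a ≤ b)
    (hb : b < N) : freeWordBoundary q (bars (cyc v N) a b ⋆ letter (segment (cyc v N) b (N + a))) =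
      ∑ p ∈ Finset.Ico (a + 1) b, (-1 : ℤ) ^ (p + a) •
        (bars (cyc v N ∘ skip p) a (b - 1) ⋆ letter (segment (cyc v N) b (N + a))) -
      ∑ p ∈ Finset.Ico (b + 1) (N + a), (-1 : ℤ) ^ (a + p + 1) • (bars (cyc v N) a b ⋆
        letter (cubeMul (segment (cyc v N) b p) (segment (cyc v N) p (N + a)))) +
      ∑ p ∈ Finset.Ico (b + 1) (N + a), (-1 : ℤ) ^ (a + p + 1) • (bars (cyc v N) a b ⋆
        letter (segment (cyc v N ∘ skip p) b (N + a - 1))) -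
      ∑ c ∈ Finset.Ico a b, (-1 : ℤ) ^ (a + c) • (bars (cyc v N) a c ⋆
        letter (cubeMul (segment (cyc v N) c b) (segment (cyc v N) b (N + a)))) -
      ∑ c ∈ Finset.Ico (a + 1) (b + 1), (-1 : ℤ) ^ ((c + a) * N + N + c + a) •
        (bars (cyc v N) c b ⋆ letter (cubeMul (segment (cyc v N) b (N + a))
          (segment (cyc v N) (N + a) (N + c)))) := by
  have e3 : mergeLast (segment (cyc v N) b (N + a)) (bars (cyc v N) a b) =
      - ∑ c ∈ Finset.Ico a b, (-1 : ℤ) ^ (a + c) • (bars (cyc v N) a c ⋆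
        letter (cubeMul (segment (cyc v N) c b) (segment (cyc v N) b (N + a)))) := by
    rcases hab.eq_or_lt with rfl | hab
    · rw [bars_self, mergeLast_empty, Finset.Ico_self, Finset.sum_empty, neg_zero]
    · rw [bars_right _ hab, map_neg, map_sum]
      refine congrArg _ (Finset.sum_congr rfl fun c hc => ?_)
      rw [Finset.mem_Ico] at hc
      rw [mergeLast_append_letter, wordSign_bars _ hc.1, map_smul, LinearMap.smul_apply]
  have e4 : mergeFirst (segment (cyc v N) b (N + a)) (bars (cyc v N) a b) =
      - ∑ c ∈ Finset.Ico (a + 1) (b + 1), (-1 : ℤ) ^ ((c + a) * N + N + c + a) •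
        (bars (cyc v N) c b ⋆ letter (cubeMul (segment (cyc v N) b (N + a))
          (segment (cyc v N) (N + a) (N + c)))) := by
    rcases hab.eq_or_lt with rfl | hab
    · rw [bars_self, mergeFirst_empty, Finset.Ico_self, Finset.sum_empty, neg_zero]
    · rw [bars_left _ hab, map_neg, map_sum]
      refine congrArg _ (Finset.sum_congr rfl fun c hc => ?_)
      rw [Finset.mem_Ico] at hc
      -- One period later the first letter, from a to c, becomes a segment which directly continues
      -- the last letter.
      have e5 : segment (cyc v N) (N + a) (N + c) = segment (cyc v N) a c :=
        segment_congr (by omega) fun l hl => by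
          rw [add_assoc, cyc_add, cyc_of_lt _ (by omega)]
      rw [mergeFirst_letter_append _ _ (wordSign_bars _ (show c ≤ b by omega)), e5, dim_segment,
        dim_segment]
      congr 1
      -- Using the gaps as variables removes the truncated subtractions. The parities of the
      -- quadratic exponents then agree because g * g and g have the same parity.
      obtain ⟨g, rfl⟩ : ∃ g, c = a + 1 + g := ⟨c - (a + 1), by omega⟩
      obtain ⟨r, rfl⟩ : ∃ r, b = a + 1 + g + r := ⟨b - (a + 1 + g), by omega⟩
      obtain ⟨s, rfl⟩ : ∃ s, N = a + 1 + g + r + 1 + s := ⟨N - (a + 1 + g + r + 1), by omega⟩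
      rw [show a + 1 + g - a - 1 = g by omega,
        show a + 1 + g + r + 1 + s + a - (a + 1 + g + r) - 1 = a + s by omega]
      refine neg_one_pow_congr_mod ?_
      have h1 : g * (a + s) + g * (a + 1 + g + (a + 1 + g + r)) + 1 =
        3 * (g * a) + g * s + 2 * g + 2 * (g * g) + g * r + 1 := by ring
      have h2 : (a + 1 + g + a) * (a + 1 + g + r + 1 + s) + (a + 1 + g + r + 1 + s) + (a + 1 + g) + a =
        2 * (a * (a + 1 + g + r + 1 + s)) + g * g + 5 * g + g * a + g * r + g * s + 4 * a +
          2 * r + 2 * s + 5 := by ring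
      have h3 : (g * g) % 2 = g % 2 := by
        rcases Nat.mod_two_eq_zero_or_one g with h | h <;> simp [Nat.mul_mod, h]
      omega
  rw [freeWordBoundary_append, e3, e4, barDifferential_bars _ hab, wordSign_bars _ hab,
    cubeBoundary_segment, map_sum, LinearMap.sum_apply, map_sum, ← sub_eq_add_neg,
    ← sub_eq_add_neg]
  congr 2
  rw [sub_add, ← Finset.sum_sub_distrib]
  congr 1
  · refine Finset.sum_congr rfl fun p _ => ?_
    rw [map_smul, LinearMap.smul_apply]
  · refine Finset.sum_congr rfl fun p _ => ?_
    rw [map_smul, map_smul, LinearMap.smul_apply, smul_smul, ← pow_add, map_sub, smul_sub,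
      neg_one_pow_congr_mod (show (p + b + 1 + (a + b)) % 2 = (a + p + 1) % 2 by omega)]

/-- Faces at 1 of the last letter cut it in two. Such a product also arises when the last letter is
multiplied with a cyclic neighbour in another term, and the signs of `cyclicChain` make the two
cancel. The omissions inside the first letters and inside the last letter, before and after the
closing edge, add up to the simplicial boundary by `sum_cyclic_faces`. -/
theorem freeWordBoundary_cyclicChain (N : ℕ) (v : ℕ → {x : E // f x = q}) :
    freeWordBoundary q (cyclicChain N v) =
      ∑ p ∈ Finset.range N, (-1 : ℤ) ^ p • cyclicChain (N - 1) (v ∘ skip p) := by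
  set V := cyc v N with hV
  let G : ℕ → ℕ → ℕ → FreeWords q := fun p a b => (-1 : ℤ) ^ p • ((-1 : ℤ) ^ (b + (N - 1) + 1 + a * (N - 1)) •
    (bars (cyc (v ∘ skip p) (N - 1)) a b ⋆ letter (segment (cyc (v ∘ skip p) (N - 1)) b (N - 1 + a))))
  have hR : ∑ p ∈ Finset.range N, (-1 : ℤ) ^ p • cyclicChain (N - 1) (v ∘ skip p) =
      ∑ p ∈ Finset.range N, ∑ b ∈ Finset.range (N - 1), ∑ a ∈ Finset.range (b + 1), G p a b := by
    simp only [cyclicChain, Finset.smul_sum, G]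
  let P : ℕ → ℕ → ℕ → FreeWords q := fun a b p => (-1 : ℤ) ^ (b + N + a * N + a + p) • (bars V a b ⋆
    letter (cubeMul (segment V b p) (segment V p (N + a))))
  have key : ∀ b ∈ Finset.range N, ∀ a ∈ Finset.range (b + 1),
      freeWordBoundary q ((-1 : ℤ) ^ (b + N + 1 + a * N) • (bars V a b ⋆ letter (segment V b (N + a)))) =
      (∑ p ∈ Finset.Ico (a + 1) b, G p a (b - 1) +
        ∑ p ∈ Finset.Ico (b + 1) N, G p a b + ∑ p ∈ Finset.range a, G p (a - 1) (b - 1)) +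
      (∑ c ∈ Finset.Ico a b, P a c b - ∑ p ∈ Finset.Ico (b + 1) N, P a b p) +
      (∑ c ∈ Finset.Ico (a + 1) (b + 1), P c b (N + a) - ∑ p ∈ Finset.range a, P a b (N + p)) := by
    intro b hb a ha
    rw [Finset.mem_range] at hb ha
    have g1 : ∀ p ∈ Finset.Ico (a + 1) b, G p a (b - 1) = (-1 : ℤ) ^ (b + N + 1 + a * N) •
        (-1 : ℤ) ^ (p + a) • (bars (V ∘ skip p) a (b - 1) ⋆ letter (segment V b (N + a))) := by
      intro p hp
      rw [Finset.mem_Ico] at hp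
      simp only [G]
      rw [smul_smul, smul_smul, ← pow_add, ← pow_add]
      refine congrArg₂ (· • ·) ?_ (congrArg₂ (fun x y => x ⋆ letter y) ?_ ?_)
      · refine neg_one_pow_congr_mod ?_
        obtain ⟨M, rfl⟩ : ∃ M, N = M + 1 := ⟨N - 1, by omega⟩
        rw [Nat.add_sub_cancel, mul_add]
        omega
      · refine bars_congr rfl fun l hl => ?_
        simp only [hV, Function.comp, cyc, skip]
        split_ifs <;> first | rfl | omega
      · refine segment_congr (by omega) fun l hl => ?_
        simp only [hV, Function.comp, cyc, skip]
        split_ifs <;> first | rfl | omega | (congr 1; omega)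
    have g2 : ∀ p ∈ Finset.Ico (b + 1) N, G p a b = (-1 : ℤ) ^ (b + N + 1 + a * N) •
        (-1 : ℤ) ^ (a + p + 1) • (bars V a b ⋆ letter (segment (V ∘ skip p) b (N + a - 1))) := by
      intro p hp
      rw [Finset.mem_Ico] at hp
      simp only [G]
      rw [smul_smul, smul_smul, ← pow_add, ← pow_add]
      refine congrArg₂ (· • ·) ?_ (congrArg₂ (fun x y => x ⋆ letter y) ?_ ?_)
      · refine neg_one_pow_congr_mod ?_
        obtain ⟨M, rfl⟩ : ∃ M, N = M + 1 := ⟨N - 1, by omega⟩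
        rw [Nat.add_sub_cancel, mul_add]
        omega
      · refine bars_congr rfl fun l hl => ?_
        simp only [hV, Function.comp, cyc, skip]
        split_ifs <;> first | rfl | omega
      · refine segment_congr (by omega) fun l hl => ?_
        simp only [hV, Function.comp, cyc, skip]
        split_ifs <;> first | rfl | omega | (congr 1; omega)
    -- A vertex p < a occurs only in the last letter, as N + p. Omitting it lowers both cuts by one.
    have g3 : ∀ p ∈ Finset.range a, G p (a - 1) (b - 1) = (-1 : ℤ) ^ (b + N + 1 + a * N) •
        (-1 : ℤ) ^ (a + (N + p) + 1) • (bars V a b ⋆ letter (segment (V ∘ skip (N + p)) b (N + a - 1))) := by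
      intro p hp
      rw [Finset.mem_range] at hp
      simp only [G]
      rw [smul_smul, smul_smul, ← pow_add, ← pow_add]
      refine congrArg₂ (· • ·) ?_ (congrArg₂ (fun x y => x ⋆ letter y) ?_ ?_)
      · refine neg_one_pow_congr_mod ?_
        obtain ⟨M, rfl⟩ : ∃ M, N = M + 1 := ⟨N - 1, by omega⟩
        obtain ⟨c, rfl⟩ : ∃ c, a = c + 1 := ⟨a - 1, by omega⟩
        rw [Nat.add_sub_cancel, Nat.add_sub_cancel, show (c + 1) * (M + 1) = c * M + c + M + 1 by ring]
        omega
      · refine bars_congr (by omega) fun l hl => ?_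
        simp only [hV, Function.comp, cyc, skip]
        split_ifs <;> first | rfl | omega | (congr 1; omega)
      · refine segment_congr (by omega) fun l hl => ?_
        simp only [hV, Function.comp, cyc, skip]
        split_ifs <;> first | rfl | omega | (congr 1; omega)
    have split : ∀ F : ℕ → FreeWords q, ∑ p ∈ Finset.Ico (b + 1) (N + a), F p =
        ∑ p ∈ Finset.Ico (b + 1) N, F p + ∑ p ∈ Finset.range a, F (N + p) := by
      intro F
      rw [← Finset.sum_Ico_consecutive _ (show b + 1 ≤ N by omega) (Nat.le_add_right N a),
        Finset.sum_Ico_eq_sum_range _ N, Nat.add_sub_cancel_left]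
    rw [map_smul, freeWordBoundary_bars_append _ (by omega) hb, split, split, ← hV,
      Finset.sum_congr rfl g1, Finset.sum_congr rfl g2, Finset.sum_congr rfl g3,
      ← Finset.smul_sum, ← Finset.smul_sum, ← Finset.smul_sum]
    have h1 : ∑ c ∈ Finset.Ico a b, P a c b = - ((-1 : ℤ) ^ (b + N + 1 + a * N) •
        ∑ c ∈ Finset.Ico a b, (-1 : ℤ) ^ (a + c) • (bars V a c ⋆
          letter (cubeMul (segment V c b) (segment V b (N + a))))) := by
      rw [Finset.smul_sum, ← Finset.sum_neg_distrib]
      refine Finset.sum_congr rfl fun c _ => ?_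
      simp only [P]
      rw [smul_smul, ← neg_smul, ← pow_add]
      congr 1
      exact neg_one_pow_succ_mod (by omega)
    have h2 : ∑ p ∈ Finset.Ico (b + 1) N, P a b p = (-1 : ℤ) ^ (b + N + 1 + a * N) •
        ∑ p ∈ Finset.Ico (b + 1) N, (-1 : ℤ) ^ (a + p + 1) • (bars V a b ⋆
          letter (cubeMul (segment V b p) (segment V p (N + a)))) := by
      rw [Finset.smul_sum]
      refine Finset.sum_congr rfl fun c _ => ?_
      simp only [P]
      rw [smul_smul, ← pow_add]
      congr 1
      exact neg_one_pow_congr_mod (by omega)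
    have h3 : ∑ p ∈ Finset.range a, P a b (N + p) = (-1 : ℤ) ^ (b + N + 1 + a * N) •
        ∑ p ∈ Finset.range a, (-1 : ℤ) ^ (a + (N + p) + 1) • (bars V a b ⋆
          letter (cubeMul (segment V b (N + p)) (segment V (N + p) (N + a)))) := by
      rw [Finset.smul_sum]
      refine Finset.sum_congr rfl fun c _ => ?_
      simp only [P]
      rw [smul_smul, ← pow_add]
      congr 1
      exact neg_one_pow_congr_mod (by omega)
    have h4 : ∑ c ∈ Finset.Ico (a + 1) (b + 1), P c b (N + a) = - ((-1 : ℤ) ^ (b + N + 1 + a * N) •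
        ∑ c ∈ Finset.Ico (a + 1) (b + 1), (-1 : ℤ) ^ ((c + a) * N + N + c + a) •
          (bars V c b ⋆ letter (cubeMul (segment V b (N + a)) (segment V (N + a) (N + c))))) := by
      rw [Finset.smul_sum, ← Finset.sum_neg_distrib]
      refine Finset.sum_congr rfl fun c _ => ?_
      simp only [P]
      rw [smul_smul, ← neg_smul, ← pow_add]
      congr 1
      refine neg_one_pow_succ_mod ?_
      rw [add_mul]
      omega
    rw [h1, h2, h3, h4]
    module
  rw [hR, ← sum_cyclic_faces, cyclicChain, map_sum]
  simp only [map_sum]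
  rw [Finset.sum_congr rfl fun b hb => Finset.sum_congr rfl (key b hb)]
  simp only [Finset.sum_add_distrib, Finset.sum_sub_distrib]
  -- Products with the preceding letter cancel the cuts of the last letter before the closing edge.
  have c1 : ∑ b ∈ Finset.range N, ∑ a ∈ Finset.range (b + 1), ∑ c ∈ Finset.Ico a b, P a c b =
      ∑ b ∈ Finset.range N, ∑ a ∈ Finset.range (b + 1), ∑ p ∈ Finset.Ico (b + 1) N, P a b p := by
    have : ∀ b ∈ Finset.range N, ∑ a ∈ Finset.range (b + 1), ∑ c ∈ Finset.Ico a b, P a c b =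
        ∑ c ∈ Finset.range b, ∑ a ∈ Finset.range (c + 1), P a c b := fun b _ =>
      Finset.sum_comm' fun x y => by simp only [Finset.mem_Ico, Finset.mem_range]; omega
    rw [Finset.sum_congr rfl this]
    have : ∀ b ∈ Finset.range N, ∑ a ∈ Finset.range (b + 1), ∑ p ∈ Finset.Ico (b + 1) N, P a b p =
        ∑ p ∈ Finset.Ico (b + 1) N, ∑ a ∈ Finset.range (b + 1), P a b p := fun b _ =>
      Finset.sum_comm
    rw [Finset.sum_congr rfl this]
    exact Finset.sum_comm' fun x y => by simp only [Finset.mem_Ico, Finset.mem_range]; omega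
  -- Products with the first letter cancel the cuts of the last letter after the closing edge.
  have c2 : ∑ b ∈ Finset.range N, ∑ a ∈ Finset.range (b + 1), ∑ c ∈ Finset.Ico (a + 1) (b + 1),
      P c b (N + a) =
      ∑ b ∈ Finset.range N, ∑ a ∈ Finset.range (b + 1), ∑ p ∈ Finset.range a, P a b (N + p) :=
    Finset.sum_congr rfl fun b _ => Finset.sum_comm' fun x y => by
      simp only [Finset.mem_Ico, Finset.mem_range]; omega
  rw [c1, c2]
  abel

end CyclicChain

/-! ### Closed paths around a polygon in a linear space -/

section CyclePaths

variable {E : Type*} [AddCommGroup E] [Module ℝ E] [TopologicalSpace E]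
  [IsTopologicalAddGroup E] [ContinuousSMul ℝ E]

/-- The sum of three translates of the truncation by multiples of `ℓ`. On `[-ℓ, 2 * ℓ]` it agrees
up to a constant with the sum of all translates. -/
def clampSum (ℓ x : ℝ) : ℝ := clamp (x + ℓ) + clamp x + clamp (x - ℓ)

/-- A shift by ℓ moves each translate to the next one. In this range the new first term is already 1
and the term that is lost was still 0; ℓ ≥ 1 is needed for the former. -/
theorem clampSum_add {ℓ x : ℝ} (hℓ : 1 ≤ ℓ) (h : -ℓ ≤ x) (h' : x ≤ ℓ) :
    clampSum ℓ (x + ℓ) = clampSum ℓ x + 1 := by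
  rw [clampSum, clampSum, add_sub_cancel_right, clamp_of_one_le (x := x + ℓ + ℓ) (by linarith),
    clamp_of_nonpos (x := x - ℓ) (by linarith)]
  ring

/-- The closed path of period `s 0 + ⋯ + s (N - 1)` through `v 0, …, v (N - 1)` in which the motion
from `v i` to `v (i + 1)` takes place in the unit of time after `s 0 + ⋯ + s i`. -/
def cyclePath (v : ℕ → E) (N : ℕ) (s : ℕ → 𝕀) (τ : ℝ) : E :=
  v 0 + ∑ i ∈ Finset.range N,
    clampSum (startTime s N) (τ - startTime s (i + 1)) • (cyc v N (i + 1) - v i)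

theorem sum_cyc_sub {E : Type*} [AddCommGroup E] (v : ℕ → E) (N : ℕ) : ∑ i ∈ Finset.range N, (cyc v N (i + 1) - v i) = 0 := by
  cases N with
  | zero => simp
  | succ N =>
    have h : ∀ i ∈ Finset.range N, cyc v (N + 1) (i + 1) - v i = v (i + 1) - v i := fun i hi => by
      rw [Finset.mem_range] at hi
      rw [cyc_of_lt _ (by omega)]
    rw [Finset.sum_range_succ, Finset.sum_congr rfl h, Finset.sum_range_sub, cyc_of_le _ le_rfl,
      Nat.sub_self]
    abel

/-- After one period every motion has been carried out once more, and the displacements of a closed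
polygon add up to zero. -/
theorem cyclePath_periodic (v : ℕ → E) {N : ℕ} {s : ℕ → 𝕀} (hs : 1 ≤ startTime s N) {τ : ℝ}
    (h0 : 0 ≤ τ) (h1 : τ ≤ startTime s N) :
    cyclePath v N s (τ + startTime s N) = cyclePath v N s τ := by
  have h : ∀ i ∈ Finset.range N,
      clampSum (startTime s N) (τ + startTime s N - startTime s (i + 1)) • (cyc v N (i + 1) - v i) =
      clampSum (startTime s N) (τ - startTime s (i + 1)) • (cyc v N (i + 1) - v i) +
        (cyc v N (i + 1) - v i) := by
    intro i hi
    rw [Finset.mem_range] at hi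
    have h2 := startTime_mono s (show i + 1 ≤ N by omega)
    have h3 := startTime_nonneg s (i + 1)
    rw [add_sub_right_comm, clampSum_add hs (by linarith) (by linarith), add_smul, one_smul]
  rw [cyclePath, Finset.sum_congr rfl h, Finset.sum_add_distrib, sum_cyc_sub, add_zero, cyclePath]

theorem cyclePath_congr {v v' : ℕ → E} {s s' : ℕ → 𝕀} {N : ℕ} (hv : ∀ i ≤ N - 1, v i = v' i)
    (hs : ∀ i < N, s i = s' i) (τ : ℝ) : cyclePath v N s τ = cyclePath v' N s' τ := by
  rw [cyclePath, cyclePath, hv 0 (Nat.zero_le _), startTime_congr hs]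
  congr 1
  refine Finset.sum_congr rfl fun i hi => ?_
  rw [Finset.mem_range] at hi
  rw [startTime_congr (i := i + 1) fun j hj => hs j (by omega), hv i (by omega)]
  congr 2
  unfold cyc
  split_ifs <;> exact hv _ (by omega)

theorem continuous_cyclePath {T : Type*} [TopologicalSpace T] (v : ℕ → E) (N : ℕ) {s : T → ℕ → 𝕀}
    {τ : T → ℝ} (hs : Continuous s) (hτ : Continuous τ) :
    Continuous fun x => cyclePath v N (s x) (τ x) := by
  have h : ∀ i, Continuous fun x => startTime (s x) i := fun i => (continuous_startTime i).comp hs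
  have hc : ∀ {g : T → ℝ}, Continuous g → Continuous fun x => clamp (g x) := fun hg =>
    continuous_clamp.comp hg
  refine continuous_const.add (continuous_finsetSum _ fun i _ => Continuous.smul ?_ continuous_const)
  unfold clampSum
  exact ((hc ((hτ.sub (h _)).add (h _))).add (hc (hτ.sub (h _)))).add
    (hc ((hτ.sub (h _)).sub (h _)))

theorem startTime_ins (k : ℕ) (ε : 𝕀) (s : ℕ → 𝕀) {i : ℕ} (h : k ≤ i) :
    startTime (ins k ε s) (i + 1) = startTime s i + ε := by
  obtain ⟨r, rfl⟩ := Nat.exists_eq_add_of_le h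
  rw [add_right_comm, startTime_ins_add]

/-- With s p = 0 the motions into and out of v p are simultaneous and combine to one that avoids v
p. The bounds on τ keep all times where three translates suffice. -/
theorem cyclePath_ins_zero (v : ℕ → E) {N p : ℕ} {s : ℕ → 𝕀} (hp : p < N + 1)
    (hs : 1 ≤ startTime s N) {τ : ℝ} (h0 : 0 ≤ τ) (h1 : τ ≤ 2 * startTime s N) :
    cyclePath v (N + 1) (ins p 0 s) τ = cyclePath (v ∘ skip p) N s τ := by
  have hN : 0 < N := by
    by_contra h
    obtain rfl : N = 0 := by omega
    simp only [startTime, Finset.range_zero, Finset.sum_empty] at hs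
    linarith
  rw [cyclePath, cyclePath, startTime_ins _ _ _ (show p ≤ N by omega), Set.Icc.coe_zero, add_zero]
  set ℓ := startTime s N with hℓ
  rcases p with _ | k
  · rw [Finset.sum_range_succ', startTime_ins _ _ _ le_rfl, cyc_of_lt _ (by omega)]
    obtain ⟨M, rfl⟩ : ∃ M, N = M + 1 := ⟨N - 1, by omega⟩
    rw [Finset.sum_range_succ, Finset.sum_range_succ, cyc_of_le v le_rfl,
      cyc_of_le (v ∘ skip 0) le_rfl, startTime_ins _ _ _ (Nat.zero_le _), Set.Icc.coe_zero,
      add_zero, ← hℓ, Nat.sub_self, Nat.sub_self]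
    have h2 : ∀ i ∈ Finset.range M, clampSum ℓ (τ - startTime (ins 0 0 s) (i + 1 + 1)) •
        (cyc v (M + 1 + 1) (i + 1 + 1) - v (i + 1)) = clampSum ℓ (τ - startTime s (i + 1)) •
        (cyc (v ∘ skip 0) (M + 1) (i + 1) - (v ∘ skip 0) i) := by
      intro i hi
      rw [Finset.mem_range] at hi
      rw [startTime_ins _ _ _ (Nat.zero_le _), Set.Icc.coe_zero, add_zero, cyc_of_lt _ (by omega),
        cyc_of_lt _ (by omega)]
      rfl
    -- For p = 0 the reference point v 0 changes to v 1. The motion from v 0 to v 1 starts at time 0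
    -- and the one into v 0 at time ℓ; matching them by a shift of one period produces the missing v
    -- 1 - v 0.
    have h3 := clampSum_add (ℓ := ℓ) (x := τ - ℓ) hs (by linarith) (by linarith)
    rw [sub_add_cancel] at h3
    rw [Finset.sum_congr rfl h2, show startTime s 0 = 0 from Finset.sum_range_zero _, add_zero,
      sub_zero, h3]
    simp only [Function.comp, skip_of_le (Nat.zero_le _)]
    module
  · obtain ⟨r, rfl⟩ : ∃ r, N = k + 1 + r := ⟨N - (k + 1), by omega⟩
    rw [show k + 1 + r + 1 = k + 1 + 1 + r by omega, Finset.sum_range_add,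
      Finset.sum_range_succ, Finset.sum_range_succ, Finset.sum_range_add, Finset.sum_range_succ]
    have e0 : startTime (ins (k + 1) 0 s) (k + 1 + 1) = startTime s (k + 1) := by
      rw [startTime_ins _ _ _ le_rfl, Set.Icc.coe_zero, add_zero]
    have e1 : cyc (v ∘ skip (k + 1)) (k + 1 + r) (k + 1) = cyc v (k + 1 + 1 + r) (k + 1 + 1) := by
      simp only [cyc, Function.comp, skip]
      split_ifs <;> first | rfl | omega | (congr 1; omega)
    have e2 : ∀ i ≤ k, (v ∘ skip (k + 1)) i = v i := fun i hi => by
      simp [skip, Nat.lt_succ_of_le hi]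
    rw [e0, startTime_ins_le _ _ le_rfl, e1, e2 _ le_rfl, e2 _ (Nat.zero_le _),
      cyc_of_lt v (show k + 1 < k + 1 + 1 + r by omega)]
    have h1 : ∑ i ∈ Finset.range k, clampSum ℓ (τ - startTime (ins (k + 1) 0 s) (i + 1)) •
        (cyc v (k + 1 + 1 + r) (i + 1) - v i) =
        ∑ i ∈ Finset.range k, clampSum ℓ (τ - startTime s (i + 1)) •
          (cyc (v ∘ skip (k + 1)) (k + 1 + r) (i + 1) - (v ∘ skip (k + 1)) i) := by
      refine Finset.sum_congr rfl fun i hi => ?_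
      rw [Finset.mem_range] at hi
      rw [startTime_ins_le _ _ (by omega), e2 _ hi.le, cyc_of_lt _ (by omega),
        cyc_of_lt _ (by omega), e2 _ hi]
    have h2 : ∑ i ∈ Finset.range r, clampSum ℓ
        (τ - startTime (ins (k + 1) 0 s) (k + 1 + 1 + i + 1)) •
        (cyc v (k + 1 + 1 + r) (k + 1 + 1 + i + 1) - v (k + 1 + 1 + i)) =
        ∑ i ∈ Finset.range r, clampSum ℓ (τ - startTime s (k + 1 + i + 1)) •
          (cyc (v ∘ skip (k + 1)) (k + 1 + r) (k + 1 + i + 1) -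
            (v ∘ skip (k + 1)) (k + 1 + i)) := by
      refine Finset.sum_congr rfl fun i hi => ?_
      rw [Finset.mem_range] at hi
      have e3 : cyc (v ∘ skip (k + 1)) (k + 1 + r) (k + 1 + i + 1) =
          cyc v (k + 1 + 1 + r) (k + 1 + 1 + i + 1) := by
        simp only [cyc, Function.comp, skip]
        split_ifs <;> first | rfl | omega | (congr 1; omega)
      rw [e3, startTime_ins _ _ _ (by omega), Set.Icc.coe_zero, add_zero]
      simp only [Function.comp, skip_of_le (show k + 1 ≤ k + 1 + i by omega)]
      rw [show k + 1 + 1 + i = k + 1 + i + 1 by omega]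
    rw [h1, h2]
    module

theorem startTime_cyc (s : ℕ → 𝕀) {N i : ℕ} (h : i ≤ N) : startTime (cyc s N) i = startTime s i :=
  startTime_congr fun _ hj => cyc_of_lt _ (by omega)

theorem startTime_cyc_add (s : ℕ → 𝕀) (N i : ℕ) :
    startTime (cyc s N) (N + i) = startTime s N + startTime s i := by
  rw [startTime_add, startTime_cyc s le_rfl]
  simp only [cyc_add]

/-- The closed path `cyclePath`, when it is started at the vertex `a`. -/
theorem cyclePath_add_startTime (v : ℕ → E) {N a : ℕ} {s : ℕ → 𝕀} (ha : a < N) (hs : s a = 1)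
    {τ : ℝ} (h0 : 0 ≤ τ) (h1 : τ ≤ startTime s N) :
    cyclePath v N s (τ + startTime s (a + 1)) =
      pathAt (fun i => cyc v N (a + i)) (fun i => cyc s N (a + 1 + i)) N τ := by
  have hS : startTime s a + 1 = startTime s (a + 1) := by rw [startTime_succ, hs, Set.Icc.coe_one]
  have hSa := startTime_nonneg s a
  have hℓ := startTime_mono s (show a + 1 ≤ N by omega)
  have hst : ∀ i, startTime (fun i => cyc s N (a + 1 + i)) i =
      startTime (cyc s N) (a + 1 + i) - startTime s (a + 1) := fun i => by
    rw [startTime_add, startTime_cyc s (by omega), add_sub_cancel_left]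
  obtain ⟨r, rfl⟩ : ∃ r, N = a + r := ⟨N - a, by omega⟩
  -- The displacements from the vertex a onwards cancel those before it.
  have hz := sum_cyc_sub v (a + r)
  rw [Finset.sum_range_add] at hz
  have hv : ∀ j ∈ Finset.range a, cyc v (a + r) (j + 1) - v j = v (j + 1) - v j := fun j hj => by
    rw [Finset.mem_range] at hj
    rw [cyc_of_lt _ (by omega)]
  rw [Finset.sum_congr rfl hv, Finset.sum_range_sub] at hz
  -- After the start at vertex a, a motion with j < a is complete in two of the three translates,
  -- whence the coefficient 2. The third translate is its next occurrence.
  have e1 : ∀ j ∈ Finset.range a, clampSum (startTime s (a + r))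
      (τ + startTime s (a + 1) - startTime s (j + 1)) • (cyc v (a + r) (j + 1) - v j) =
      clamp (τ - (startTime s (a + r) + startTime s (j + 1) - startTime s (a + 1))) •
        (v (j + 1) - v j) + (2 : ℝ) • (v (j + 1) - v j) := by
    intro j hj
    rw [hv j hj]
    rw [Finset.mem_range] at hj
    have h2 := startTime_mono s (show j + 1 ≤ a by omega)
    rw [clampSum, clamp_of_one_le (x := _ + startTime s (a + r)) (by linarith),
      clamp_of_one_le (x := τ + startTime s (a + 1) - startTime s (j + 1)) (by linarith),
      show τ + startTime s (a + 1) - startTime s (j + 1) - startTime s (a + r) =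
        τ - (startTime s (a + r) + startTime s (j + 1) - startTime s (a + 1)) by ring]
    module
  have e2 : ∀ i ∈ Finset.range r, clampSum (startTime s (a + r))
      (τ + startTime s (a + 1) - startTime s (a + i + 1)) •
        (cyc v (a + r) (a + i + 1) - v (a + i)) =
      clamp (τ - (startTime s (a + 1 + i) - startTime s (a + 1))) •
        (cyc v (a + r) (a + (i + 1)) - cyc v (a + r) (a + i)) +
        (cyc v (a + r) (a + i + 1) - v (a + i)) := by
    intro i hi
    rw [Finset.mem_range] at hi
    have h2 := startTime_mono s (show a + 1 ≤ a + i + 1 by omega)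
    have h3 := startTime_mono s (show a + i + 1 ≤ a + r by omega)
    rw [clampSum, clamp_of_one_le (x := _ + startTime s (a + r)) (by linarith),
      clamp_of_nonpos (x := _ - startTime s (a + r)) (by linarith), cyc_of_lt v (i := a + i)
        (by omega), add_right_comm a i 1, ← add_assoc a i 1, add_right_comm a i 1, sub_sub_eq_add_sub]
    module
  have e3 : ∀ i ∈ Finset.range r, clamp (τ - startTime (fun i => cyc s (a + r) (a + 1 + i)) i) •
        (cyc v (a + r) (a + (i + 1)) - cyc v (a + r) (a + i)) =
      clamp (τ - (startTime s (a + 1 + i) - startTime s (a + 1))) •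
        (cyc v (a + r) (a + (i + 1)) - cyc v (a + r) (a + i)) := by
    intro i hi
    rw [Finset.mem_range] at hi
    rw [hst, startTime_cyc s (by omega)]
  have e4 : ∀ j ∈ Finset.range a, clamp (τ - startTime (fun i => cyc s (a + r) (a + 1 + i)) (r + j)) •
        (cyc v (a + r) (a + (r + j + 1)) - cyc v (a + r) (a + (r + j))) =
      clamp (τ - (startTime s (a + r) + startTime s (j + 1) - startTime s (a + 1))) •
        (v (j + 1) - v j) := by
    intro j hj
    rw [hst, show a + 1 + (r + j) = a + r + (j + 1) by omega, startTime_cyc_add,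
      show a + (r + j + 1) = a + r + (j + 1) by omega, ← add_assoc a r j, cyc_add, cyc_add]
  rw [cyclePath, pathAt, Finset.sum_range_add, Finset.sum_congr rfl e1, Finset.sum_congr rfl e2,
    Finset.sum_add_distrib, Finset.sum_add_distrib, ← Finset.smul_sum, Finset.sum_range_sub,
    add_comm a r, Finset.sum_range_add, add_comm r a, Finset.sum_congr rfl e3,
    Finset.sum_congr rfl e4, add_zero, cyc_of_lt _ (show a < a + r by omega)]
  rw [eq_neg_of_add_eq_zero_right hz]
  module

end CyclePaths

/-! ### Reindexing of sums over faces -/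

section Sums

variable {M : Type*} [AddCommGroup M]

/-- The coordinates of a cube with one coordinate per vertex p ≠ a: the vertices after a are
numbered p - 1. -/
theorem sum_split_one (f : ℕ → M) {a N : ℕ} (ha : a < N) : ∑ k ∈ Finset.range (N - 1), f k =
    ∑ p ∈ Finset.range a, f p + ∑ p ∈ Finset.Ico (a + 1) N, f (p - 1) := by
  have h := Finset.sum_Ico_add' (fun p => f (p - 1)) a (N - 1) 1
  simp only [Nat.add_sub_cancel] at h
  rw [Nat.sub_add_cancel (by omega)] at h
  rw [← h, Finset.range_eq_Ico, Finset.range_eq_Ico,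
    Finset.sum_Ico_consecutive _ (Nat.zero_le _) (by omega)]

theorem sum_split_two (f : ℕ → M) {a b N : ℕ} (hab : a < b) (hb : b < N) :
    ∑ k ∈ Finset.range (N - 2), f k = ∑ p ∈ Finset.range a, f p +
      ∑ p ∈ Finset.Ico (a + 1) b, f (p - 1) + ∑ p ∈ Finset.Ico (b + 1) N, f (p - 2) := by
  rw [show N - 2 = N - 1 - 1 by omega, sum_split_one f (show b - 1 < N - 1 by omega),
    sum_split_one f hab]
  have h := Finset.sum_Ico_add' (fun p => f (p - 2)) b (N - 1) 1
  rw [Nat.sub_add_cancel (show 1 ≤ N by omega)] at h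
  rw [← h, Nat.sub_add_cancel (by omega)]
  rfl

theorem sum_vertex_faces (g : ℕ → ℕ → M) (N : ℕ) :
    ∑ a ∈ Finset.range N, (∑ p ∈ Finset.range a, g p (a - 1) + ∑ p ∈ Finset.Ico (a + 1) N, g p a) =
      ∑ p ∈ Finset.range N, ∑ a ∈ Finset.range (N - 1), g p a := by
  have h1 : ∑ a ∈ Finset.range N, ∑ p ∈ Finset.range a, g p (a - 1) =
      ∑ p ∈ Finset.range N, ∑ a ∈ Finset.Ico (p + 1) N, g p (a - 1) :=
    Finset.sum_comm' fun x y => by simp only [Finset.mem_Ico, Finset.mem_range]; omega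
  have h2 : ∑ a ∈ Finset.range N, ∑ p ∈ Finset.Ico (a + 1) N, g p a =
      ∑ p ∈ Finset.range N, ∑ a ∈ Finset.range p, g p a :=
    Finset.sum_comm' fun x y => by simp only [Finset.mem_Ico, Finset.mem_range]; omega
  rw [Finset.sum_add_distrib, h1, h2, add_comm, ← Finset.sum_add_distrib]
  refine Finset.sum_congr rfl fun p hp => ?_
  rw [Finset.mem_range] at hp
  rw [sum_split_one _ hp]

/-- This is `sum_cyclic_faces` for g extended by zero to the diagonal a = b. -/
theorem sum_arc_faces (g : ℕ → ℕ → ℕ → M) (N : ℕ) :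
    ∑ b ∈ Finset.range N, ∑ a ∈ Finset.range b, (∑ p ∈ Finset.range a, g p (a - 1) (b - 1) +
      ∑ p ∈ Finset.Ico (a + 1) b, g p a (b - 1) + ∑ p ∈ Finset.Ico (b + 1) N, g p a b) =
      ∑ p ∈ Finset.range N, ∑ b ∈ Finset.range (N - 1), ∑ a ∈ Finset.range b, g p a b := by
  have key := sum_cyclic_faces (fun p a b => if a < b then g p a b else 0) N
  have h1 : ∀ p ∈ Finset.range N, ∀ b ∈ Finset.range (N - 1), ∑ a ∈ Finset.range (b + 1),
      (if a < b then g p a b else 0) = ∑ a ∈ Finset.range b, g p a b := by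
    intro p _ b _
    rw [Finset.sum_range_succ, if_neg (lt_irrefl _), add_zero]
    exact Finset.sum_congr rfl fun a ha => if_pos (Finset.mem_range.1 ha)
  rw [Finset.sum_congr rfl fun p hp => Finset.sum_congr rfl (h1 p hp)] at key
  rw [← key]
  refine Finset.sum_congr rfl fun b _ => ?_
  rw [Finset.sum_range_succ, Finset.Ico_eq_empty (show ¬ b + 1 < b by omega), Finset.sum_empty,
    zero_add,
    Finset.sum_eq_zero (s := Finset.Ico (b + 1) N) (fun p _ => if_neg (lt_irrefl _)),
    Finset.sum_eq_zero (s := Finset.range b) (fun p _ => if_neg (lt_irrefl _)), add_zero, add_zero]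
  refine Finset.sum_congr rfl fun a ha => ?_
  rw [Finset.mem_range] at ha
  have e1 : ∀ p ∈ Finset.range a, (if a - 1 < b - 1 then g p (a - 1) (b - 1) else 0) =
      g p (a - 1) (b - 1) := fun p hp => if_pos (by rw [Finset.mem_range] at hp; omega)
  have e2 : ∀ p ∈ Finset.Ico (a + 1) b, (if a < b - 1 then g p a (b - 1) else 0) =
      g p a (b - 1) := fun p hp => if_pos (by rw [Finset.mem_Ico] at hp; omega)
  have e3 : ∀ p ∈ Finset.Ico (b + 1) N, (if a < b then g p a b else 0) = g p a b := fun p _ =>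
    if_pos ha
  rw [Finset.sum_congr rfl e1, Finset.sum_congr rfl e2, Finset.sum_congr rfl e3]
  abel

theorem sum_pairs (g : ℕ → ℕ → M) (N : ℕ) :
    ∑ a ∈ Finset.range N, ∑ p ∈ Finset.Ico (a + 1) N, g a p =
      ∑ b ∈ Finset.range N, ∑ a ∈ Finset.range b, g a b :=
  Finset.sum_comm' fun x y => by simp only [Finset.mem_Ico, Finset.mem_range]; omega

theorem sum_triples_middle (g : ℕ → ℕ → ℕ → M) (N : ℕ) :
    ∑ b ∈ Finset.range N, ∑ a ∈ Finset.range b, ∑ p ∈ Finset.Ico (a + 1) b, g a p b =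
      ∑ z ∈ Finset.range N, ∑ y ∈ Finset.range z, ∑ x ∈ Finset.range y, g x y z :=
  Finset.sum_congr rfl fun b _ =>
    Finset.sum_comm' fun x y => by simp only [Finset.mem_Ico, Finset.mem_range]; omega

theorem sum_triples_last (g : ℕ → ℕ → ℕ → M) (N : ℕ) :
    ∑ b ∈ Finset.range N, ∑ a ∈ Finset.range b, ∑ p ∈ Finset.Ico (b + 1) N, g a b p =
      ∑ z ∈ Finset.range N, ∑ y ∈ Finset.range z, ∑ x ∈ Finset.range y, g x y z := by
  rw [← sum_pairs (fun y z => ∑ x ∈ Finset.range y, g x y z)]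
  exact Finset.sum_congr rfl fun b _ => Finset.sum_comm

end Sums

/-! ### Cubes of closed paths started at a vertex or on an arc -/

section LiftedLoops

variable {E : Type v} [AddCommGroup E] [Module ℝ E] [TopologicalSpace E]
  [IsTopologicalAddGroup E] [ContinuousSMul ℝ E]

theorem ins_ins {k a : ℕ} (h : k < a) (x y : 𝕀) (t : ℕ → 𝕀) :
    ins a x (ins k y t) = ins k y (ins (a - 1) x t) := by
  ext i
  simp only [ins]
  split_ifs <;> first | rfl | omega

theorem ins_congr {s t : ℕ → 𝕀} (k : ℕ) (x : 𝕀) {n : ℕ} (h : ∀ i < n, s i = t i) :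
    ∀ i < n + 1, k ≤ n → ins k x s i = ins k x t i := by
  intro i hi hk
  simp only [ins]
  split_ifs
  · exact h _ (by omega)
  · rfl
  · exact h _ (by omega)

theorem continuous_ins (k : ℕ) (x : 𝕀) : Continuous (ins k x) := by
  refine continuous_pi fun i => ?_
  unfold ins
  split_ifs
  · exact continuous_apply _
  · exact continuous_const
  · exact continuous_apply _

theorem ins_of_lt' {k i : ℕ} (x : 𝕀) (t : ℕ → 𝕀) (h : k < i) : ins k x t i = t (i - 1) := by
  rw [ins, if_neg (by omega), if_neg (by omega)]

variable (E) in
/-- Pairs of a path in `E` and a length. -/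
abbrev LiftedLoop : Type v := C(𝕀, E) × ℝ

/-- The closed path `cyclePath`, started at the time `θ`. -/
def cycleLoop (v : ℕ → E) (N : ℕ) : C((ℕ → 𝕀) × ℝ, LiftedLoop E) where
  toFun x := (⟨fun w => cyclePath v N x.1 (w * startTime x.1 N + x.2),
    continuous_cyclePath v N continuous_const
      ((continuous_subtype_val.mul continuous_const).add continuous_const)⟩, startTime x.1 N)
  continuous_toFun := by
    refine Continuous.prodMk (ContinuousMap.curry ⟨fun y : ((ℕ → 𝕀) × ℝ) × 𝕀 =>
      cyclePath v N y.1.1 (y.2 * startTime y.1.1 N + y.1.2), ?_⟩).continuous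
      ((continuous_startTime N).comp continuous_fst)
    have h1 : Continuous fun y : ((ℕ → 𝕀) × ℝ) × 𝕀 => y.1.1 := continuous_fst.comp continuous_fst
    exact continuous_cyclePath v N h1 (((continuous_subtype_val.comp continuous_snd).mul
      ((continuous_startTime N).comp h1)).add (continuous_snd.comp continuous_fst))

theorem cycleLoop_congr {v v' : ℕ → E} {s s' : ℕ → 𝕀} {N : ℕ} {θ θ' : ℝ}
    (hv : ∀ i ≤ N - 1, v i = v' i) (hs : ∀ i < N, s i = s' i) (hθ : θ = θ') :
    cycleLoop v N (s, θ) = cycleLoop v' N (s', θ') := by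
  subst hθ
  refine Prod.ext (ContinuousMap.ext fun w => ?_) (startTime_congr hs)
  change cyclePath _ _ _ (w * startTime s N + _) = cyclePath _ _ _ (w * startTime s' N + _)
  rw [startTime_congr hs, cyclePath_congr hv hs]

/-- A loop started at θ runs through times up to θ plus the period. The bound on θ keeps them within
two periods, as `cyclePath_ins_zero` requires. -/
theorem cycleLoop_ins_zero (v : ℕ → E) {N p : ℕ} {s : ℕ → 𝕀} (hp : p < N)
    (hs : 1 ≤ startTime s (N - 1)) {θ : ℝ} (h0 : 0 ≤ θ) (h1 : θ ≤ startTime s (N - 1)) :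
    cycleLoop v N (ins p 0 s, θ) = cycleLoop (v ∘ skip p) (N - 1) (s, θ) := by
  obtain ⟨M, rfl⟩ : ∃ M, N = M + 1 := ⟨N - 1, by omega⟩
  rw [Nat.add_sub_cancel] at *
  have h : startTime (ins p 0 s) (M + 1) = startTime s M := by
    rw [startTime_ins _ _ _ (by omega), Set.Icc.coe_zero, add_zero]
  refine Prod.ext (ContinuousMap.ext fun w => ?_) h
  change cyclePath _ _ _ (w * startTime (ins p 0 s) (M + 1) + _) =
    cyclePath _ _ _ (w * startTime s M + _)
  have h2 := mul_nonneg w.2.1 (startTime_nonneg s M)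
  have h3 := mul_le_of_le_one_left (startTime_nonneg s M) w.2.2
  rw [h, cyclePath_ins_zero v (by omega) hs (by linarith) (by linarith)]

/-- The time at the fraction `w` of the interval between the vertices `a` and `b`. -/
def arcTime (s : ℕ → 𝕀) (a b : ℕ) (w : ℝ) : ℝ :=
  startTime s (a + 1) + w * (startTime s (b + 1) - startTime s (a + 1))

theorem arcTime_congr {s s' : ℕ → 𝕀} {a b N : ℕ} (ha : a < N) (hb : b < N)
    (h : ∀ i < N, s i = s' i) (w : ℝ) : arcTime s a b w = arcTime s' a b w := by
  rw [arcTime, arcTime, startTime_congr (i := a + 1) fun j hj => h j (by omega),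
    startTime_congr (i := b + 1) fun j hj => h j (by omega)]

theorem arcTime_mem (s : ℕ → 𝕀) {a b N : ℕ} (hab : a ≤ b) (hb : b < N) (w : 𝕀) :
    0 ≤ arcTime s a b w ∧ arcTime s a b w ≤ startTime s N := by
  have h1 := startTime_nonneg s (a + 1)
  have h2 := startTime_mono s (show a + 1 ≤ b + 1 by omega)
  have h3 := startTime_mono s (show b + 1 ≤ N by omega)
  have h4 := mul_nonneg w.2.1 (sub_nonneg.2 h2)
  have h5 := mul_le_of_le_one_left (sub_nonneg.2 h2) w.2.2
  constructor <;> rw [arcTime] <;> linarith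

theorem continuous_arcTime {T : Type*} [TopologicalSpace T] (a b : ℕ) {s : T → ℕ → 𝕀} {w : T → 𝕀}
    (hs : Continuous s) (hw : Continuous w) : Continuous fun x => arcTime (s x) a b (w x) := by
  have h : ∀ i, Continuous fun x => startTime (s x) i := fun i => (continuous_startTime i).comp hs
  exact (h _).add ((continuous_subtype_val.comp hw).mul ((h _).sub (h _)))

theorem arcTime_ins_lt (k : ℕ) (s : ℕ → 𝕀) {a b : ℕ} (ha : k < a) (hb : k < b) (w : ℝ) :
    arcTime (ins k 0 s) a b w = arcTime s (a - 1) (b - 1) w := by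
  rw [arcTime, arcTime, startTime_ins _ _ _ ha.le, startTime_ins _ _ _ hb.le, Set.Icc.coe_zero,
    add_zero, add_zero, Nat.sub_add_cancel (by omega), Nat.sub_add_cancel (by omega)]

theorem arcTime_ins_between (k : ℕ) (s : ℕ → 𝕀) {a b : ℕ} (ha : a < k) (hb : k < b) (w : ℝ) :
    arcTime (ins k 0 s) a b w = arcTime s a (b - 1) w := by
  rw [arcTime, arcTime, startTime_ins_le _ _ ha, startTime_ins _ _ _ hb.le, Set.Icc.coe_zero,
    add_zero, Nat.sub_add_cancel (by omega)]

theorem arcTime_ins_gt (k : ℕ) (s : ℕ → 𝕀) {a b : ℕ} (ha : a < k) (hb : b < k) (w : ℝ) :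
    arcTime (ins k 0 s) a b w = arcTime s a b w := by
  rw [arcTime, arcTime, startTime_ins_le _ _ ha, startTime_ins_le _ _ hb]

/-- A unit coordinate makes the period at least one, the hypothesis of the formulas for `cyclePath`.
-/
theorem one_le_startTime {s : ℕ → 𝕀} {a N : ℕ} (ha : a < N) (h : s a = 1) : 1 ≤ startTime s N := by
  have h1 := startTime_mono s (show a + 1 ≤ N by omega)
  have h2 := startTime_nonneg s a
  rw [startTime_succ, h, Set.Icc.coe_one] at h1
  linarith

/-- The cube of all `cycleLoop`s which start at the vertex `a`. -/
def vertexCube (N : ℕ) (v : ℕ → E) (a : ℕ) : Cube (LiftedLoop E) :=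
  cubeOf (N - 1) ((cycleLoop v N).comp
    ⟨fun t => (ins a 1 t, startTime (ins a 1 t) (a + 1)), (continuous_ins a 1).prodMk
      ((continuous_startTime _).comp (continuous_ins a 1))⟩)

/-- The cube of all `cycleLoop`s which start between the vertices `a` and `b`. -/
def arcCube (N : ℕ) (v : ℕ → E) (a b : ℕ) : Cube (LiftedLoop E) :=
  cubeOf (N - 1) ((cycleLoop v N).comp
    ⟨fun t => (ins b 1 (ins a 1 t), arcTime (ins b 1 (ins a 1 t)) a b (t (N - 2))),
      ((continuous_ins b 1).comp (continuous_ins a 1)).prodMk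
      (continuous_arcTime a b ((continuous_ins b 1).comp (continuous_ins a 1))
        (continuous_apply _))⟩)

/-- The common faces of the cubes `vertexCube` and `arcCube`. -/
def pairCube (N : ℕ) (v : ℕ → E) (x y c : ℕ) : Cube (LiftedLoop E) :=
  cubeOf (N - 2) ((cycleLoop v N).comp
    ⟨fun t => (ins y 1 (ins x 1 t), startTime (ins y 1 (ins x 1 t)) (c + 1)),
      ((continuous_ins y 1).comp (continuous_ins x 1)).prodMk
      ((continuous_startTime _).comp ((continuous_ins y 1).comp (continuous_ins x 1)))⟩)

/-- The faces of the cube `arcCube` at a third vertex. -/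
def tripleCube (N : ℕ) (v : ℕ → E) (x y z c d : ℕ) : Cube (LiftedLoop E) :=
  cubeOf (N - 2) ((cycleLoop v N).comp
    ⟨fun t => (ins z 1 (ins y 1 (ins x 1 t)),
      arcTime (ins z 1 (ins y 1 (ins x 1 t))) c d (t (N - 3))),
      ((continuous_ins z 1).comp ((continuous_ins y 1).comp (continuous_ins x 1))).prodMk
      (continuous_arcTime c d
        ((continuous_ins z 1).comp ((continuous_ins y 1).comp (continuous_ins x 1)))
        (continuous_apply _))⟩)

variable (v : ℕ → E) {N : ℕ}

theorem ev_vertexCube {a : ℕ} (ha : a < N) (t : ℕ → 𝕀) : ev (vertexCube N v a) t =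
    cycleLoop v N (ins a 1 t, startTime (ins a 1 t) (a + 1)) := by
  refine ev_cubeOf _ _ (fun s t h => ?_) t
  have h' : ∀ i < N, ins a 1 s i = ins a 1 t i := fun i hi => ins_congr a 1 h i (by omega) (by omega)
  exact cycleLoop_congr (fun _ _ => rfl) h' (startTime_congr fun j hj => h' j (by omega))

theorem ev_arcCube {a b : ℕ} (hab : a < b) (hb : b < N) (t : ℕ → 𝕀) : ev (arcCube N v a b) t =
    cycleLoop v N (ins b 1 (ins a 1 t), arcTime (ins b 1 (ins a 1 t)) a b (t (N - 2))) := by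
  refine ev_cubeOf _ _ (fun s t h => ?_) t
  have h' : ∀ i < N, ins b 1 (ins a 1 s) i = ins b 1 (ins a 1 t) i := fun i hi =>
    ins_congr b 1 (fun i hi => ins_congr (n := N - 2) a 1 (fun i hi => h i (by omega)) i
      (by omega) (by omega)) i (show i < N - 1 + 1 by omega) (by omega)
  refine cycleLoop_congr (fun _ _ => rfl) h' ?_
  rw [h (N - 2) (by omega), arcTime_congr (by omega) hb h']

theorem ev_pairCube {x y c : ℕ} (hxy : x < y) (hy : y < N) (hc : c < N) (t : ℕ → 𝕀) :
    ev (pairCube N v x y c) t =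
      cycleLoop v N (ins y 1 (ins x 1 t), startTime (ins y 1 (ins x 1 t)) (c + 1)) := by
  refine ev_cubeOf _ _ (fun s t h => ?_) t
  have h' : ∀ i < N, ins y 1 (ins x 1 s) i = ins y 1 (ins x 1 t) i := fun i hi =>
    ins_congr y 1 (fun i hi => ins_congr (n := N - 2) x 1 h i
      (by omega) (by omega)) i (show i < N - 1 + 1 by omega) (by omega)
  exact cycleLoop_congr (fun _ _ => rfl) h' (startTime_congr fun j hj => h' j (by omega))

theorem triple_congr {x y z : ℕ} (hxy : x < y) (hyz : y < z) (hz : z < N) {s t : ℕ → 𝕀}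
    (h : ∀ i < N - 3, s i = t i) : ∀ i < N,
    ins z 1 (ins y 1 (ins x 1 s)) i = ins z 1 (ins y 1 (ins x 1 t)) i := fun i hi =>
  ins_congr z 1 (fun i hi => ins_congr (n := N - 2) y 1 (fun i hi => ins_congr (n := N - 3) x 1 h i
      (by omega) (by omega)) i (by omega) (by omega)) i (show i < N - 1 + 1 by omega) (by omega)

theorem ev_tripleCube {x y z c d : ℕ} (hxy : x < y) (hyz : y < z) (hz : z < N) (hc : c < N)
    (hd : d < N) (t : ℕ → 𝕀) : ev (tripleCube N v x y z c d) t =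
      cycleLoop v N (ins z 1 (ins y 1 (ins x 1 t)),
        arcTime (ins z 1 (ins y 1 (ins x 1 t))) c d (t (N - 3))) := by
  refine ev_cubeOf _ _ (fun s t h => ?_) t
  have h' := triple_congr hxy hyz hz (fun i hi => h i (by omega))
  refine cycleLoop_congr (fun _ _ => rfl) h' ?_
  rw [h (N - 3) (by omega), arcTime_congr hc hd h']

end LiftedLoops

/-! ### The boundary of the chain of closed paths -/

section LiftedBoundary

variable {E : Type v} [AddCommGroup E] [Module ℝ E] [TopologicalSpace E]
  [IsTopologicalAddGroup E] [ContinuousSMul ℝ E] (v : ℕ → E) {N : ℕ}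

/-- In these face formulas the coordinate which belongs to the vertex p has the number p before the
inserted unit coordinates, p - 1 after one of them and p - 2 after both. The face at 0 omits p, the
face at 1 makes the path pass through v p. -/
theorem fc_vertexCube_lt_zero {a k : ℕ} (hk : k < a) (ha : a < N) :
    fc (vertexCube N v a) k 0 = vertexCube (N - 1) (v ∘ skip k) (a - 1) := by
  refine cube_ext rfl fun t => ?_
  have h1 := one_le_startTime (show a - 1 < N - 1 by omega) (ins_self (a - 1) 1 t)
  have h2 := startTime_mono (ins (a - 1) 1 t) (show a - 1 + 1 ≤ N - 1 by omega)
  rw [ev_fc _ (by change k < N - 1; omega), ev_vertexCube _ ha, ev_vertexCube _ (by omega),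
    ins_ins hk, startTime_ins _ _ _ hk.le, Set.Icc.coe_zero, add_zero, Nat.sub_add_cancel (by omega)]
  rw [Nat.sub_add_cancel (by omega)] at h2
  exact cycleLoop_ins_zero v (by omega) h1 (startTime_nonneg _ _) h2

theorem fc_vertexCube_gt_zero {a p : ℕ} (hp : a < p) (hN : p < N) :
    fc (vertexCube N v a) (p - 1) 0 = vertexCube (N - 1) (v ∘ skip p) a := by
  refine cube_ext rfl fun t => ?_
  have h1 := one_le_startTime (show a < N - 1 by omega) (ins_self a 1 t)
  have h2 := startTime_mono (ins a 1 t) (show a + 1 ≤ N - 1 by omega)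
  rw [ev_fc _ (by change p - 1 < N - 1; omega), ev_vertexCube _ (by omega), ev_vertexCube _ (by omega),
    ← ins_ins hp, startTime_ins_le _ _ hp]
  exact cycleLoop_ins_zero v (by omega) h1 (startTime_nonneg _ _) h2

theorem fc_vertexCube_lt_one {a k : ℕ} (hk : k < a) (ha : a < N) :
    fc (vertexCube N v a) k 1 = pairCube N v k a a := by
  refine cube_ext rfl fun t => ?_
  rw [ev_fc _ (by change k < N - 1; omega), ev_vertexCube _ ha, ev_pairCube _ hk ha ha]

theorem fc_vertexCube_gt_one {a p : ℕ} (hp : a < p) (hN : p < N) :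
    fc (vertexCube N v a) (p - 1) 1 = pairCube N v a p a := by
  refine cube_ext rfl fun t => ?_
  rw [ev_fc _ (by change p - 1 < N - 1; omega), ev_vertexCube _ (by omega),
    ev_pairCube _ hp hN (by omega), ← ins_ins hp]

theorem fc_arcCube_last_zero {a b : ℕ} (hab : a < b) (hb : b < N) :
    fc (arcCube N v a b) (N - 2) 0 = pairCube N v a b a := by
  refine cube_ext rfl fun t => ?_
  rw [ev_fc _ (by change N - 2 < N - 1; omega), ev_arcCube _ hab hb, ev_pairCube _ hab hb (by omega),
    ins_self, arcTime, Set.Icc.coe_zero, zero_mul, add_zero]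
  -- The delays use only the first N - 2 coordinates. The last one determines the starting time
  -- alone.
  have h : ∀ i < N, ins b 1 (ins a 1 (ins (N - 2) 0 t)) i = ins b 1 (ins a 1 t) i := fun i hi =>
    ins_congr b 1 (fun i hi => ins_congr (n := N - 2) a 1 (fun i hi => ins_lt _ _ hi) i
      (by omega) (by omega)) i (show i < N - 1 + 1 by omega) (by omega)
  exact cycleLoop_congr (fun _ _ => rfl) h (startTime_congr fun j hj => h j (by omega))

theorem fc_arcCube_last_one {a b : ℕ} (hab : a < b) (hb : b < N) :
    fc (arcCube N v a b) (N - 2) 1 = pairCube N v a b b := by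
  refine cube_ext rfl fun t => ?_
  rw [ev_fc _ (by change N - 2 < N - 1; omega), ev_arcCube _ hab hb, ev_pairCube _ hab hb (by omega),
    ins_self, arcTime, Set.Icc.coe_one, one_mul, add_sub_cancel]
  have h : ∀ i < N, ins b 1 (ins a 1 (ins (N - 2) 1 t)) i = ins b 1 (ins a 1 t) i := fun i hi =>
    ins_congr b 1 (fun i hi => ins_congr (n := N - 2) a 1 (fun i hi => ins_lt _ _ hi) i
      (by omega) (by omega)) i (show i < N - 1 + 1 by omega) (by omega)
  exact cycleLoop_congr (fun _ _ => rfl) h (startTime_congr fun j hj => h j (by omega))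

theorem fc_arcCube_lt_zero {a b k : ℕ} (hk : k < a) (hab : a < b) (hb : b < N) :
    fc (arcCube N v a b) k 0 = arcCube (N - 1) (v ∘ skip k) (a - 1) (b - 1) := by
  refine cube_ext rfl fun t => ?_
  have h1 := one_le_startTime (show b - 1 < N - 1 by omega)
    (ins_self (b - 1) 1 (ins (a - 1) 1 t))
  have h2 := arcTime_mem (ins (b - 1) 1 (ins (a - 1) 1 t)) (show a - 1 ≤ b - 1 by omega)
    (show b - 1 < N - 1 by omega) (t (N - 3))
  rw [ev_fc _ (by change k < N - 1; omega), ev_arcCube _ hab hb,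
    ev_arcCube _ (show a - 1 < b - 1 by omega) (by omega), ins_ins hk, ins_ins (hk.trans hab),
    arcTime_ins_lt _ _ hk (hk.trans hab), ins_of_lt' _ _ (by omega)]
  exact cycleLoop_ins_zero v (by omega) h1 h2.1 h2.2

theorem fc_arcCube_between_zero {a b p : ℕ} (hp : a < p) (hpb : p < b) (hb : b < N) :
    fc (arcCube N v a b) (p - 1) 0 = arcCube (N - 1) (v ∘ skip p) a (b - 1) := by
  refine cube_ext rfl fun t => ?_
  have h1 := one_le_startTime (show b - 1 < N - 1 by omega)
    (ins_self (b - 1) 1 (ins a 1 t))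
  have h2 := arcTime_mem (ins (b - 1) 1 (ins a 1 t)) (show a ≤ b - 1 by omega)
    (show b - 1 < N - 1 by omega) (t (N - 3))
  rw [ev_fc _ (by change p - 1 < N - 1; omega), ev_arcCube _ (by omega) hb,
    ev_arcCube _ (show a < b - 1 by omega) (by omega), ← ins_ins hp, ins_ins hpb,
    arcTime_ins_between _ _ hp hpb, ins_of_lt' _ _ (by omega)]
  exact cycleLoop_ins_zero v (by omega) h1 h2.1 h2.2

theorem fc_arcCube_gt_zero {a b p : ℕ} (hab : a < b) (hp : b < p) (hN : p < N) :
    fc (arcCube N v a b) (p - 2) 0 = arcCube (N - 1) (v ∘ skip p) a b := by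
  refine cube_ext rfl fun t => ?_
  have h1 := one_le_startTime (show b < N - 1 by omega) (ins_self b 1 (ins a 1 t))
  have h2 := arcTime_mem (ins b 1 (ins a 1 t)) hab.le (show b < N - 1 by omega) (t (N - 3))
  rw [ev_fc _ (by change p - 2 < N - 1; omega), ev_arcCube _ hab (by omega),
    ev_arcCube _ hab (by omega), show p - 2 = p - 1 - 1 by omega,
    ← ins_ins (show a < p - 1 by omega), ← ins_ins hp, arcTime_ins_gt _ _ (by omega) hp,
    ins_of_lt' _ _ (by omega)]
  exact cycleLoop_ins_zero v (by omega) h1 h2.1 h2.2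

theorem fc_arcCube_lt_one {a b k : ℕ} (hk : k < a) (hab : a < b) (hb : b < N) :
    fc (arcCube N v a b) k 1 = tripleCube N v k a b a b := by
  refine cube_ext rfl fun t => ?_
  rw [ev_fc _ (by change k < N - 1; omega), ev_arcCube _ hab hb,
    ev_tripleCube _ hk hab hb (by omega) hb, ins_of_lt' _ _ (by omega)]
  rfl

theorem fc_arcCube_between_one {a b p : ℕ} (hp : a < p) (hpb : p < b) (hb : b < N) :
    fc (arcCube N v a b) (p - 1) 1 = tripleCube N v a p b a b := by
  refine cube_ext rfl fun t => ?_
  rw [ev_fc _ (by change p - 1 < N - 1; omega), ev_arcCube _ (by omega) hb,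
    ev_tripleCube _ hp hpb hb (by omega) hb, ins_of_lt' _ _ (by omega), ← ins_ins hp]
  rfl

theorem fc_arcCube_gt_one {a b p : ℕ} (hab : a < b) (hp : b < p) (hN : p < N) :
    fc (arcCube N v a b) (p - 2) 1 = tripleCube N v a b p a b := by
  refine cube_ext rfl fun t => ?_
  rw [ev_fc _ (by change p - 2 < N - 1; omega), ev_arcCube _ hab (by omega),
    ev_tripleCube _ hab hp hN (by omega) (by omega), ins_of_lt' _ _ (by omega),
    show p - 2 = p - 1 - 1 by omega, ← ins_ins (show a < p - 1 by omega), ← ins_ins hp]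
  rfl

/-- A family of starting points on the arc from x to z splits at y into the families on the two
smaller arcs. This is an instance of the fitting relation, with a division point that depends on the
delays. -/
theorem mkQ_tripleCube {x y z : ℕ} (hxy : x < y) (hyz : y < z) (hz : z < N) :
    (relations (LiftedLoop E)).mkQ (Finsupp.single (tripleCube N v x y z x z) 1) =
      (relations (LiftedLoop E)).mkQ (Finsupp.single (tripleCube N v x y z x y) 1) +
        (relations (LiftedLoop E)).mkQ (Finsupp.single (tripleCube N v x y z y z) 1) := by
  let S : (ℕ → 𝕀) → ℕ → 𝕀 := fun t => ins z 1 (ins y 1 (ins x 1 t))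
  have hS : Continuous S :=
    (continuous_ins z 1).comp ((continuous_ins y 1).comp (continuous_ins x 1))
  have hSy : ∀ t, startTime (S t) (x + 1) ≤ startTime (S t) (y + 1) := fun t =>
    startTime_mono _ (by omega)
  have hSyz : ∀ t, startTime (S t) (y + 1) ≤ startTime (S t) (z + 1) := fun t =>
    startTime_mono _ (by omega)
  -- The unit coordinate at z bounds the duration of the arc from below, which makes the quotient φ
  -- continuous.
  have hSz : ∀ t, startTime (S t) (x + 1) + 1 ≤ startTime (S t) (z + 1) := fun t => by
    rw [startTime_succ _ z, show S t z = 1 from ins_self _ _ _, Set.Icc.coe_one]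
    have := startTime_mono (S t) (show x + 1 ≤ z by omega)
    linarith
  -- The fraction of the arc from x to z that is complete at the vertex y.
  let φ : (ℕ → 𝕀) → 𝕀 := fun t => ⟨(startTime (S t) (y + 1) - startTime (S t) (x + 1)) /
    (startTime (S t) (z + 1) - startTime (S t) (x + 1)), by
      have h1 := hSy t
      have h2 := hSyz t
      have h3 := hSz t
      exact ⟨div_nonneg (by linarith) (by linarith), (div_le_one (by linarith)).2 (by linarith)⟩⟩
  have hφ : Continuous φ := by
    have h : ∀ i, Continuous fun t => startTime (S t) i := fun i => (continuous_startTime i).comp hS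
    refine Continuous.subtype_mk (((h _).sub (h _)).div ((h _).sub (h _)) fun t => ?_) _
    have := hSz t
    simp only [Pi.sub_apply, ne_eq]
    linarith
  have hφm : ∀ t, (φ t : ℝ) * (startTime (S t) (z + 1) - startTime (S t) (x + 1)) =
      startTime (S t) (y + 1) - startTime (S t) (x + 1) := fun t => by
    have := hSz t
    exact div_mul_cancel₀ _ (by linarith)
  have hφc : ∀ {s t : ℕ → 𝕀}, (∀ i < N - 3, s i = t i) → φ s = φ t := fun {s t} h => by
    have h' : ∀ i < N, S s i = S t i := triple_congr hxy hyz hz h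
    refine Subtype.ext ?_
    change (_ - _) / (_ - _) = (_ - _) / (_ - _)
    rw [startTime_congr (i := x + 1) fun j hj => h' j (by omega),
      startTime_congr (i := y + 1) fun j hj => h' j (by omega),
      startTime_congr (i := z + 1) fun j hj => h' j (by omega)]
  have hext : ∀ t : ℕ → 𝕀, φ (extendCoords (N - 3) fun i => t i) = φ t := fun t =>
    hφc fun i hi => extendCoords_apply (fun i : Fin (N - 3) => t i) hi
  -- Three delays are fixed to 1, so the coordinate N - 3 is the free starting time and does not
  -- enter the delays.
  have hu : ∀ (t : ℕ → 𝕀) (w : 𝕀), ∀ i < N, S (Function.update t (N - 3) w) i = S t i := fun t w =>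
    triple_congr hxy hyz hz fun i hi => Function.update_of_ne (by omega) _ _
  have key := mem_fitting (N - 3) ⟨fun t => φ (extendCoords (N - 3) t),
      hφ.comp (continuous_extendCoords _)⟩
    (tripleCube N v x y z x z) (tripleCube N v x y z x y) (tripleCube N v x y z y z)
    (by change N - 2 = _; omega) (by change N - 2 = _; omega) (by change N - 2 = _; omega)
    (fun t => by
      rw [ev_tripleCube _ hxy hyz hz (by omega) (by omega),
        ev_tripleCube _ hxy hyz hz (by omega) (by omega), Function.update_self]
      refine cycleLoop_congr (fun _ _ => rfl) (fun i hi => (hu t _ i hi).symm) ?_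
      change arcTime (S t) _ _ _ = arcTime (S _) _ _ _
      rw [arcTime_congr (show x < N by omega) hz (hu t _)]
      simp only [ContinuousMap.coe_mk, hext, Set.Icc.coe_mul, arcTime]
      linear_combination (-(t (N - 3) : ℝ)) * hφm t)
    (fun t => by
      rw [ev_tripleCube _ hxy hyz hz (by omega) (by omega),
        ev_tripleCube _ hxy hyz hz (by omega) (by omega), Function.update_self]
      refine cycleLoop_congr (fun _ _ => rfl) (fun i hi => (hu t _ i hi).symm) ?_
      change arcTime (S t) _ _ _ = arcTime (S _) _ _ _
      rw [arcTime_congr (show x < N by omega) hz (hu t _)]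
      simp only [ContinuousMap.coe_mk, hext, Set.Icc.coe_mul, arcTime, unitInterval.coe_symm_eq]
      linear_combination (-(1 - (t (N - 3) : ℝ))) * hφm t)
  rw [← map_add, eq_comm, ← sub_eq_zero, ← map_sub, Submodule.mkQ_apply,
    Submodule.Quotient.mk_eq_zero]
  exact (le_sup_left.trans le_sup_right : fitting _ ≤ relations _) key

/-- The chain of free loops in `E` associated with the points `v 0, …, v (N - 1)`. -/
def cycleChain (N : ℕ) (v : ℕ → E) : FreeChains (LiftedLoop E) :=
  ∑ a ∈ Finset.range N, (-1 : ℤ) ^ a • Finsupp.single (vertexCube N v a) 1 +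
    ∑ b ∈ Finset.range N, ∑ a ∈ Finset.range b,
      (-1 : ℤ) ^ (a + b + N + 1) • Finsupp.single (arcCube N v a b) 1

theorem cycleChain_mem (N : ℕ) (v : ℕ → E) : cycleChain N v ∈ degreePart _ (N - 1) := by
  refine add_mem (Submodule.sum_mem _ fun a _ => Submodule.smul_mem _ _ ?_)
    (Submodule.sum_mem _ fun b _ => Submodule.sum_mem _ fun a _ => Submodule.smul_mem _ _ ?_) <;>
  exact single_mem_degreePart rfl

theorem cubeBoundary_vertexCube {a : ℕ} (ha : a < N) :
    cubeBoundary (vertexCube N v a) =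
      ∑ p ∈ Finset.range a, (-1 : ℤ) ^ p • (Finsupp.single (pairCube N v p a a) 1 -
        Finsupp.single (vertexCube (N - 1) (v ∘ skip p) (a - 1)) 1) +
      ∑ p ∈ Finset.Ico (a + 1) N, (-1 : ℤ) ^ (p + 1) • (Finsupp.single (pairCube N v a p a) 1 -
        Finsupp.single (vertexCube (N - 1) (v ∘ skip p) a) 1) := by
  rw [cubeBoundary_eq, show (vertexCube N v a).1 = N - 1 from rfl, sum_split_one _ ha]
  refine congrArg₂ (· + ·) ?_ ?_
  · refine Finset.sum_congr rfl fun p hp => ?_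
    rw [Finset.mem_range] at hp
    rw [fc_vertexCube_lt_zero _ hp ha, fc_vertexCube_lt_one _ hp ha]
  · refine Finset.sum_congr rfl fun p hp => ?_
    rw [Finset.mem_Ico] at hp
    rw [fc_vertexCube_gt_zero _ (by omega) hp.2, fc_vertexCube_gt_one _ (by omega) hp.2,
      neg_one_pow_congr_mod (show (p - 1) % 2 = (p + 1) % 2 by omega)]

theorem cubeBoundary_arcCube {a b : ℕ} (hab : a < b) (hb : b < N) :
    cubeBoundary (arcCube N v a b) =
      ∑ p ∈ Finset.range a, (-1 : ℤ) ^ p • (Finsupp.single (tripleCube N v p a b a b) 1 -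
        Finsupp.single (arcCube (N - 1) (v ∘ skip p) (a - 1) (b - 1)) 1) +
      ∑ p ∈ Finset.Ico (a + 1) b, (-1 : ℤ) ^ (p + 1) •
        (Finsupp.single (tripleCube N v a p b a b) 1 -
        Finsupp.single (arcCube (N - 1) (v ∘ skip p) a (b - 1)) 1) +
      ∑ p ∈ Finset.Ico (b + 1) N, (-1 : ℤ) ^ p • (Finsupp.single (tripleCube N v a b p a b) 1 -
        Finsupp.single (arcCube (N - 1) (v ∘ skip p) a b) 1) +
      (-1 : ℤ) ^ N • (Finsupp.single (pairCube N v a b b) 1 -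
        Finsupp.single (pairCube N v a b a) 1) := by
  rw [cubeBoundary_eq, show (arcCube N v a b).1 = N - 2 + 1 by change N - 1 = _; omega,
    Finset.sum_range_succ, sum_split_two _ hab hb, fc_arcCube_last_zero _ hab hb,
    fc_arcCube_last_one _ hab hb, neg_one_pow_congr_mod (show (N - 2) % 2 = N % 2 by omega)]
  refine congrArg₂ (· + ·) (congrArg₂ (· + ·) (congrArg₂ (· + ·) ?_ ?_) ?_) rfl
  · refine Finset.sum_congr rfl fun p hp => ?_
    rw [Finset.mem_range] at hp
    rw [fc_arcCube_lt_zero _ hp hab hb, fc_arcCube_lt_one _ hp hab hb]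
  · refine Finset.sum_congr rfl fun p hp => ?_
    rw [Finset.mem_Ico] at hp
    rw [fc_arcCube_between_zero _ (by omega) hp.2 hb, fc_arcCube_between_one _ (by omega) hp.2 hb,
      neg_one_pow_congr_mod (show (p - 1) % 2 = (p + 1) % 2 by omega)]
  · refine Finset.sum_congr rfl fun p hp => ?_
    rw [Finset.mem_Ico] at hp
    rw [fc_arcCube_gt_zero _ hab (by omega) hp.2, fc_arcCube_gt_one _ hab (by omega) hp.2,
      neg_one_pow_congr_mod (show (p - 2) % 2 = p % 2 by omega)]

/-- Up to the relations, the boundary of `cycleChain` is the simplicial boundary. -/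
theorem mkQ_boundary_cycleChain (N : ℕ) (v : ℕ → E) :
    (relations (LiftedLoop E)).mkQ (freeBoundary _ (cycleChain N v)) =
      (relations (LiftedLoop E)).mkQ
        (∑ p ∈ Finset.range N, (-1 : ℤ) ^ p • cycleChain (N - 1) (v ∘ skip p)) := by
  set π := (relations (LiftedLoop E)).mkQ with hπ
  let D : ℕ → ℕ → ℕ → FreeChains (LiftedLoop E) ⧸ relations (LiftedLoop E) := fun x y c =>
    (-1 : ℤ) ^ (x + y) • π (Finsupp.single (pairCube N v x y c) 1)
  let T : ℕ → ℕ → ℕ → ℕ → ℕ → FreeChains (LiftedLoop E) ⧸ relations (LiftedLoop E) :=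
    fun c d x y z => (-1 : ℤ) ^ (x + y + z + N + 1) •
      π (Finsupp.single (tripleCube N v x y z c d) 1)
  let A : ℕ → ℕ → FreeChains (LiftedLoop E) ⧸ relations (LiftedLoop E) := fun p a =>
    (-1 : ℤ) ^ (p + a) • π (Finsupp.single (vertexCube (N - 1) (v ∘ skip p) a) 1)
  let B : ℕ → ℕ → ℕ → FreeChains (LiftedLoop E) ⧸ relations (LiftedLoop E) := fun p a b =>
    (-1 : ℤ) ^ (p + a + b + N) • π (Finsupp.single (arcCube (N - 1) (v ∘ skip p) a b) 1)
  have hA : ∀ a ∈ Finset.range N,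
      π (freeBoundary _ ((-1 : ℤ) ^ a • Finsupp.single (vertexCube N v a) 1)) =
      (∑ p ∈ Finset.range a, A p (a - 1) + ∑ p ∈ Finset.Ico (a + 1) N, A p a) +
      (∑ p ∈ Finset.range a, D p a a - ∑ p ∈ Finset.Ico (a + 1) N, D a p a) := by
    intro a ha
    rw [Finset.mem_range] at ha
    rw [map_smul, freeBoundary_single, cubeBoundary_vertexCube _ ha, map_smul, map_add, map_sum,
      map_sum, smul_add, Finset.smul_sum, Finset.smul_sum]
    have h1 : ∀ p ∈ Finset.range a, (-1 : ℤ) ^ a • π ((-1 : ℤ) ^ p •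
        (Finsupp.single (pairCube N v p a a) 1 -
          Finsupp.single (vertexCube (N - 1) (v ∘ skip p) (a - 1)) 1)) = D p a a + A p (a - 1) := by
      intro p hp
      rw [Finset.mem_range] at hp
      rw [map_smul, smul_smul, ← pow_add, map_sub, smul_sub, sub_eq_add_neg, ← neg_smul]
      simp only [D, A]
      rw [neg_one_pow_congr_mod (show (a + p) % 2 = (p + a) % 2 by omega),
        neg_one_pow_succ_mod (a := p + (a - 1)) (b := p + a) (by omega)]
    have h2 : ∀ p ∈ Finset.Ico (a + 1) N, (-1 : ℤ) ^ a • π ((-1 : ℤ) ^ (p + 1) •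
        (Finsupp.single (pairCube N v a p a) 1 -
          Finsupp.single (vertexCube (N - 1) (v ∘ skip p) a) 1)) = A p a - D a p a := by
      intro p hp
      rw [map_smul, smul_smul, ← pow_add, map_sub, smul_sub]
      simp only [D, A]
      rw [neg_one_pow_succ_mod (a := a + (p + 1)) (b := p + a) (by omega), add_comm p a]
      module
    rw [Finset.sum_congr rfl h1, Finset.sum_congr rfl h2, Finset.sum_add_distrib,
      Finset.sum_sub_distrib]
    abel
  have hB : ∀ b ∈ Finset.range N, ∀ a ∈ Finset.range b,
      π (freeBoundary _ ((-1 : ℤ) ^ (a + b + N + 1) • Finsupp.single (arcCube N v a b) 1)) =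
      (∑ p ∈ Finset.range a, B p (a - 1) (b - 1) + ∑ p ∈ Finset.Ico (a + 1) b, B p a (b - 1) +
        ∑ p ∈ Finset.Ico (b + 1) N, B p a b) +
      (∑ p ∈ Finset.range a, T a b p a b - ∑ p ∈ Finset.Ico (a + 1) b, T a b a p b +
        ∑ p ∈ Finset.Ico (b + 1) N, T a b a b p) + (D a b a - D a b b) := by
    intro b hb a ha
    rw [Finset.mem_range] at ha hb
    rw [map_smul, freeBoundary_single, cubeBoundary_arcCube _ ha hb, map_smul, map_add, map_add,
      map_add, map_sum, map_sum, map_sum, smul_add, smul_add, smul_add, Finset.smul_sum,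
      Finset.smul_sum, Finset.smul_sum]
    have h1 : ∀ p ∈ Finset.range a, (-1 : ℤ) ^ (a + b + N + 1) • π ((-1 : ℤ) ^ p •
        (Finsupp.single (tripleCube N v p a b a b) 1 -
          Finsupp.single (arcCube (N - 1) (v ∘ skip p) (a - 1) (b - 1)) 1)) =
        T a b p a b + B p (a - 1) (b - 1) := by
      intro p hp
      rw [Finset.mem_range] at hp
      rw [map_smul, smul_smul, ← pow_add, map_sub, smul_sub, sub_eq_add_neg, ← neg_smul]
      simp only [T, B]
      rw [neg_one_pow_congr_mod (show (a + b + N + 1 + p) % 2 = (p + a + b + N + 1) % 2 by omega),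
        neg_one_pow_succ_mod (a := p + (a - 1) + (b - 1) + N) (b := p + a + b + N + 1) (by omega)]
    have h2 : ∀ p ∈ Finset.Ico (a + 1) b, (-1 : ℤ) ^ (a + b + N + 1) • π ((-1 : ℤ) ^ (p + 1) •
        (Finsupp.single (tripleCube N v a p b a b) 1 -
          Finsupp.single (arcCube (N - 1) (v ∘ skip p) a (b - 1)) 1)) =
        B p a (b - 1) - T a b a p b := by
      intro p hp
      rw [Finset.mem_Ico] at hp
      rw [map_smul, smul_smul, ← pow_add, map_sub, smul_sub]
      simp only [T, B]
      rw [neg_one_pow_succ_mod (a := a + b + N + 1 + (p + 1)) (b := a + p + b + N + 1) (by omega),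
        neg_one_pow_congr_mod (show (p + a + (b - 1) + N) % 2 = (a + p + b + N + 1) % 2 by omega)]
      module
    have h3 : ∀ p ∈ Finset.Ico (b + 1) N, (-1 : ℤ) ^ (a + b + N + 1) • π ((-1 : ℤ) ^ p •
        (Finsupp.single (tripleCube N v a b p a b) 1 -
          Finsupp.single (arcCube (N - 1) (v ∘ skip p) a b) 1)) =
        T a b a b p + B p a b := by
      intro p hp
      rw [map_smul, smul_smul, ← pow_add, map_sub, smul_sub]
      simp only [T, B]
      rw [neg_one_pow_congr_mod (show (a + b + N + 1 + p) % 2 = (a + b + p + N + 1) % 2 by omega),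
        neg_one_pow_succ_mod (a := p + a + b + N) (b := a + b + p + N + 1) (by omega)]
      module
    have h4 : (-1 : ℤ) ^ (a + b + N + 1) • π ((-1 : ℤ) ^ N •
        (Finsupp.single (pairCube N v a b b) 1 - Finsupp.single (pairCube N v a b a) 1)) =
        D a b a - D a b b := by
      rw [map_smul, smul_smul, ← pow_add, map_sub, smul_sub]
      simp only [D]
      rw [neg_one_pow_succ_mod (a := a + b + N + 1 + N) (b := a + b) (by omega)]
      module
    rw [Finset.sum_congr rfl h1, Finset.sum_congr rfl h2, Finset.sum_congr rfl h3, h4,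
      Finset.sum_add_distrib, Finset.sum_sub_distrib, Finset.sum_add_distrib]
    abel
  -- The three arcs among x < y < z occur with alternating signs, so this additivity cancels all
  -- faces at a third vertex.
  have hT : ∀ z ∈ Finset.range N, ∀ y ∈ Finset.range z, ∀ x ∈ Finset.range y,
      T x z x y z = T x y x y z + T y z x y z := by
    intro z hz y hy x hx
    rw [Finset.mem_range] at hx hy hz
    simp only [T, hπ]
    rw [mkQ_tripleCube _ hx hy hz, smul_add]
  have hR : π (∑ p ∈ Finset.range N, (-1 : ℤ) ^ p • cycleChain (N - 1) (v ∘ skip p)) =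
      ∑ p ∈ Finset.range N, ∑ a ∈ Finset.range (N - 1), A p a +
      ∑ p ∈ Finset.range N, ∑ b ∈ Finset.range (N - 1), ∑ a ∈ Finset.range b, B p a b := by
    rw [map_sum, ← Finset.sum_add_distrib]
    refine Finset.sum_congr rfl fun p hp => ?_
    rw [Finset.mem_range] at hp
    rw [map_smul, cycleChain, map_add, smul_add]
    simp only [map_sum, map_smul, Finset.smul_sum, smul_smul, ← pow_add, A, B]
    refine congrArg₂ (· + ·) rfl ?_
    refine Finset.sum_congr rfl fun b _ => Finset.sum_congr rfl fun a _ => ?_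
    rw [neg_one_pow_congr_mod (show (p + (a + b + (N - 1) + 1)) % 2 = (p + a + b + N) % 2 by omega)]
  rw [hR, ← sum_vertex_faces, ← sum_arc_faces, cycleChain, map_add, map_add]
  simp only [map_sum]
  rw [Finset.sum_congr rfl hA, Finset.sum_congr rfl fun b hb => Finset.sum_congr rfl (hB b hb)]
  simp only [Finset.sum_add_distrib, Finset.sum_sub_distrib]
  -- Faces of vertex cubes where the path passes a second vertex cancel the ends of the arc cubes
  -- between these two vertices.
  rw [sum_pairs (fun a p => D a p a), sum_triples_middle (fun a p b => T a b a p b),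
    sum_triples_last (fun a b p => T a b a b p),
    Finset.sum_congr rfl fun z hz => Finset.sum_congr rfl fun y hy => Finset.sum_congr rfl
      (hT z hz y hy)]
  simp only [Finset.sum_add_distrib]
  abel

end LiftedBoundary

/-! ### Comparison of the lifted chain with the image under the Goodwillie map -/

section Projection

variable {E : Type v} [AddCommGroup E] [Module ℝ E] [TopologicalSpace E]
  [IsTopologicalAddGroup E] [ContinuousSMul ℝ E] {Q : Type u} [TopologicalSpace Q]

/-- The image in `Q` of a path in `E`, which is made a loop by means of the linear structure. -/
def projectLoop (f : C(E, Q)) : C(LiftedLoop E, FreeLoop Q) where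
  toFun x := (⟨⟨fun w => f (x.1 w - (w : ℝ) • (x.1 1 - x.1 0)), by fun_prop⟩, by simp⟩,
    x.2.toNNReal)
  continuous_toFun := by
    refine Continuous.prodMk (Continuous.subtype_mk (ContinuousMap.curry
      ⟨fun y : LiftedLoop E × 𝕀 => f (y.1.1 y.2 - (y.2 : ℝ) • (y.1.1 1 - y.1.1 0)), ?_⟩).continuous _)
      (continuous_real_toNNReal.comp continuous_snd)
    have h : ∀ {g : LiftedLoop E × 𝕀 → 𝕀}, Continuous g →
        Continuous fun y : LiftedLoop E × 𝕀 => y.1.1 (g y) := fun hg =>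
      Continuous.eval (continuous_fst.comp continuous_fst) hg
    exact f.continuous.comp ((h continuous_snd).sub
      ((continuous_subtype_val.comp continuous_snd).smul
        ((h continuous_const).sub (h continuous_const))))

theorem projectLoop_const (f : C(E, Q)) (x : E) :
    projectLoop f (ContinuousMap.const 𝕀 x, 0) = constLoop Q (f x) :=
  freeLoop_ext (by simp [projectLoop, constLoop]) fun w => by simp [projectLoop, constLoop]

theorem len_projectLoop_cycleLoop (f : C(E, Q)) (v : ℕ → E) (N : ℕ) (s : ℕ → 𝕀) (θ : ℝ) :
    ((projectLoop f (cycleLoop v N (s, θ))).2 : ℝ) = startTime s N :=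
  Real.coe_toNNReal _ (startTime_nonneg s N)

/-- In this range the path is closed already, so the linear correction in `projectLoop` vanishes. It
serves only to make the map defined on all paths. -/
theorem projectLoop_cycleLoop_apply (f : C(E, Q)) (v : ℕ → E) {N : ℕ} {s : ℕ → 𝕀} {θ : ℝ}
    (hs : 1 ≤ startTime s N) (h0 : 0 ≤ θ) (h1 : θ ≤ startTime s N) (w : 𝕀) :
    (projectLoop f (cycleLoop v N (s, θ))).1.1 w =
      f (cyclePath v N s (w * startTime s N + θ)) := by
  change f (cyclePath v N s _ - (w : ℝ) • (cyclePath v N s (((1 : 𝕀) : ℝ) * startTime s N + θ) -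
    cyclePath v N s (((0 : 𝕀) : ℝ) * startTime s N + θ))) = _
  rw [Set.Icc.coe_one, Set.Icc.coe_zero, one_mul, zero_mul, zero_add, add_comm (startTime s N) θ,
    cyclePath_periodic v hs h0 h1, sub_self, smul_zero, sub_zero]

theorem pathAt_of_le_startTime (u : ℕ → E) (t : ℕ → 𝕀) {m N : ℕ} (h : m ≤ N) {τ : ℝ}
    (hτ : τ ≤ startTime t m) : pathAt u t N τ = pathAt u t m τ := by
  obtain ⟨r, rfl⟩ := Nat.exists_eq_add_of_le h
  rw [pathAt, pathAt, Finset.sum_range_add, Finset.sum_eq_zero (s := Finset.range r), add_zero]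
  intro i _
  have := startTime_mono t (show m ≤ m + i by omega)
  rw [clamp_of_nonpos (by linarith), zero_smul]

theorem startTime_shift_cyc (s : ℕ → 𝕀) (N a i : ℕ) (ha : a ≤ N) :
    startTime (fun j => cyc s N (a + j)) i = startTime (cyc s N) (a + i) - startTime s a := by
  rw [startTime_add, startTime_cyc s ha, add_sub_cancel_left]

variable {q : Q} {f : C(E, Q)} (v : ℕ → {x : E // f x = q}) {N : ℕ}

theorem coe_cyc (i : ℕ) : ((cyc v N i : {x : E // f x = q}) : E) = cyc (fun i => (v i : E)) N i := by
  unfold cyc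
  split_ifs <;> rfl

/-- As s a = 1, the closed path passes through v a at the starting time; from there it is the path
that goes once around the polygon from a to N + a. -/
theorem projectLoop_vertex {a : ℕ} (ha : a < N) {s : ℕ → 𝕀} (hs : s a = 1) :
    projectLoop f (cycleLoop (fun i => (v i : E)) N (s, startTime s (a + 1))) =
      inclusion q (edgeLoop (fun i => cyc v N (a + i)) N fun j => cyc s N (a + 1 + j)) := by
  have h1 := one_le_startTime ha hs
  have h2 := startTime_mono s (show a + 1 ≤ N by omega)
  have hlen : pathLen (fun j => cyc s N (a + 1 + j)) N = startTime s N := by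
    rw [pathLen, startTime_shift_cyc _ _ _ _ (by omega), show a + 1 + (N - 1) = N + a by omega,
      startTime_cyc_add, startTime_succ, hs, Set.Icc.coe_one]
    ring
  refine freeLoop_ext (NNReal.coe_injective ?_) fun w => ?_
  · rw [len_projectLoop_cycleLoop, ← hlen]
    rfl
  · rw [projectLoop_cycleLoop_apply _ _ h1 (startTime_nonneg _ _) h2]
    change _ = f (pathAt _ _ _ (w * pathLen _ N))
    rw [hlen, cyclePath_add_startTime _ ha hs (mul_nonneg w.2.1 (startTime_nonneg _ _))
      (mul_le_of_le_one_left (startTime_nonneg _ _) w.2.2)]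
    simp only [coe_cyc]

/-- The unit coordinates at a and b cut the closed path into two loops at q. A starting time on the
first arc is the moved base point of `sharp`. -/
theorem projectLoop_arc {a b : ℕ} (hab : a < b) (hb : b < N) {s : ℕ → 𝕀} (hsa : s a = 1)
    (hsb : s b = 1) (w : 𝕀) :
    projectLoop f (cycleLoop (fun i => (v i : E)) N (s, arcTime s a b w)) =
      sharp q (edgeLoop (fun i => cyc v N (a + i)) (b - a) fun j => cyc s N (a + 1 + j),
        edgeLoop (fun i => cyc v N (b + i)) (N + a - b) fun j => cyc s N (b + 1 + j), w) := by
  have h1 := one_le_startTime hb hsb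
  have h2 := startTime_mono s (show b + 1 ≤ N by omega)
  have h3 := startTime_nonneg s a
  have h4 := arcTime_mem s hab.le hb w
  have ha1 : startTime s (a + 1) = startTime s a + 1 := by rw [startTime_succ, hsa, Set.Icc.coe_one]
  have hb1 : startTime s (b + 1) = startTime s b + 1 := by rw [startTime_succ, hsb, Set.Icc.coe_one]
  have hab1 := startTime_mono s (show a + 1 ≤ b by omega)
  -- α follows the polygon from a to b, and β from b to a in the next period.
  set α := edgeLoop (fun i => cyc v N (a + i)) (b - a) fun j => cyc s N (a + 1 + j) with hα
  set β := edgeLoop (fun i => cyc v N (b + i)) (N + a - b) fun j => cyc s N (b + 1 + j) with hβ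
  have hlα : len α = startTime s (b + 1) - startTime s (a + 1) := by
    rw [hα, len_edgeLoop, pathLen, startTime_shift_cyc _ _ _ _ (by omega),
      show a + 1 + (b - a - 1) = b by omega, startTime_cyc s hb.le]
    linarith
  have hlβ : len β = startTime s N + startTime s (a + 1) - startTime s (b + 1) := by
    rw [hβ, len_edgeLoop, pathLen, startTime_shift_cyc _ _ _ _ (by omega),
      show b + 1 + (N + a - b - 1) = N + a by omega, startTime_cyc_add]
    linarith
  have hα_at : ∀ τ, 0 ≤ τ → τ ≤ len α → f (cyclePath (fun i => (v i : E)) N s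
      (τ + startTime s (a + 1))) = loopAt α τ := by
    intro τ h0 h5
    rw [cyclePath_add_startTime _ (hab.trans hb) hsa h0 (by linarith), hα, loopAt_edgeLoop]
    simp only [coe_cyc]
    rw [pathAt_of_le_startTime _ _ (show b - a ≤ N by omega)]
    rw [startTime_shift_cyc _ _ _ _ (by omega), show a + 1 + (b - a) = b + 1 by omega,
      startTime_cyc s (by omega)]
    linarith
  have hβ_at : ∀ τ, 0 ≤ τ → τ ≤ len β → f (cyclePath (fun i => (v i : E)) N s
      (τ + startTime s (b + 1))) = loopAt β τ := by
    intro τ h0 h5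
    rw [cyclePath_add_startTime _ hb hsb h0 (by linarith), hβ, loopAt_edgeLoop]
    simp only [coe_cyc]
    rw [pathAt_of_le_startTime _ _ (show N + a - b ≤ N by omega)]
    rw [startTime_shift_cyc _ _ _ _ (by omega), show b + 1 + (N + a - b) = N + (a + 1) by omega,
      startTime_cyc_add]
    linarith
  have hl : len α + len β = startTime s N := by rw [hlα, hlβ]; ring
  have hw0 := mul_nonneg w.2.1 (len_pos α).le
  have hw1 := mul_le_of_le_one_left (len_pos α).le w.2.2
  have harc : arcTime s a b w = startTime s (a + 1) + w * len α := by rw [hlα, arcTime]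
  refine freeLoop_ext (NNReal.coe_injective ?_) fun r => ?_
  · rw [len_projectLoop_cycleLoop, ← hl]
    rfl
  · rw [projectLoop_cycleLoop_apply _ _ h1 h4.1 h4.2, harc]
    change _ = sharpAt α β w (r * (len α + len β))
    rw [hl]
    have hr0 := mul_nonneg r.2.1 (startTime_nonneg s N)
    have hr1 := mul_le_of_le_one_left (startTime_nonneg s N) r.2.2
    generalize (r : ℝ) * startTime s N = σ at hr0 hr1
    have hw2 : (1 - (w : ℝ)) * len α = len α - w * len α := by ring
    rw [sharpAt, hw2]
    generalize (w : ℝ) * len α = x at *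
    split_ifs with c1 c2
    · rw [← hα_at _ (by linarith) (by linarith)]
      congr 2; ring
    · rw [← hβ_at _ (by linarith) (by linarith), hlα]
      congr 2; ring
    -- After β the loop is on α again, one period later.
    · have hp := cyclePath_periodic (fun i => (v i : E)) h1
        (τ := σ - len β - (len α - x) + startTime s (a + 1)) (by linarith) (by linarith)
      rw [← hα_at _ (by linarith) (by linarith), ← hp]
      congr 2; linarith

theorem freeGoodwillie_letter (σ : Cube (BasedLoop q)) : freeGoodwillie q (letter σ) =
    (-1 : ℤ) ^ σ.1 • Finsupp.single (mapCube (inclusion q) σ) 1 :=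
  freeGoodwillie_single _

theorem freeGoodwillie_two (σ τ : Cube (BasedLoop q)) :
    freeGoodwillie q (appendWords (letter σ) (letter τ)) = - Finsupp.single (cubeVee σ τ) 1 := by
  rw [letter, letter, append_single, freeGoodwillie_single]
  rfl

theorem freeGoodwillie_three (x : FreeWords q) (ρ σ τ : Cube (BasedLoop q)) :
    freeGoodwillie q (appendWords (appendWords (letter ρ) (appendWords (letter σ) x)) (letter τ)) =
      0 := by
  induction x using words_induction with
  | zero => simp
  | add x y hx hy => simp only [map_add, LinearMap.add_apply, hx, hy, add_zero]
  | smul a x hx => simp only [map_smul, LinearMap.smul_apply, hx, smul_zero]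
  | single l =>
    rw [letter_append_single, letter_append_single, letter, append_single, freeGoodwillie_single]
    exact goodwillieWord_long (by simp)

/-- A decomposition with at least two letters, followed by τ, is too long for 𝒢. The single-letter
term has the sign -1, which cancels the sign of 𝒢 on words of length two. -/
theorem freeGoodwillie_bars_append {u : ℕ → {x : E // f x = q}} {a b : ℕ} (hab : a < b)
    (τ : Cube (BasedLoop q)) :
    freeGoodwillie q (appendWords (bars u a b) (letter τ)) =
      Finsupp.single (cubeVee (segment u a b) τ) 1 := by
  have h : ∀ c ∈ Finset.Ico (a + 1) b, freeGoodwillie q (appendWords (appendWords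
      (letter (segment u a c)) (bars u c b)) (letter τ)) = 0 := by
    intro c hc
    rw [Finset.mem_Ico] at hc
    rw [bars_left u hc.2]
    simp only [map_neg, map_sum, LinearMap.neg_apply, LinearMap.sum_apply]
    rw [Finset.sum_eq_zero, neg_zero]
    exact fun d _ => freeGoodwillie_three _ _ _ _
  rw [bars_left u hab, map_neg, LinearMap.neg_apply, map_neg, map_sum, LinearMap.sum_apply, map_sum,
    Finset.sum_Ico_succ_top hab, Finset.sum_eq_zero h, zero_add, bars_self, append_empty,
    freeGoodwillie_two, neg_neg]

/-- The letter lists the delays in cyclic order from a + 1 on, the vertex cube from 0 on. The block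
of a coordinates trades places with the N - 1 - a others, and the permuting relation gives the sign.
-/
theorem mkQ_mapCube_vertexCube {a : ℕ} (ha : a < N) :
    (relations (FreeLoop Q)).mkQ (Finsupp.single
      (mapCube (inclusion q) (segment (cyc v N) a (N + a))) 1) = (-1 : ℤ) ^ (a * (N - 1 - a)) •
      (relations (FreeLoop Q)).mkQ (Finsupp.single
        (mapCube (projectLoop f) (vertexCube N (fun i => (v i : E)) a)) 1) := by
  have hd : N + a - a = N := by omega
  refine mkQ_blockSwap (p := 0) (by change 0 + a + (N - 1 - a) ≤ N - 1; omega)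
    (by change N + a - a - 1 = N - 1; omega) fun t => ?_
  rw [ev_mapCube, ev_mapCube, ev_vertexCube _ ha, projectLoop_vertex v ha (ins_self _ _ _), segment,
    ev_edgeCube, hd]
  refine congrArg _ (edgeLoop_congr (fun _ _ => rfl) fun j hj => ?_)
  simp only [cyc, ins, Function.comp, blockSwap]
  split_ifs <;> first | omega | (congr 1; omega)

/-- The same exchange of blocks, for the N - 2 delays other than those at a and b. The last
coordinate, which moves the base point, stays in place. -/
theorem mkQ_mapCube_arcCube {a b : ℕ} (hab : a < b) (hb : b < N) :
    (relations (FreeLoop Q)).mkQ (Finsupp.single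
      (cubeVee (segment (cyc v N) a b) (segment (cyc v N) b (N + a))) 1) =
      (-1 : ℤ) ^ (a * (N - 2 - a)) • (relations (FreeLoop Q)).mkQ (Finsupp.single
        (mapCube (projectLoop f) (arcCube N (fun i => (v i : E)) a b)) 1) := by
  refine mkQ_blockSwap (p := 0) (by change 0 + a + (N - 2 - a) ≤ N - 1; omega)
    (by change b - a - 1 + (N + a - b - 1) + 1 = N - 1; omega) fun t => ?_
  have h1 : ins b 1 (ins a 1 (t ∘ blockSwap 0 a (N - 2 - a))) a = 1 := by
    rw [ins_lt _ _ hab, ins_self]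
  rw [ev_mapCube, ev_arcCube _ hab hb, projectLoop_arc v hab hb h1 (ins_self _ _ _), ev_cubeVee,
    segment, segment, ev_edgeCube, ev_edgeCube]
  have e : ∀ i k, blockSwap 0 a (N - 2 - a) i = k → (t ∘ blockSwap 0 a (N - 2 - a)) i = t k :=
    fun i k h => congrArg t h
  refine sharp_congr (edgeLoop_congr (fun _ _ => rfl) fun j hj => ?_)
    (edgeLoop_congr (fun _ _ => rfl) fun j hj => ?_) ?_
  · rw [cyc_of_lt _ (by omega), ins_lt _ _ (by omega), ins_of_lt' _ _ (by omega)]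
    refine (e _ _ ?_).symm
    unfold blockSwap
    split_ifs <;> omega
  · rcases lt_or_ge (b + 1 + j) N with h | h
    · rw [cyc_of_lt _ h, ins_of_lt' _ _ (by omega), ins_of_lt' _ _ (by omega)]
      refine (e _ _ ?_).symm
      rw [dim_edgeCube]
      unfold blockSwap
      split_ifs <;> omega
    · rw [cyc_of_le _ h, ins_lt _ _ (by omega), ins_lt _ _ (by omega)]
      refine (e _ _ ?_).symm
      rw [dim_edgeCube]
      unfold blockSwap
      split_ifs <;> omega
  · refine (e _ _ ?_).symm
    rw [dim_edgeCube, dim_edgeCube]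
    unfold blockSwap
    split_ifs <;> omega

/-- The Goodwillie map takes the Hochschild chain of a sequence of points to its chain of
free loops. -/
theorem mkQ_freeGoodwillie_cyclicChain (N : ℕ) (v : ℕ → {x : E // f x = q}) :
    (relations (FreeLoop Q)).mkQ (freeGoodwillie q (cyclicChain N v)) =
      (relations (FreeLoop Q)).mkQ
        (mapChain (projectLoop f) (cycleChain N fun i => (v i : E))) := by
  have h1 : ∀ a ∈ Finset.range N, (relations (FreeLoop Q)).mkQ (freeGoodwillie q
      ((-1 : ℤ) ^ (a + N + 1 + a * N) •
        appendWords (bars (cyc v N) a a) (letter (segment (cyc v N) a (N + a))))) =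
      (relations (FreeLoop Q)).mkQ (mapChain (projectLoop f)
        ((-1 : ℤ) ^ a • Finsupp.single (vertexCube N (fun i => (v i : E)) a) 1)) := by
    intro a ha
    rw [Finset.mem_range] at ha
    rw [bars_self, empty_append, map_smul, map_smul, freeGoodwillie_letter, map_smul,
      mkQ_mapCube_vertexCube v ha, map_smul, map_smul, mapChain_single, smul_smul, smul_smul,
      ← pow_add, ← pow_add, dim_segment]
    refine congrArg₂ (· • ·) (neg_one_pow_congr_mod ?_) rfl
    -- The signs of `cyclicChain`, of 𝒢 and of the exchange of blocks combine to that of a, since a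
    -- * a and a have the same parity.
    obtain ⟨r, rfl⟩ : ∃ r, N = a + 1 + r := ⟨N - (a + 1), by omega⟩
    rw [show a + 1 + r - 1 - a = r by omega, show a + 1 + r + a - a - 1 = a + r by omega,
      mul_add, mul_add]
    have : (a * a) % 2 = a % 2 := by
      rcases Nat.mod_two_eq_zero_or_one a with h | h <;> simp [Nat.mul_mod, h]
    omega
  have h2 : ∀ b ∈ Finset.range N, ∀ a ∈ Finset.range b, (relations (FreeLoop Q)).mkQ
      (freeGoodwillie q ((-1 : ℤ) ^ (b + N + 1 + a * N) •
        appendWords (bars (cyc v N) a b) (letter (segment (cyc v N) b (N + a))))) =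
      (relations (FreeLoop Q)).mkQ (mapChain (projectLoop f)
        ((-1 : ℤ) ^ (a + b + N + 1) • Finsupp.single (arcCube N (fun i => (v i : E)) a b) 1)) := by
    intro b hb a ha
    rw [Finset.mem_range] at ha hb
    rw [map_smul, map_smul, freeGoodwillie_bars_append ha, mkQ_mapCube_arcCube v ha hb, map_smul,
      map_smul, mapChain_single, smul_smul, ← pow_add]
    refine congrArg₂ (· • ·) (neg_one_pow_congr_mod ?_) rfl
    obtain ⟨r, rfl⟩ : ∃ r, N = a + 2 + r := ⟨N - (a + 2), by omega⟩
    rw [show a + 2 + r - 2 - a = r by omega, mul_add, mul_add]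
    have : (a * a) % 2 = a % 2 := by
      rcases Nat.mod_two_eq_zero_or_one a with h | h <;> simp [Nat.mul_mod, h]
    omega
  have h3 : cyclicChain N v = ∑ b ∈ Finset.range N, (∑ a ∈ Finset.range b,
      (-1 : ℤ) ^ (b + N + 1 + a * N) •
        appendWords (bars (cyc v N) a b) (letter (segment (cyc v N) b (N + a))) +
      (-1 : ℤ) ^ (b + N + 1 + b * N) •
        appendWords (bars (cyc v N) b b) (letter (segment (cyc v N) b (N + b)))) :=
    Finset.sum_congr rfl fun b _ => Finset.sum_range_succ _ _
  rw [h3, cycleChain, Finset.sum_add_distrib, map_add, map_add, map_add, map_add]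
  simp only [map_sum]
  rw [Finset.sum_congr rfl h1, Finset.sum_congr rfl fun b hb => Finset.sum_congr rfl (h2 b hb),
    add_comm]

end Projection

/-! ### Natural triangulation of cubes by sequences of vertices -/

section Simplices

variable {Y : Type*}

/-- The simplicial boundary on the free abelian group on finite sequences of points. -/
def simplexBoundary : (List Y →₀ ℤ) →ₗ[ℤ] (List Y →₀ ℤ) :=
  Finsupp.linearCombination ℤ fun l =>
    ∑ p ∈ Finset.range l.length, (-1 : ℤ) ^ p • Finsupp.single (l.eraseIdx p) 1

theorem simplexBoundary_single (l : List Y) : simplexBoundary (Finsupp.single l 1) =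
    ∑ p ∈ Finset.range l.length, (-1 : ℤ) ^ p • Finsupp.single (l.eraseIdx p) 1 := by
  rw [simplexBoundary, Finsupp.linearCombination_single, one_smul]

/-- The join with a point. -/
def simplexCone (y : Y) : (List Y →₀ ℤ) →ₗ[ℤ] (List Y →₀ ℤ) := Finsupp.lmapDomain ℤ ℤ (y :: ·)

theorem simplexCone_single (y : Y) (l : List Y) :
    simplexCone y (Finsupp.single l 1) = Finsupp.single (y :: l) 1 := by
  simp [simplexCone]

theorem simplex_hom_ext {M : Type*} [AddCommGroup M] {f g : (List Y →₀ ℤ) →ₗ[ℤ] M}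
    (h : ∀ l, f (Finsupp.single l 1) = g (Finsupp.single l 1)) : f = g := by
  ext1 l
  ext1
  exact h l

/-- The empty sequence counts as a simplex, so this is the augmented complex and the formula needs
no correction in the lowest degree. -/
theorem simplexBoundary_cone (y : Y) (x : List Y →₀ ℤ) :
    simplexBoundary (simplexCone y x) = x - simplexCone y (simplexBoundary x) := by
  have : simplexBoundary ∘ₗ simplexCone y = LinearMap.id - simplexCone y ∘ₗ simplexBoundary :=
    simplex_hom_ext fun l => by
      simp only [LinearMap.comp_apply, LinearMap.sub_apply, LinearMap.id_apply, simplexCone_single,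
        simplexBoundary_single, map_sum, map_smul, List.length_cons]
      rw [Finset.sum_range_succ', pow_zero, one_smul, List.eraseIdx_zero, List.tail_cons, add_comm,
        sub_eq_add_neg, ← Finset.sum_neg_distrib]
      refine congrArg₂ (· + ·) rfl (Finset.sum_congr rfl fun p _ => ?_)
      rw [List.eraseIdx_cons_succ, pow_succ, mul_neg_one, neg_smul]
  exact LinearMap.congr_fun this x

/-- Insertion of a term into a sequence. -/
def insertAt {α : Type*} (k : ℕ) (x : α) (t : ℕ → α) : ℕ → α :=
  fun i => if i < k then t i else if i = k then x else t (i - 1)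

theorem insertAt_insertAt {α : Type*} {j k : ℕ} (h : j ≤ k) (x y : α) (t : ℕ → α) :
    insertAt (k + 1) x (insertAt j y t) = insertAt j y (insertAt k x t) := by
  ext i
  simp only [insertAt]
  split_ifs <;> first | rfl | omega

theorem comp_insertAt {α β : Type*} (g : α → β) (k : ℕ) (x : α) (t : ℕ → α) :
    g ∘ insertAt k x t = insertAt k (g x) (g ∘ t) := by
  ext i
  simp only [insertAt, Function.comp]
  split_ifs <;> rfl

/-- The triangulation of a cube with the vertices `w`. -/
def triangulate : ℕ → ((ℕ → Bool) → Y) → (List Y →₀ ℤ)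
  | 0, w => Finsupp.single [w fun _ => false] 1
  | n + 1, w => simplexCone (w fun _ => false) (∑ k ∈ Finset.range (n + 1), (-1 : ℤ) ^ k •
      (triangulate n (w ∘ insertAt k true) - triangulate n (w ∘ insertAt k false)))

/-- The triangulation is the join of one corner with the triangulations of all faces. The sum over
the faces is a cycle by `sum_faces_faces`, hence it is the boundary of its cone. Faces that contain
the corner contribute sequences with a repeated vertex; these need not be removed. -/
theorem simplexBoundary_triangulate (n : ℕ) (w : (ℕ → Bool) → Y) :
    simplexBoundary (triangulate (n + 1) w) = ∑ k ∈ Finset.range (n + 1), (-1 : ℤ) ^ k •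
      (triangulate n (w ∘ insertAt k true) - triangulate n (w ∘ insertAt k false)) := by
  induction n generalizing w with
  | zero =>
    rw [triangulate, simplexBoundary_cone, sub_eq_self]
    simp [triangulate, simplexBoundary_single]
  | succ n ih =>
    rw [triangulate, simplexBoundary_cone, sub_eq_self]
    simp only [map_sum, map_smul, map_sub, ih]
    have := sum_faces_faces (C := fun _ => (ℕ → Bool) → Y)
      (fun _ k ε w => w ∘ insertAt k ε) (fun _ j k ε η w h _ => funext fun t =>
        congrArg w (insertAt_insertAt h η ε t)) (n := n) (triangulate n) w
    simp only [← map_sub, ← map_smul, ← map_sum]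
    rw [this, map_zero]

theorem triangulate_map {Z : Type*} (g : Y → Z) (n : ℕ) (w : (ℕ → Bool) → Y) :
    Finsupp.lmapDomain ℤ ℤ (List.map g) (triangulate n w) = triangulate n (g ∘ w) := by
  have h : ∀ (y : Y) (x : List Y →₀ ℤ), Finsupp.lmapDomain ℤ ℤ (List.map g) (simplexCone y x) =
      simplexCone (g y) (Finsupp.lmapDomain ℤ ℤ (List.map g) x) := fun y x => by
    have : Finsupp.lmapDomain ℤ ℤ (List.map g) ∘ₗ simplexCone y =
        simplexCone (g y) ∘ₗ Finsupp.lmapDomain ℤ ℤ (List.map g) :=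
      simplex_hom_ext fun l => by simp [simplexCone]
    exact LinearMap.congr_fun this x
  induction n generalizing w with
  | zero => simp [triangulate]
  | succ n ih =>
    rw [triangulate, triangulate, h]
    simp only [map_sum, map_smul, map_sub, ih]
    rfl

variable {M : Type*} [AddCommGroup M]

/-- The linear extension of a function of finite sequences. -/
def sumOver (F : ℕ → (ℕ → Y) → M) (y₀ : Y) : (List Y →₀ ℤ) →ₗ[ℤ] M :=
  Finsupp.linearCombination ℤ fun l => F l.length fun i => l.getD i y₀

theorem sumOver_single (F : ℕ → (ℕ → Y) → M) (y₀ : Y) (l : List Y) :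
    sumOver F y₀ (Finsupp.single l 1) = F l.length fun i => l.getD i y₀ := by
  rw [sumOver, Finsupp.linearCombination_single, one_smul]

theorem getD_eraseIdx (l : List Y) (p : ℕ) (y₀ : Y) (i : ℕ) :
    (l.eraseIdx p).getD i y₀ = l.getD (skip p i) y₀ := by
  simp only [List.getD_eq_getElem?_getD, List.getElem?_eraseIdx, skip]
  split_ifs <;> rfl

theorem sumOver_boundary {P : Type*} [AddCommGroup P] {F : ℕ → (ℕ → Y) → M} {B π : M →ₗ[ℤ] P}
    (hF : ∀ N v, B (F N v) = π (∑ p ∈ Finset.range N, (-1 : ℤ) ^ p • F (N - 1) (v ∘ skip p)))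
    (y₀ : Y) (x : List Y →₀ ℤ) :
    B (sumOver F y₀ x) = π (sumOver F y₀ (simplexBoundary x)) := by
  have : B ∘ₗ sumOver F y₀ = π ∘ₗ sumOver F y₀ ∘ₗ simplexBoundary := simplex_hom_ext fun l => by
    simp only [LinearMap.comp_apply, sumOver_single, simplexBoundary_single, hF]
    congr 1
    rw [map_sum]
    refine Finset.sum_congr rfl fun p hp => ?_
    rw [Finset.mem_range] at hp
    rw [map_smul, sumOver_single, List.length_eraseIdx_of_lt hp]
    congr 2
    funext i
    exact (getD_eraseIdx l p y₀ i).symm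
  exact LinearMap.congr_fun this x

/-- Lists are read as infinite sequences with default values y₀ and z₀, which need not correspond.
The hypothesis `hG` says that the default is never seen. -/
theorem sumOver_map {Z P : Type*} [AddCommGroup P] {F : ℕ → (ℕ → Y) → M} {G : ℕ → (ℕ → Z) → P}
    (φ : M →ₗ[ℤ] P) (g : Y → Z) (hG : ∀ N v v', (∀ i < N, v i = v' i) → G N v = G N v')
    (h : ∀ N v, φ (F N v) = G N (g ∘ v)) (y₀ : Y) (z₀ : Z) (x : List Y →₀ ℤ) :
    φ (sumOver F y₀ x) = sumOver G z₀ (Finsupp.lmapDomain ℤ ℤ (List.map g) x) := by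
  have : φ ∘ₗ sumOver F y₀ = sumOver G z₀ ∘ₗ Finsupp.lmapDomain ℤ ℤ (List.map g) :=
    simplex_hom_ext fun l => by
      simp only [LinearMap.comp_apply, sumOver_single, h, Finsupp.lmapDomain_apply,
        Finsupp.mapDomain_single, List.length_map]
      refine hG _ _ _ fun i hi => ?_
      simp [List.getD_eq_getElem?_getD, List.getElem?_eq_getElem hi]
  exact LinearMap.congr_fun this x

/-- A property of the values on sequences of length `n + 1` holds on triangulated `n`-cubes. -/
theorem triangulate_mem (n : ℕ) (w : (ℕ → Bool) → Y) : triangulate n w ∈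
    Submodule.span ℤ {c | ∃ l : List Y, l.length = n + 1 ∧ c = Finsupp.single l 1} := by
  induction n generalizing w with
  | zero => exact Submodule.subset_span ⟨_, rfl, rfl⟩
  | succ n ih =>
    have h : Submodule.span ℤ {c | ∃ l : List Y, l.length = n + 1 ∧ c = Finsupp.single l 1} ≤
        (Submodule.span ℤ {c | ∃ l : List Y, l.length = n + 1 + 1 ∧ c = Finsupp.single l 1}).comap
          (simplexCone (w fun _ => false)) := by
      rw [Submodule.span_le]
      rintro _ ⟨l, hl, rfl⟩
      exact Submodule.subset_span ⟨_ :: l, by simp [hl], simplexCone_single _ _⟩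
    exact h (Submodule.sum_mem _ fun k _ => Submodule.smul_mem _ _ (sub_mem (ih _) (ih _)))

theorem sumOver_triangulate_mem {F : ℕ → (ℕ → Y) → M} {n : ℕ} {S : Submodule ℤ M}
    (h : ∀ v, F (n + 1) v ∈ S) (y₀ : Y) (w : (ℕ → Bool) → Y) :
    sumOver F y₀ (triangulate n w) ∈ S := by
  have key : Submodule.span ℤ {c | ∃ l : List Y, l.length = n + 1 ∧ c = Finsupp.single l 1} ≤
      S.comap (sumOver F y₀) := by
    rw [Submodule.span_le]
    rintro _ ⟨l, hl, rfl⟩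
    simp only [SetLike.mem_coe, Submodule.mem_comap, sumOver_single, hl]
    exact h _
  exact key (triangulate_mem n w)

end Simplices

/-! ### Naturality under affine maps and contraction of the path space -/

section AffineMaps

variable {E : Type v} [AddCommGroup E] [Module ℝ E] [TopologicalSpace E]
  [IsTopologicalAddGroup E] [ContinuousSMul ℝ E] {Q : Type u} [TopologicalSpace Q]

/-- Affine maps, in the form in which they are used. -/
def IsAffine (g : C(E, E)) : Prop :=
  ∀ (x y z : E) (r : ℝ), g (x + r • (y - z)) = g x + r • (g y - g z)

theorem IsAffine.map_sum {g : C(E, E)} (hg : IsAffine g) {ι : Type*} (s : Finset ι) (x : E)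
    (r : ι → ℝ) (y z : ι → E) : g (x + ∑ i ∈ s, r i • (y i - z i)) =
      g x + ∑ i ∈ s, r i • (g (y i) - g (z i)) := by
  classical
  induction s using Finset.induction_on with
  | empty => simp
  | insert i s hi ih =>
    rw [Finset.sum_insert hi, Finset.sum_insert hi, add_comm (r i • _), ← add_assoc, hg, ih]
    abel

/-- The map of lifted loops induced by a map. -/
def mapLifted (g : C(E, E)) : C(LiftedLoop E, LiftedLoop E) where
  toFun x := (g.comp x.1, x.2)
  continuous_toFun := ((ContinuousMap.continuous_postcomp g).comp continuous_fst).prodMk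
    continuous_snd

theorem mapLifted_comp (g h : C(E, E)) : mapLifted (g.comp h) = (mapLifted g).comp (mapLifted h) :=
  rfl

theorem mapLifted_cycleLoop {g : C(E, E)} (hg : IsAffine g) (v : ℕ → E) (N : ℕ)
    (x : (ℕ → 𝕀) × ℝ) : mapLifted g (cycleLoop v N x) = cycleLoop (g ∘ v) N x := by
  refine Prod.ext (ContinuousMap.ext fun w => ?_) rfl
  change g (cyclePath v N _ _) = cyclePath (g ∘ v) N _ _
  rw [cyclePath, hg.map_sum, cyclePath]
  refine congrArg₂ (· + ·) rfl (Finset.sum_congr rfl fun i _ => ?_)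
  congr 2
  unfold cyc
  split_ifs <;> rfl

theorem mapChain_cycleChain {g : C(E, E)} (hg : IsAffine g) (N : ℕ) (v : ℕ → E) :
    mapChain (mapLifted g) (cycleChain N v) = cycleChain N (g ∘ v) := by
  have h : ∀ n (φ : C(ℕ → 𝕀, (ℕ → 𝕀) × ℝ)), mapCube (mapLifted g)
      (cubeOf n ((cycleLoop v N).comp φ)) = cubeOf n ((cycleLoop (g ∘ v) N).comp φ) := by
    intro n φ
    change cubeOf n ((mapLifted g).comp ((cycleLoop v N).comp φ)) = _
    congr 1
    exact ContinuousMap.ext fun t => mapLifted_cycleLoop hg v N (φ t)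
  simp only [cycleChain, map_add, map_sum, map_smul, mapChain_single, vertexCube, arcCube, h]

theorem cycleChain_congr {N : ℕ} {v v' : ℕ → E} (hv : ∀ i < N, v i = v' i) :
    cycleChain N v = cycleChain N v' := by
  rcases Nat.eq_zero_or_pos N with rfl | hN
  · simp [cycleChain]
  have h : cycleLoop v N = cycleLoop v' N := ContinuousMap.ext fun x =>
    cycleLoop_congr (fun i hi => hv i (by omega)) (fun _ _ => rfl) rfl
  simp only [cycleChain, vertexCube, arcCube, h]

/-- The correction that closes a path is affine in the path and so commutes with affine maps. -/
theorem projectLoop_mapLifted (f : C(E, Q)) {g : C(E, E)} (hg : IsAffine g) :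
    (projectLoop f).comp (mapLifted g) = projectLoop (f.comp g) := by
  refine ContinuousMap.ext fun x => freeLoop_ext rfl fun w => ?_
  change f (g (x.1 w) - (w : ℝ) • (g (x.1 1) - g (x.1 0))) = f (g (x.1 w - (w : ℝ) • (x.1 1 - x.1 0)))
  rw [sub_eq_add_neg (x.1 w), ← neg_smul, hg, neg_smul, ← sub_eq_add_neg]

/-- Constant lifted loops. -/
def constLifted (E : Type v) [TopologicalSpace E] : C(E, LiftedLoop E) where
  toFun x := (ContinuousMap.const 𝕀 x, 0)
  continuous_toFun := ContinuousMap.continuous_const'.prodMk continuous_const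

theorem mapLifted_constLifted (g : C(E, E)) :
    (mapLifted g).comp (constLifted E) = (constLifted E).comp g := rfl

theorem projectLoop_constLifted (f : C(E, Q)) :
    (projectLoop f).comp (constLifted E) = (constLoop Q).comp f :=
  ContinuousMap.ext fun x => projectLoop_const f x

/-- The contraction of the space of lifted loops. -/
def contractLifted (E : Type v) [AddCommGroup E] [Module ℝ E] [TopologicalSpace E]
    [IsTopologicalAddGroup E] [ContinuousSMul ℝ E] : C(𝕀 × LiftedLoop E, LiftedLoop E) where
  toFun x := ((x.1 : ℝ) • x.2.1, x.1 * x.2.2)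
  continuous_toFun := by fun_prop

theorem contractLifted_one (x : LiftedLoop E) : contractLifted E (1, x) = x := by
  simp [contractLifted]

theorem contractLifted_zero (x : LiftedLoop E) : contractLifted E (0, x) = 0 := by
  simp [contractLifted]

end AffineMaps

/-! ### The standard cubes and the acyclic models argument -/

section Model

/-- The space in which the standard cubes of all dimensions lie. -/
abbrev ModelSpace : Type := ℕ → ℝ

/-- The inclusion of a coordinate hyperplane. -/
def faceMap (k : ℕ) (ε : Bool) : C(ModelSpace, ModelSpace) where
  toFun := insertAt k (if ε then 1 else 0)
  continuous_toFun := by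
    refine continuous_pi fun i => ?_
    unfold insertAt
    split_ifs
    · exact continuous_apply i
    · exact continuous_const
    · exact continuous_const
    · exact (continuous_apply (i - 1) : Continuous fun a : ℕ → ℝ => a (i - 1))

theorem isAffine_faceMap (k : ℕ) (ε : Bool) : IsAffine (faceMap k ε) := by
  intro x y z r
  funext i
  simp only [faceMap, ContinuousMap.coe_mk, insertAt, Pi.add_apply, Pi.smul_apply, Pi.sub_apply]
  split_ifs <;> simp

theorem faceMap_faceMap {j k : ℕ} (h : j ≤ k) (ε η : Bool) :
    (faceMap (k + 1) η).comp (faceMap j ε) = (faceMap j ε).comp (faceMap k η) :=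
  ContinuousMap.ext fun t => insertAt_insertAt h _ _ t

/-- The vertices of the standard cube. -/
def modelVertex (b : ℕ → Bool) : ModelSpace := fun i => if b i then 1 else 0

theorem modelVertex_insertAt (k : ℕ) (ε : Bool) (b : ℕ → Bool) :
    modelVertex (insertAt k ε b) = faceMap k ε (modelVertex b) :=
  comp_insertAt (fun ε : Bool => if ε then (1 : ℝ) else 0) k ε b

/-- The standard cube. -/
def modelCube (n : ℕ) : Cube ModelSpace :=
  ⟨n, fun t i => (extendCoords n t i : ℝ), continuous_pi fun i =>
    continuous_subtype_val.comp ((continuous_apply i).comp (continuous_extendCoords n))⟩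

theorem ev_modelCube (n : ℕ) (t : ℕ → 𝕀) (i : ℕ) :
    ev (modelCube n) t i = if i < n then (t i : ℝ) else 0 := by
  change ((extendCoords n (fun j => t j) i : 𝕀) : ℝ) = _
  unfold extendCoords
  split_ifs <;> rfl

theorem fc_modelCube {n k : ℕ} (hk : k < n + 1) (ε : Bool) :
    fc (modelCube (n + 1)) k (if ε then 1 else 0) = mapCube (faceMap k ε) (modelCube n) := by
  refine cube_ext rfl fun t => funext fun i => ?_
  rw [ev_fc _ hk, ev_mapCube, ev_modelCube]
  simp only [faceMap, ContinuousMap.coe_mk, insertAt, ev_modelCube, ins]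
  split_ifs <;> first | rfl | omega

/-- The extension of a cube to all of the model space. -/
def cubeMap {X : Type u} [TopologicalSpace X] (σ : Cube X) : C(ModelSpace, X) where
  toFun y := ev σ fun i => Set.projIcc 0 1 zero_le_one (y i)
  continuous_toFun := continuous_ev σ fun i => continuous_projIcc.comp (continuous_apply i)

variable {X : Type u} [TopologicalSpace X]

theorem cubeMap_apply (σ : Cube X) (y : ModelSpace) :
    cubeMap σ y = ev σ fun i => Set.projIcc 0 1 zero_le_one (y i) := rfl

theorem mapCube_modelCube (σ : Cube X) : mapCube (cubeMap σ) (modelCube σ.1) = σ := by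
  refine cube_ext rfl fun t => ?_
  rw [ev_mapCube, cubeMap_apply]
  refine ev_congr σ fun i hi => ?_
  rw [ev_modelCube, if_pos hi, Set.projIcc_val]

theorem cubeMap_faceMap (σ : Cube X) {k : ℕ} (hk : k < σ.1) (ε : Bool) :
    (cubeMap σ).comp (faceMap k ε) = cubeMap (fc σ k (if ε then 1 else 0)) := by
  refine ContinuousMap.ext fun y => ?_
  rw [ContinuousMap.comp_apply, cubeMap_apply, cubeMap_apply, ev_fc _ hk]
  refine congrArg _ (funext fun i => ?_)
  simp only [faceMap, ContinuousMap.coe_mk, insertAt, ins]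
  split_ifs <;> simp

theorem cubeMap_modelVertex (σ : Cube X) (b : ℕ → Bool) :
    cubeMap σ (modelVertex b) = ev σ fun i => if b i then 1 else 0 := by
  rw [cubeMap_apply]
  refine congrArg (ev σ) (funext fun i => ?_)
  unfold modelVertex
  split_ifs <;> simp

/-- The alternating sum of the images of a chain under the face maps. -/
def faceSum (n : ℕ) : FreeChains (LiftedLoop ModelSpace) →ₗ[ℤ] FreeChains (LiftedLoop ModelSpace) :=
  ∑ k ∈ Finset.range n, (-1 : ℤ) ^ k •
    (mapChain (mapLifted (faceMap k true)) - mapChain (mapLifted (faceMap k false)))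

theorem faceSum_apply (n : ℕ) (x : FreeChains (LiftedLoop ModelSpace)) : faceSum n x =
    ∑ k ∈ Finset.range n, (-1 : ℤ) ^ k • (mapChain (mapLifted (faceMap k true)) x -
      mapChain (mapLifted (faceMap k false)) x) := by
  rw [faceSum, LinearMap.sum_apply]
  exact Finset.sum_congr rfl fun k _ => by rw [LinearMap.smul_apply, LinearMap.sub_apply]

/-- The face inclusions satisfy the precubical identities under composition, so this is the
cancellation of faces of faces for chains pushed forward along them. -/
theorem faceSum_faceSum (n : ℕ) (x : FreeChains (LiftedLoop ModelSpace)) :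
    faceSum (n + 2) (faceSum (n + 1) x) = 0 := by
  have := sum_faces_faces (C := fun _ => C(ModelSpace, ModelSpace))
      (fun _ k ε φ => φ.comp (faceMap k ε)) (fun _ j k ε η φ h _ => by
        rw [ContinuousMap.comp_assoc, faceMap_faceMap h, ContinuousMap.comp_assoc]) (n := n)
      (fun φ => mapChain (mapLifted φ) x) (ContinuousMap.id _)
  simp only [ContinuousMap.id_comp, mapLifted_comp, mapChain_comp] at this
  rw [← this, faceSum_apply]
  refine Finset.sum_congr rfl fun k _ => ?_
  simp only [faceSum_apply, map_sum, map_smul, map_sub]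

theorem faceSum_boundary (n : ℕ) (x : FreeChains (LiftedLoop ModelSpace)) :
    freeBoundary _ (faceSum n x) = faceSum n (freeBoundary _ x) := by
  simp only [faceSum_apply, map_sum, map_smul, map_sub, mapChain_boundary]

theorem faceSum_relations (n : ℕ) {x : FreeChains (LiftedLoop ModelSpace)}
    (hx : x ∈ relations (LiftedLoop ModelSpace)) :
    faceSum n x ∈ relations (LiftedLoop ModelSpace) := by
  rw [faceSum_apply]
  exact Submodule.sum_mem _ fun k _ => Submodule.smul_mem _ _
    (sub_mem (mapChain_relations _ hx) (mapChain_relations _ hx))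

theorem faceSum_degreePart (n : ℕ) {m : ℕ} {x : FreeChains (LiftedLoop ModelSpace)}
    (hx : x ∈ degreePart _ m) : faceSum n x ∈ degreePart (LiftedLoop ModelSpace) m := by
  rw [faceSum_apply]
  exact Submodule.sum_mem _ fun k _ => Submodule.smul_mem _ _
    (sub_mem (mapChain_degreePart _ hx) (mapChain_degreePart _ hx))

/-- The chain of free loops associated with the triangulated standard cube. -/
def modelChain (n : ℕ) : FreeChains (LiftedLoop ModelSpace) :=
  sumOver cycleChain 0 (triangulate n modelVertex)

theorem modelChain_mem (n : ℕ) : modelChain n ∈ degreePart (LiftedLoop ModelSpace) n :=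
  sumOver_triangulate_mem (fun v => cycleChain_mem (n + 1) v) _ _

theorem sumOver_cycleChain_faceMap (n k : ℕ) (ε : Bool) :
    sumOver cycleChain 0 (triangulate n (modelVertex ∘ insertAt k ε)) =
      mapChain (mapLifted (faceMap k ε)) (modelChain n) := by
  have h : modelVertex ∘ insertAt k ε = faceMap k ε ∘ modelVertex :=
    funext fun b => modelVertex_insertAt k ε b
  rw [h, ← triangulate_map, modelChain]
  refine Eq.symm ?_
  refine sumOver_map (F := cycleChain) (G := cycleChain) (mapChain (mapLifted (faceMap k ε)))
    (faceMap k ε) ?_ ?_ 0 0 _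
  · exact fun _ _ _ h => cycleChain_congr h
  · exact fun N v => mapChain_cycleChain (isAffine_faceMap k ε) N v

/-- The boundary of `cycleChain` is simplicial, that of the triangulation is the sum over the faces
of the cube, and the triangulated faces are affine images of the standard one. -/
theorem mkQ_boundary_modelChain (n : ℕ) : (relations (LiftedLoop ModelSpace)).mkQ
    (freeBoundary _ (modelChain (n + 1))) =
      (relations (LiftedLoop ModelSpace)).mkQ (faceSum (n + 1) (modelChain n)) := by
  have := sumOver_boundary (B := (relations (LiftedLoop ModelSpace)).mkQ ∘ₗ freeBoundary _)
    (π := (relations (LiftedLoop ModelSpace)).mkQ) (F := cycleChain)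
    (fun N v => mkQ_boundary_cycleChain N v) 0 (triangulate (n + 1) modelVertex)
  rw [LinearMap.comp_apply] at this
  rw [modelChain, this, simplexBoundary_triangulate, faceSum_apply]
  simp only [map_sum, map_smul, map_sub, sumOver_cycleChain_faceMap]

/-- The difference of `modelChain` and of the chain of constant loops. -/
def modelDifference (n : ℕ) : FreeChains (LiftedLoop ModelSpace) :=
  modelChain n - mapChain (constLifted _) (Finsupp.single (modelCube n) 1)

theorem modelDifference_mem (n : ℕ) :
    modelDifference n ∈ degreePart (LiftedLoop ModelSpace) n :=
  sub_mem (modelChain_mem n) (mapChain_degreePart _ (single_mem_degreePart rfl))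

theorem mkQ_boundary_modelDifference (n : ℕ) : (relations (LiftedLoop ModelSpace)).mkQ
    (freeBoundary _ (modelDifference (n + 1))) =
      (relations (LiftedLoop ModelSpace)).mkQ (faceSum (n + 1) (modelDifference n)) := by
  rw [modelDifference, modelDifference, map_sub, map_sub, map_sub, map_sub, mkQ_boundary_modelChain,
    mapChain_boundary, freeBoundary_single, cubeBoundary_eq, faceSum_apply (n + 1) (mapChain _ _)]
  refine congrArg₂ (· - ·) rfl (congrArg _ ?_)
  rw [map_sum]
  refine Finset.sum_congr rfl fun k hk => ?_
  rw [Finset.mem_range] at hk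
  have h : ∀ ε : Bool, mapChain (constLifted ModelSpace)
      (Finsupp.single (fc (modelCube (n + 1)) k (if ε then 1 else 0)) 1) =
      mapChain (mapLifted (faceMap k ε)) (mapChain (constLifted ModelSpace)
        (Finsupp.single (modelCube n) 1)) := by
    intro ε
    rw [fc_modelCube hk, ← mapChain_single, ← mapChain_comp, ← mapChain_comp,
      mapLifted_constLifted]
  rw [map_smul, map_sub]
  have h1 := h true
  have h0 := h false
  simp only [if_true, Bool.false_eq_true, if_false] at h1 h0
  rw [h1, h0]

/-- The part of `modelDifference` which is a cycle relative to the faces. -/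
def modelResidue : ℕ → FreeChains (LiftedLoop ModelSpace)
  | 0 => modelDifference 0
  | n + 1 => modelDifference (n + 1) -
      faceSum (n + 1) (coneChain (contractLifted ModelSpace) (modelResidue n))

/-- A chain which bounds `modelDifference` relative to the faces. -/
def modelHomotopy (n : ℕ) : FreeChains (LiftedLoop ModelSpace) :=
  coneChain (contractLifted ModelSpace) (modelResidue n)

theorem modelResidue_mem (n : ℕ) : modelResidue n ∈ degreePart (LiftedLoop ModelSpace) n := by
  induction n with
  | zero => exact modelDifference_mem 0
  | succ n ih =>
    exact sub_mem (modelDifference_mem _) (faceSum_degreePart _ (coneChain_degreePart _ ih))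

/-- Writing D, R and H for difference, residue and homotopy, R (n + 1) is D (n + 1) corrected by the
face sum of H n. It is a cycle modulo the relations, and the contraction bounds it. Hence H
satisfies, modulo the relations, the equation of a natural homotopy on the standard cubes. -/
theorem boundary_modelHomotopy (n : ℕ) :
    freeBoundary _ (modelHomotopy n) - modelResidue n ∈ relations (LiftedLoop ModelSpace) := by
  induction n with
  | zero =>
    -- In degree zero the residue is one loop minus one constant loop, a difference of two points of
    -- the path space.
    have h : modelResidue 0 = Finsupp.single (vertexCube 1 (fun i => [modelVertex fun _ => false].getD i 0) 0) 1 -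
        Finsupp.single (mapCube (constLifted _) (modelCube 0)) 1 := by
      rw [modelResidue, modelDifference, modelChain, triangulate, sumOver_single, mapChain_single,
        cycleChain]
      simp
    rw [modelHomotopy, h, boundary_coneChain_point contractLifted_one contractLifted_zero rfl rfl,
      sub_self]
    exact zero_mem _
  | succ n ih =>
    refine boundary_coneChain_sub_mem contractLifted_one contractLifted_zero
      (modelResidue_mem (n + 1)) ?_
    rw [← Submodule.Quotient.mk_eq_zero, ← Submodule.mkQ_apply, modelResidue, map_sub, map_sub,
      mkQ_boundary_modelDifference, faceSum_boundary, ← map_sub, ← map_sub, Submodule.mkQ_apply,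
      Submodule.Quotient.mk_eq_zero]
    -- Up to the relations D n - ∂ H n is the face sum of H (n - 1), with zero in place of H (-1). A
    -- second face sum kills it.
    have h : modelDifference n - freeBoundary _ (modelHomotopy n) =
        faceSum n (if n = 0 then 0 else modelHomotopy (n - 1)) -
          (freeBoundary _ (modelHomotopy n) - modelResidue n) := by
      cases n with
      | zero => simp [modelResidue]
      | succ n =>
        rw [if_neg (by omega), Nat.add_sub_cancel, modelResidue, ← modelHomotopy]
        abel
    change faceSum (n + 1) (modelDifference n - freeBoundary _ (modelHomotopy n)) ∈ _
    rw [h, map_sub]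
    refine sub_mem ?_ (faceSum_relations _ ih)
    cases n with
    | zero => simp [faceSum]
    | succ n =>
      rw [faceSum_faceSum]
      exact zero_mem _

end Model

/-! ### Naturality and degree of the Hochschild chain -/

section CyclicChains

variable {E : Type v} [AddCommGroup E] [Module ℝ E] [TopologicalSpace E]
  [IsTopologicalAddGroup E] [ContinuousSMul ℝ E] {Q : Type u} [TopologicalSpace Q]
  {q : Q} {f : C(E, Q)}

theorem cyclicChain_congr {N : ℕ} {v v' : ℕ → {x : E // f x = q}} (h : ∀ i < N, v i = v' i) :
    cyclicChain N v = cyclicChain N v' := by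
  have hc : ∀ i < 2 * N, cyc v N i = cyc v' N i := fun i hi => by
    unfold cyc
    split_ifs <;> exact h _ (by omega)
  rw [cyclicChain, cyclicChain]
  refine Finset.sum_congr rfl fun b hb => Finset.sum_congr rfl fun a ha => ?_
  rw [Finset.mem_range] at hb ha
  rw [bars_congr rfl fun l hl => hc (a + l) (by omega),
    segment_congr rfl fun l hl => hc (b + l) (by omega)]

/-- The map of fibres over `q` which covers the identity. -/
def mapFibre (g : C(E, E)) (x : {x : E // f.comp g x = q}) : {x : E // f x = q} := ⟨g x, x.2⟩

/-- An affine map carries the path through given points to the path through their images, so both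
sides trace the same loops in Q. -/
theorem edgeCube_mapFibre {g : C(E, E)} (hg : IsAffine g) (u : ℕ → {x : E // f.comp g x = q})
    (m : ℕ) : edgeCube (mapFibre g ∘ u) m = edgeCube u m := by
  refine cube_ext rfl fun t => ?_
  rw [ev_edgeCube, ev_edgeCube]
  refine Subtype.ext (freeLoop_ext rfl fun w => ?_)
  change f (pathAt _ t m _) = f (g (pathAt _ t m _))
  rw [pathAt, pathAt, hg.map_sum]
  rfl

theorem barSum_mapFibre {g : C(E, E)} (hg : IsAffine g) (n : ℕ) :
    ∀ u : ℕ → {x : E // f.comp g x = q}, barSum n (mapFibre g ∘ u) = barSum n u := by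
  induction n using Nat.strong_induction_on with
  | _ n ih =>
    intro u
    cases n with
    | zero => rw [barSum, barSum]
    | succ n =>
      rw [barSum, barSum]
      refine congrArg _ (Finset.sum_congr rfl fun c _ => ?_)
      rw [edgeCube_mapFibre hg]
      exact congrArg _ (ih (n - c) (by omega) fun l => u (c + 1 + l))

theorem cyclicChain_mapFibre {g : C(E, E)} (hg : IsAffine g) (N : ℕ)
    (v : ℕ → {x : E // f.comp g x = q}) :
    cyclicChain N (mapFibre g ∘ v) = cyclicChain N v := by
  have hc : cyc (mapFibre g ∘ v) N = mapFibre g ∘ cyc v N := funext fun i => by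
    simp only [cyc, Function.comp]
    split_ifs <;> rfl
  rw [cyclicChain, cyclicChain, hc]
  refine Finset.sum_congr rfl fun b _ => Finset.sum_congr rfl fun a _ => ?_
  have h1 : bars (mapFibre g ∘ cyc v N) a b = bars (cyc v N) a b :=
    barSum_mapFibre hg _ fun l => cyc v N (a + l)
  have h2 : segment (mapFibre g ∘ cyc v N) b (N + a) = segment (cyc v N) b (N + a) :=
    edgeCube_mapFibre hg (fun l => cyc v N (b + l)) _
  rw [h1, h2]

/-- The span of the nonempty words of a given degree. -/
def wordPart (q : Q) (n : ℕ) : Submodule ℤ (FreeWords q) :=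
  Submodule.span ℤ {c | ∃ w : List (Cube (BasedLoop q)), w ≠ [] ∧ wordDegree w = n ∧
    c = Finsupp.single w 1}

/-- The span of the words of a given reduced degree. -/
def reducedPart (q : Q) (n : ℕ) : Submodule ℤ (FreeWords q) :=
  Submodule.span ℤ {c | ∃ w : List (Cube (BasedLoop q)), reducedDegree w = n ∧
    c = Finsupp.single w 1}

theorem letter_append_mem (σ : Cube (BasedLoop q)) {n : ℕ} {x : FreeWords q}
    (hx : x ∈ reducedPart q n) :
    appendWords (letter σ) x ∈ reducedPart q (σ.1 + 1 + n) := by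
  have key : reducedPart q n ≤ (reducedPart q (σ.1 + 1 + n)).comap (appendWords (letter σ)) := by
    rw [reducedPart, Submodule.span_le]
    rintro _ ⟨w, hw, rfl⟩
    refine Submodule.subset_span ⟨σ :: w, ?_, append_single _ _⟩
    rw [reducedDegree_cons, hw]
  exact key hx

theorem wordDegree_append_singleton (w : List (Cube (BasedLoop q))) (σ : Cube (BasedLoop q)) :
    wordDegree (w ++ [σ]) = reducedDegree w + σ.1 := by
  have h : reducedDegree w = (w.map fun σ => σ.1).sum + w.length := by
    induction w with
    | nil => rfl
    | cons τ w ih =>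
      rw [reducedDegree_cons, ih, List.map_cons, List.sum_cons, List.length_cons]
      omega
  rw [h, wordDegree, List.map_append, List.sum_append, List.length_append, List.map_singleton,
    List.sum_singleton, List.length_singleton]
  omega

theorem append_letter_mem (σ : Cube (BasedLoop q)) {n : ℕ} {x : FreeWords q}
    (hx : x ∈ reducedPart q n) : appendWords x (letter σ) ∈ wordPart q (n + σ.1) := by
  refine Submodule.span_induction (p := fun x _ => appendWords x (letter σ) ∈ wordPart q (n + σ.1))
    ?_ ?_ ?_ ?_ hx
  · rintro _ ⟨w, hw, rfl⟩
    rw [letter, append_single]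
    exact Submodule.subset_span ⟨w ++ [σ], by simp, by rw [wordDegree_append_singleton, hw], rfl⟩
  · rw [map_zero, LinearMap.zero_apply]
    exact zero_mem _
  · intro x y _ _ hx hy
    rw [map_add, LinearMap.add_apply]
    exact add_mem hx hy
  · intro a x _ hx
    rw [map_smul, LinearMap.smul_apply]
    exact Submodule.smul_mem _ _ hx

theorem barSum_mem (n : ℕ) : ∀ u : ℕ → {x : E // f x = q}, barSum n u ∈ reducedPart q n := by
  induction n using Nat.strong_induction_on with
  | _ n ih =>
    intro u
    cases n with
    | zero =>
      rw [barSum]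
      exact Submodule.subset_span ⟨[], rfl, rfl⟩
    | succ n =>
      rw [barSum]
      refine neg_mem (Submodule.sum_mem _ fun c _ => ?_)
      have := letter_append_mem (edgeCube u (c + 1)) (ih (n - c) (by omega) fun l => u (c + 1 + l))
      rwa [dim_edgeCube, show (c : ℕ) + 1 - 1 + 1 + (n - c) = n + 1 by omega] at this

theorem cyclicChain_mem (N : ℕ) (v : ℕ → {x : E // f x = q}) :
    cyclicChain N v ∈ wordPart q (N - 1) := by
  refine Submodule.sum_mem _ fun b hb => Submodule.sum_mem _ fun a ha => Submodule.smul_mem _ _ ?_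
  rw [Finset.mem_range] at hb ha
  have := append_letter_mem (segment (cyc v N) b (N + a))
    (barSum_mem (b - a) fun l => cyc v N (a + l))
  rwa [dim_segment, show b - a + (N + a - b - 1) = N - 1 by omega] at this

end CyclicChains

/-! ### Hochschild chains of cubes with all vertices at q -/

section CubeWords

variable {Q : Type u} [TopologicalSpace Q] {q : Q}

/-- The Hochschild chain of a map whose values at the vertices of the standard `n`-cube are `q`. -/
def cubeWords (f : C(ModelSpace, Q)) (h : ∀ b, f (modelVertex b) = q) (n : ℕ) : FreeWords q :=
  sumOver (cyclicChain (f := f)) ⟨modelVertex fun _ => false, h _⟩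
    (triangulate n fun b => ⟨modelVertex b, h b⟩)

theorem cubeWords_congr {f f' : C(ModelSpace, Q)} (e : f = f') (h : ∀ b, f (modelVertex b) = q)
    (h' : ∀ b, f' (modelVertex b) = q) (n : ℕ) : cubeWords f h n = cubeWords f' h' n := by
  subst e
  rfl

theorem cubeWords_mem (f : C(ModelSpace, Q)) (h : ∀ b, f (modelVertex b) = q) (n : ℕ) :
    cubeWords f h n ∈ wordPart q n :=
  sumOver_triangulate_mem (fun v => cyclicChain_mem (n + 1) v) _ _

theorem comp_faceMap_modelVertex {f : C(ModelSpace, Q)} (h : ∀ b, f (modelVertex b) = q)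
    (k : ℕ) (ε : Bool) (b : ℕ → Bool) : f.comp (faceMap k ε) (modelVertex b) = q := by
  rw [ContinuousMap.comp_apply, ← modelVertex_insertAt, h]

/-- The simplicial boundary of the triangulated cube consists of its triangulated faces. The chain
of a face in the whole model space equals that of the restricted map by affine naturality. -/
theorem boundary_cubeWords (f : C(ModelSpace, Q)) (h : ∀ b, f (modelVertex b) = q) (n : ℕ) :
    freeWordBoundary q (cubeWords f h (n + 1)) = ∑ k ∈ Finset.range (n + 1), (-1 : ℤ) ^ k •
      (cubeWords (f.comp (faceMap k true)) (comp_faceMap_modelVertex h k true) n -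
        cubeWords (f.comp (faceMap k false)) (comp_faceMap_modelVertex h k false) n) := by
  have h1 := sumOver_boundary (B := freeWordBoundary q) (π := LinearMap.id)
    (F := cyclicChain (f := f)) (fun N v => freeWordBoundary_cyclicChain N v)
    ⟨modelVertex fun _ => false, h _⟩ (triangulate (n + 1) fun b => ⟨modelVertex b, h b⟩)
  have h2 : ∀ (k : ℕ) (ε : Bool), sumOver (cyclicChain (f := f)) ⟨modelVertex fun _ => false, h _⟩
      (triangulate n ((fun b => (⟨modelVertex b, h b⟩ : {x : ModelSpace // f x = q})) ∘
        insertAt k ε)) =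
      cubeWords (f.comp (faceMap k ε)) (comp_faceMap_modelVertex h k ε) n := by
    intro k ε
    -- The vertices of a face are images of those of the standard cube under the face inclusion.
    have h3 : (fun b => (⟨modelVertex b, h b⟩ : {x : ModelSpace // f x = q})) ∘ insertAt k ε =
        mapFibre (faceMap k ε) ∘ fun b => ⟨modelVertex b, comp_faceMap_modelVertex h k ε b⟩ :=
      funext fun b => Subtype.ext (modelVertex_insertAt k ε b)
    rw [h3, ← triangulate_map]
    refine Eq.symm ?_
    refine sumOver_map (F := cyclicChain (f := f.comp (faceMap k ε))) (G := cyclicChain (f := f))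
      LinearMap.id (mapFibre (faceMap k ε)) ?_ ?_ _ _ _
    · exact fun _ _ _ h => cyclicChain_congr h
    · exact fun N v => (cyclicChain_mapFibre (isAffine_faceMap k ε) N v).symm
  rw [cubeWords, h1, simplexBoundary_triangulate, LinearMap.id_apply]
  simp only [map_sum, map_smul, map_sub, h2]

theorem boundary_cubeWords_zero (f : C(ModelSpace, Q)) (h : ∀ b, f (modelVertex b) = q) :
    freeWordBoundary q (cubeWords f h 0) = 0 := by
  rw [cubeWords, triangulate, sumOver_single, freeWordBoundary_cyclicChain]
  simp [cyclicChain]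

theorem mkQ_freeGoodwillie_cubeWords (f : C(ModelSpace, Q)) (h : ∀ b, f (modelVertex b) = q)
    (n : ℕ) : (relations (FreeLoop Q)).mkQ (freeGoodwillie q (cubeWords f h n)) =
      (relations (FreeLoop Q)).mkQ (mapChain (projectLoop f) (modelChain n)) := by
  have h1 : modelChain n = Finsupp.lmapDomain ℤ ℤ id (modelChain n) := by simp
  have key : (relations (FreeLoop Q)).mkQ ∘ₗ freeGoodwillie q ∘ₗ sumOver (cyclicChain (f := f))
      ⟨modelVertex fun _ => false, h _⟩ = (relations (FreeLoop Q)).mkQ ∘ₗ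
        mapChain (projectLoop f) ∘ₗ sumOver cycleChain 0 ∘ₗ
          Finsupp.lmapDomain ℤ ℤ (List.map Subtype.val) := simplex_hom_ext fun l => by
    simp only [LinearMap.comp_apply, sumOver_single, Finsupp.lmapDomain_apply,
      Finsupp.mapDomain_single, List.length_map, mkQ_freeGoodwillie_cyclicChain]
    refine congrArg _ (congrArg _ (cycleChain_congr fun i hi => ?_))
    simp [List.getD_eq_getElem?_getD, List.getElem?_eq_getElem hi]
  have := LinearMap.congr_fun key (triangulate n fun b => ⟨modelVertex b, h b⟩)
  simp only [LinearMap.comp_apply, triangulate_map] at this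
  exact this

end CubeWords

/-! ### The chain map to the cyclic bar complex and its homotopy -/

section ChainMap

variable {Q : Type u} [TopologicalSpace Q] {q : Q}

/-- A choice, compatible with faces, of a cube with all vertices at `q` for each cube. -/
structure VertexRetraction (q : Q) where
  /-- The chosen cube. -/
  toFun : Cube Q → Cube Q
  dim : ∀ σ, (toFun σ).1 = σ.1
  face : ∀ σ k (ε : Bool), k < σ.1 → toFun (fc σ k (if ε then 1 else 0)) = fc (toFun σ) k (if ε then 1 else 0)
  vertex : ∀ σ b, cubeMap (toFun σ) (modelVertex b) = q

namespace VertexRetraction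

variable (d : VertexRetraction q)

/-- The chain map of a vertex retraction. -/
def onChains : FreeChains Q →ₗ[ℤ] FreeChains Q := Finsupp.lmapDomain ℤ ℤ d.toFun

/-- The map of chains on `Q` to the cyclic bar complex. -/
def toWords : FreeChains Q →ₗ[ℤ] FreeWords q :=
  Finsupp.linearCombination ℤ fun σ => cubeWords (cubeMap (d.toFun σ)) (d.vertex σ) σ.1

theorem toWords_single (σ : Cube Q) : d.toWords (Finsupp.single σ 1) =
    cubeWords (cubeMap (d.toFun σ)) (d.vertex σ) σ.1 := by
  rw [toWords, Finsupp.linearCombination_single, one_smul]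

/-- The chain homotopy of `𝒢 ∘ toWords` with the inclusion of the constant loops. -/
def homotopy : FreeChains Q →ₗ[ℤ] FreeChains (FreeLoop Q) :=
  Finsupp.linearCombination ℤ fun σ =>
    mapChain (projectLoop (cubeMap (d.toFun σ))) (modelHomotopy σ.1)

theorem homotopy_single (σ : Cube Q) : d.homotopy (Finsupp.single σ 1) =
    mapChain (projectLoop (cubeMap (d.toFun σ))) (modelHomotopy σ.1) := by
  rw [homotopy, Finsupp.linearCombination_single, one_smul]

theorem toWords_mem {n : ℕ} {x : FreeChains Q} (hx : x ∈ degreePart Q n) :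
    d.toWords x ∈ wordPart q n :=
  map_mem_of_mem_degreePart d.toWords (fun σ hσ => by
    rw [toWords_single, ← hσ]
    exact cubeWords_mem _ _ _) hx

theorem cubeMap_comp_faceMap (σ : Cube Q) {k : ℕ} (hk : k < σ.1) (ε : Bool) :
    (cubeMap (d.toFun σ)).comp (faceMap k ε) =
      cubeMap (d.toFun (fc σ k (if ε then 1 else 0))) := by
  rw [cubeMap_faceMap _ (by rwa [d.dim]), d.face _ _ _ hk]

theorem boundary_toWords (x : FreeChains Q) :
    freeWordBoundary q (d.toWords x) = d.toWords (freeBoundary Q x) := by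
  have : freeWordBoundary q ∘ₗ d.toWords = d.toWords ∘ₗ freeBoundary Q := chain_hom_ext fun σ => by
    simp only [LinearMap.comp_apply, toWords_single, freeBoundary_single, cubeBoundary_eq]
    rcases hn : σ.1 with _ | n
    · rw [boundary_cubeWords_zero]
      simp
    · rw [boundary_cubeWords]
      simp only [map_sum, map_smul, map_sub, toWords_single]
      refine Finset.sum_congr rfl fun k hk => ?_
      rw [Finset.mem_range, ← hn] at hk
      have h1 := d.cubeMap_comp_faceMap σ hk true
      have h0 := d.cubeMap_comp_faceMap σ hk false
      simp only [if_true, Bool.false_eq_true, if_false] at h1 h0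
      have hd : ∀ ε, (fc σ k ε).1 = n := fun ε => by change σ.1 - 1 = n; omega
      rw [hd, hd, cubeWords_congr h1 _ (d.vertex _), cubeWords_congr h0 _ (d.vertex _)]
  exact LinearMap.congr_fun this x

theorem homotopy_mem {n : ℕ} {x : FreeChains Q} (hx : x ∈ degreePart Q n) :
    d.homotopy x ∈ degreePart (FreeLoop Q) (n + 1) :=
  map_mem_of_mem_degreePart d.homotopy (fun σ hσ => by
    rw [homotopy_single, ← hσ]
    exact mapChain_degreePart _ (coneChain_degreePart _ (modelResidue_mem _))) hx

/-- Push the model homotopy forward along each cube. The boundary of H gives the residue, whose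
difference part yields 𝒢 ∘ W minus the constant loops. Its face sum is the homotopy of the boundary,
because the retraction commutes with faces. -/
theorem mkQ_boundary_homotopy (x : FreeChains Q) :
    (relations (FreeLoop Q)).mkQ (freeBoundary _ (d.homotopy x)) =
      (relations (FreeLoop Q)).mkQ (freeGoodwillie q (d.toWords x)) -
      (relations (FreeLoop Q)).mkQ (push (constLoop Q) (d.onChains x)) -
      (relations (FreeLoop Q)).mkQ (d.homotopy (freeBoundary Q x)) := by
  have key : (relations (FreeLoop Q)).mkQ ∘ₗ freeBoundary _ ∘ₗ d.homotopy =
      (relations (FreeLoop Q)).mkQ ∘ₗ freeGoodwillie q ∘ₗ d.toWords -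
      (relations (FreeLoop Q)).mkQ ∘ₗ push (constLoop Q) ∘ₗ d.onChains -
      (relations (FreeLoop Q)).mkQ ∘ₗ d.homotopy ∘ₗ freeBoundary Q := chain_hom_ext fun σ => by
    simp only [LinearMap.comp_apply, LinearMap.sub_apply, homotopy_single, toWords_single,
      mkQ_freeGoodwillie_cubeWords, freeBoundary_single]
    have h1 : (relations (FreeLoop Q)).mkQ (freeBoundary _ (mapChain
        (projectLoop (cubeMap (d.toFun σ))) (modelHomotopy σ.1))) =
        (relations (FreeLoop Q)).mkQ (mapChain (projectLoop (cubeMap (d.toFun σ)))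
          (modelResidue σ.1)) := by
      rw [mapChain_boundary, ← sub_eq_zero, ← map_sub, ← map_sub, Submodule.mkQ_apply,
        Submodule.Quotient.mk_eq_zero]
      exact mapChain_relations _ (boundary_modelHomotopy σ.1)
    have h2 : push (constLoop Q) (d.onChains (Finsupp.single σ 1)) =
        mapChain (projectLoop (cubeMap (d.toFun σ)))
          (mapChain (constLifted _) (Finsupp.single (modelCube σ.1) 1)) := by
      rw [← mapChain_comp, projectLoop_constLifted, mapChain_comp, mapChain_single, ← d.dim σ,
        mapCube_modelCube, onChains, Finsupp.lmapDomain_apply, Finsupp.mapDomain_single]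
      rfl
    -- For dimension 0 the truncated index is harmless, since the face sum is then empty.
    have h3 : modelResidue σ.1 = modelDifference σ.1 -
        faceSum σ.1 (modelHomotopy (σ.1 - 1)) := by
      rcases σ.1 with _ | n
      · rw [modelResidue, faceSum_apply, Finset.range_zero, Finset.sum_empty, sub_zero]
      · rfl
    have h4 : mapChain (projectLoop (cubeMap (d.toFun σ)))
        (faceSum σ.1 (modelHomotopy (σ.1 - 1))) = d.homotopy (cubeBoundary σ) := by
      rw [faceSum_apply, cubeBoundary_eq]
      simp only [map_sum, map_smul, map_sub, homotopy_single]
      refine Finset.sum_congr rfl fun k hk => ?_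
      rw [Finset.mem_range] at hk
      have h1 := d.cubeMap_comp_faceMap σ hk true
      have h0 := d.cubeMap_comp_faceMap σ hk false
      simp only [if_true, Bool.false_eq_true, if_false] at h1 h0
      rw [← mapChain_comp, ← mapChain_comp, projectLoop_mapLifted _ (isAffine_faceMap k true),
        projectLoop_mapLifted _ (isAffine_faceMap k false), h1, h0]
      rfl
    rw [h1, h2, h3, map_sub, map_sub, h4, modelDifference, map_sub, map_sub]
  exact LinearMap.congr_fun key x

end VertexRetraction

end ChainMap

/-! ### Stretching of the unit cube beyond its boundary -/

section Stretch

/-- A family of maps of the interval which begins with the identity and at the time `s` maps the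
interval to `[-s, 1 + s]`. -/
def stretch (s t : 𝕀) : ℝ := (1 + 2 * s) * t - s

/-- The projection of `stretch` to the interval. -/
def stretchProj (s t : 𝕀) : 𝕀 := Set.projIcc 0 1 zero_le_one (stretch s t)

/-- The distance of `stretch` from the interval. -/
def gap (s t : 𝕀) : 𝕀 := Set.projIcc 0 1 zero_le_one |stretch s t - stretchProj s t|

theorem continuous_stretch {T : Type*} [TopologicalSpace T] {s t : T → 𝕀} (hs : Continuous s)
    (ht : Continuous t) : Continuous fun x => stretch (s x) (t x) := by
  unfold stretch
  fun_prop

theorem continuous_stretchProj {T : Type*} [TopologicalSpace T] {s t : T → 𝕀} (hs : Continuous s)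
    (ht : Continuous t) : Continuous fun x => stretchProj (s x) (t x) :=
  continuous_projIcc.comp (continuous_stretch hs ht)

theorem continuous_gap {T : Type*} [TopologicalSpace T] {s t : T → 𝕀} (hs : Continuous s)
    (ht : Continuous t) : Continuous fun x => gap (s x) (t x) :=
  continuous_projIcc.comp ((continuous_stretch hs ht).sub
    (continuous_subtype_val.comp (continuous_stretchProj hs ht))).abs

theorem stretchProj_of_end (s : 𝕀) {ε : 𝕀} (h : ε = 0 ∨ ε = 1) : stretchProj s ε = ε := by
  rcases h with rfl | rfl
  · exact Set.projIcc_of_le_left _ (by simp [stretch, unitInterval.nonneg s])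
  · exact Set.projIcc_of_right_le _ (by simp [stretch]; linarith [s.2.1])

theorem gap_of_end (s : 𝕀) {ε : 𝕀} (h : ε = 0 ∨ ε = 1) : gap s ε = s := by
  have h1 : |stretch s ε - stretchProj s ε| = s := by
    rw [stretchProj_of_end s h]
    rcases h with rfl | rfl
    · simp [stretch, unitInterval.nonneg s]
    · simp only [stretch, Set.Icc.coe_one]
      rw [show (1 + 2 * (s : ℝ)) * 1 - s - 1 = s by ring, abs_of_nonneg s.2.1]
  rw [gap, h1, Set.projIcc_val]

theorem stretchProj_zero (t : 𝕀) : stretchProj 0 t = t := by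
  simp [stretchProj, stretch, Set.projIcc_val]

/-- A point inside the interval is its own projection, so a nonzero gap forces the projection onto
an end. -/
theorem stretchProj_eq_of_gap_ne {s t : 𝕀} (h : gap s t ≠ 0) :
    stretchProj s t = 0 ∨ stretchProj s t = 1 := by
  by_contra! hc
  refine h ?_
  have h0 : 0 < stretch s t := by
    by_contra! h0
    exact hc.1 (Set.projIcc_of_le_left _ h0)
  have h1 : stretch s t < 1 := by
    by_contra! h1
    exact hc.2 (Set.projIcc_of_right_le _ h1)
  have h2 : (stretchProj s t : ℝ) = stretch s t := by
    rw [stretchProj, Set.projIcc_of_mem _ ⟨h0.le, h1.le⟩]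
  rw [gap, h2, sub_self, abs_zero, Set.projIcc_of_le_left _ le_rfl]
  rfl

/-- The distance of the stretched point from the complement of the corners of the cube. -/
def depth (n : ℕ) (s : 𝕀) (t : ℕ → 𝕀) : 𝕀 := s ⊓ (Finset.range n).inf fun i => gap s (t i)

theorem le_depth_iff {n : ℕ} {s : 𝕀} {t : ℕ → 𝕀} {x : 𝕀} :
    x ≤ depth n s t ↔ x ≤ s ∧ ∀ i < n, x ≤ gap s (t i) := by
  simp [depth]

/-- At an end of the interval the gap is s itself. As s takes part in the infimum, such a coordinate
imposes no further condition; this makes the deformation compatible with faces. -/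
theorem depth_ins {n k : ℕ} (hk : k < n) (s : 𝕀) {ε : 𝕀} (h : ε = 0 ∨ ε = 1) (t : ℕ → 𝕀) :
    depth n s (ins k ε t) = depth (n - 1) s t := by
  refine eq_of_forall_le_iff fun x => ?_
  rw [le_depth_iff, le_depth_iff]
  refine and_congr_right fun hx => ⟨fun H i hi => ?_, fun H i hi => ?_⟩
  · have h1 := H i (by omega)
    have h2 := H (i + 1) (by omega)
    unfold ins at h1 h2
    by_cases hik : i < k
    · rwa [if_pos hik] at h1
    · rwa [if_neg (by omega), if_neg (by omega), Nat.add_sub_cancel] at h2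
  · unfold ins
    split_ifs
    · exact H i (by omega)
    · rwa [gap_of_end s h]
    · exact H (i - 1) (by omega)

end Stretch

/-! ### Moving the vertices of all cubes to q -/

section Deformation

variable {Q : Type u} [TopologicalSpace Q] {q : Q} (c : ∀ x : Q, Path x q)

/-- The deformation of a cube which moves its vertices along the given paths. -/
def deformAt (σ : Cube Q) (t : ℕ → 𝕀) : Q :=
  c (ev σ fun i => stretchProj (t σ.1) (t i)) (depth σ.1 (t σ.1) t)

theorem deformAt_congr (σ : Cube Q) {s t : ℕ → 𝕀} (h : ∀ i < σ.1 + 1, s i = t i) :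
    deformAt c σ s = deformAt c σ t := by
  have h1 : depth σ.1 (s σ.1) s = depth σ.1 (t σ.1) t := by
    refine eq_of_forall_le_iff fun x => ?_
    rw [le_depth_iff, le_depth_iff, h _ (Nat.lt_succ_self _)]
    exact and_congr_right fun _ => forall₂_congr fun i hi => by rw [h i (by omega)]
  have h2 : (ev σ fun i => stretchProj (s σ.1) (s i)) =
      ev σ fun i => stretchProj (t σ.1) (t i) := ev_congr σ fun i hi => by
    rw [h i (by omega), h _ (Nat.lt_succ_self _)]
  rw [deformAt, deformAt, h1, h2]

/-- The paths `c x` need not depend continuously on x. Where the depth is positive, all coordinates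
lie beyond the cube and project to a fixed vertex, so only the path of one vertex is used at a time.
Elsewhere every path is at its source. -/
theorem continuous_deformAt (σ : Cube Q) : Continuous (deformAt c σ) := by
  have hp : ∀ i, Continuous fun t : ℕ → 𝕀 => stretchProj (t σ.1) (t i) := fun i =>
    continuous_stretchProj (continuous_apply _) (continuous_apply _)
  have hd : Continuous fun t : ℕ → 𝕀 => depth σ.1 (t σ.1) t :=
    (continuous_apply _).inf (Continuous.finset_inf_apply fun i _ =>
      continuous_gap (continuous_apply _) (continuous_apply _))
  -- A finite closed cover: the set of depth zero, and for each corner of the cube the set that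
  -- projects to it.
  let A : Option (Fin σ.1 → Bool) → Set (ℕ → 𝕀)
    | none => {t | depth σ.1 (t σ.1) t = 0}
    | some b => {t | ∀ i : Fin σ.1, stretchProj (t σ.1) (t i) = if b i then 1 else 0}
  refine LocallyFinite.continuous (f := A) (locallyFinite_of_finite A) ?_ ?_ ?_
  · refine Set.eq_univ_of_forall fun t => Set.mem_iUnion.2 ?_
    by_cases h : depth σ.1 (t σ.1) t = 0
    · exact ⟨none, h⟩
    · have h1 : ∀ i : Fin σ.1, stretchProj (t σ.1) (t i) = 0 ∨ stretchProj (t σ.1) (t i) = 1 :=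
        fun i => stretchProj_eq_of_gap_ne fun h0 =>
          h (le_antisymm (h0 ▸ (le_depth_iff.1 le_rfl).2 i i.2) bot_le)
      refine ⟨some fun i => decide (stretchProj (t σ.1) (t i) = 1), fun i => ?_⟩
      rcases h1 i with h | h <;> simp [h]
  · rintro (_ | b)
    · exact isClosed_eq hd continuous_const
    · simp only [A, Set.ofPred_forall]
      exact isClosed_iInter fun i => isClosed_eq (hp i) continuous_const
  · rintro (_ | b)
    · refine ContinuousOn.congr (continuous_ev σ hp).continuousOn fun t ht => ?_
      have ht : depth σ.1 (t σ.1) t = 0 := ht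
      rw [deformAt, ht, Path.source]
    · let x := σ.2 fun i => if b i then 1 else 0
      refine ContinuousOn.congr ((c x).continuous.comp hd).continuousOn fun t ht => ?_
      have h1 : (ev σ fun i => stretchProj (t σ.1) (t i)) = x :=
        congrArg σ.2 (funext fun i => ht i)
      rw [deformAt, h1]
      rfl

/-- The deformation of a cube as a cube, whose last coordinate is the time. -/
def deformCube (σ : Cube Q) : Cube Q := cubeOf (σ.1 + 1) ⟨deformAt c σ, continuous_deformAt c σ⟩

theorem ev_deformCube (σ : Cube Q) (t : ℕ → 𝕀) : ev (deformCube c σ) t = deformAt c σ t :=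
  ev_cubeOf _ _ (fun _ _ h => deformAt_congr c σ h) t

/-- The ends 0 and 1 are fixed by the projection and do not affect the depth, so the deformation of
a face is the face of the deformation. -/
theorem fc_deformCube (σ : Cube Q) {k : ℕ} (hk : k < σ.1) {ε : 𝕀} (h : ε = 0 ∨ ε = 1) :
    fc (deformCube c σ) k ε = deformCube c (fc σ k ε) := by
  refine cube_ext (by change σ.1 + 1 - 1 = σ.1 - 1 + 1; omega) fun t => ?_
  rw [ev_fc _ (by change k < σ.1 + 1; omega), ev_deformCube, ev_deformCube, deformAt, deformAt,
    show (fc σ k ε).1 = σ.1 - 1 from rfl, ev_fc _ hk]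
  have h1 : ins k ε t σ.1 = t (σ.1 - 1) := by
    unfold ins
    rw [if_neg (by omega), if_neg (by omega)]
  have h2 : (fun i => stretchProj (t (σ.1 - 1)) (ins k ε t i)) =
      ins k ε fun i => stretchProj (t (σ.1 - 1)) (t i) := funext fun i => by
    unfold ins
    split_ifs
    · rfl
    · exact stretchProj_of_end _ h
    · rfl
  rw [h1, h2, depth_ins hk _ h]

theorem fc_deformCube_zero (σ : Cube Q) : fc (deformCube c σ) σ.1 0 = σ := by
  refine cube_ext rfl fun t => ?_
  have h1 : ins σ.1 0 t σ.1 = 0 := by simp [ins]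
  have h2 : depth σ.1 0 (ins σ.1 0 t) = 0 := le_antisymm inf_le_left bot_le
  rw [ev_fc _ (Nat.lt_succ_self _), ev_deformCube, deformAt, h1, h2, Path.source]
  refine ev_congr σ fun i hi => ?_
  rw [stretchProj_zero, ins, if_pos hi]

/-- The deformation of cubes, at the final time. -/
def vertexRetraction : VertexRetraction q where
  toFun σ := fc (deformCube c σ) σ.1 1
  dim _ := rfl
  face σ k ε hk := by
    have hε : (if ε then 1 else 0 : 𝕀) = 0 ∨ (if ε then 1 else 0 : 𝕀) = 1 := by
      cases ε <;> simp
    generalize (if ε then 1 else 0 : 𝕀) = ε at hε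
    rw [← fc_deformCube c σ hk hε]
    refine cube_ext rfl fun t => ?_
    have h1 : (fc σ k ε).1 = σ.1 - 1 := rfl
    have h2 : (deformCube c σ).1 = σ.1 + 1 := rfl
    rw [h1, ev_fc _ (by change _ < σ.1 + 1 - 1; omega), ev_fc _ (by omega),
      ev_fc _ (by change k < σ.1 + 1 - 1; omega), ev_fc _ (by omega)]
    refine congrArg _ (funext fun i => ?_)
    simp only [ins]
    split_ifs <;> first | rfl | omega
  vertex σ b := by
    rw [cubeMap_modelVertex, ev_fc _ (Nat.lt_succ_self _), ev_deformCube, deformAt]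
    have h1 : ins σ.1 1 (fun i => if b i then 1 else 0 : ℕ → 𝕀) σ.1 = 1 := by simp [ins]
    have h2 : depth σ.1 1 (ins σ.1 1 fun i => if b i then 1 else 0) = 1 := by
      refine le_antisymm le_top (le_depth_iff.2 ⟨le_rfl, fun i hi => ?_⟩)
      rw [ins, if_pos hi, gap_of_end]
      split_ifs <;> simp
    rw [h1, h2, Path.target]

/-- The chain homotopy given by the deformation of cubes. -/
def deformChain : FreeChains Q →ₗ[ℤ] FreeChains Q := Finsupp.lmapDomain ℤ ℤ (deformCube c)

theorem deformChain_single (σ : Cube Q) :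
    deformChain c (Finsupp.single σ 1) = Finsupp.single (deformCube c σ) 1 := by
  simp [deformChain]

theorem deformChain_mem {n : ℕ} {x : FreeChains Q} (hx : x ∈ degreePart Q n) :
    deformChain c x ∈ degreePart Q (n + 1) :=
  map_mem_of_mem_degreePart (deformChain c) (fun σ hσ => by
    rw [deformChain_single, ← hσ]
    exact single_mem_degreePart rfl) hx

/-- The time is the last coordinate, of number n, so its two ends enter with the sign (-1)^n, while
the faces of the cube keep their signs. -/
theorem boundary_deformChain {n : ℕ} {x : FreeChains Q} (hx : x ∈ degreePart Q n) :
    freeBoundary Q (deformChain c x) = deformChain c (freeBoundary Q x) +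
      (-1 : ℤ) ^ n • ((vertexRetraction c).onChains x - x) := by
  have key : ∀ σ : Cube Q, σ.1 = n → freeBoundary Q (deformChain c (Finsupp.single σ 1)) =
      deformChain c (freeBoundary Q (Finsupp.single σ 1)) +
      (-1 : ℤ) ^ n • ((vertexRetraction c).onChains (Finsupp.single σ 1) - Finsupp.single σ 1) := by
    rintro σ rfl
    rw [deformChain_single, freeBoundary_single, freeBoundary_single, cubeBoundary_eq,
      cubeBoundary_eq, show (deformCube c σ).1 = σ.1 + 1 from rfl, Finset.sum_range_succ,
      fc_deformCube_zero, map_sum]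
    refine congrArg₂ (· + ·) (Finset.sum_congr rfl fun k hk => ?_) ?_
    · rw [Finset.mem_range] at hk
      rw [map_smul, map_sub, deformChain_single, deformChain_single,
        fc_deformCube c σ hk (Or.inl rfl), fc_deformCube c σ hk (Or.inr rfl)]
    · rw [VertexRetraction.onChains, Finsupp.lmapDomain_apply, Finsupp.mapDomain_single]
      rfl
  have h := map_mem_of_mem_degreePart (S := ⊥) (freeBoundary Q ∘ₗ deformChain c -
    deformChain c ∘ₗ freeBoundary Q - (-1 : ℤ) ^ n • ((vertexRetraction c).onChains -
      LinearMap.id)) (fun σ hσ => by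
    rw [Submodule.mem_bot]
    simp only [LinearMap.sub_apply, LinearMap.comp_apply, LinearMap.smul_apply, LinearMap.id_apply,
      key σ hσ]
    abel) hx
  rw [Submodule.mem_bot] at h
  simp only [LinearMap.sub_apply, LinearMap.comp_apply, LinearMap.smul_apply,
    LinearMap.id_apply] at h
  rw [sub_sub, sub_eq_zero] at h
  exact h

end Deformation

/-! ### Splitting off the degenerate cubes -/

section Normalization

variable {X : Type u} [TopologicalSpace X]

/-- The cube whose `k`-th coordinate is replaced by `0`. -/
def freeze (k : ℕ) (σ : Cube X) : Cube X :=
  ⟨σ.1, fun t => ev σ (Function.update (extendCoords σ.1 t) k 0), continuous_ev σ fun i => by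
    by_cases h : i = k
    · subst h
      simpa using continuous_const
    · simp only [Function.update_of_ne h]
      exact (continuous_apply i).comp (continuous_extendCoords σ.1)⟩

theorem ev_freeze (k : ℕ) (σ : Cube X) (t : ℕ → 𝕀) :
    ev (freeze k σ) t = ev σ (Function.update t k 0) := by
  refine ev_congr σ fun i hi => ?_
  by_cases h : i = k
  · subst h
    simp
  · rw [Function.update_of_ne h, Function.update_of_ne h]
    exact extendCoords_apply (fun j : Fin σ.1 => t j) hi

theorem freeze_freeze (j k : ℕ) (σ : Cube X) : freeze j (freeze k σ) = freeze k (freeze j σ) := by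
  refine cube_ext rfl fun t => ?_
  rw [ev_freeze, ev_freeze, ev_freeze, ev_freeze]
  rcases eq_or_ne j k with rfl | h
  · rfl
  · rw [Function.update_comm h]

/-- The linear extension of `freeze`. -/
def freezeChain (k : ℕ) : FreeChains X →ₗ[ℤ] FreeChains X := Finsupp.lmapDomain ℤ ℤ (freeze k)

theorem freezeChain_single (k : ℕ) (σ : Cube X) :
    freezeChain k (Finsupp.single σ 1) = Finsupp.single (freeze k σ) 1 := by
  simp [freezeChain]

theorem freezeChain_freezeChain (j k : ℕ) (x : FreeChains X) :
    freezeChain j (freezeChain k x) = freezeChain k (freezeChain j x) := by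
  have : (freezeChain j ∘ₗ freezeChain k : FreeChains X →ₗ[ℤ] _) =
      freezeChain k ∘ₗ freezeChain j := chain_hom_ext fun σ => by
    simp only [LinearMap.comp_apply, freezeChain_single, freeze_freeze j k]
  exact LinearMap.congr_fun this x

theorem freezeChain_mem (k : ℕ) {n : ℕ} {x : FreeChains X} (hx : x ∈ degreePart X n) :
    freezeChain k x ∈ degreePart X n :=
  map_mem_of_mem_degreePart (freezeChain k) (fun σ hσ => by
    rw [freezeChain_single]
    exact single_mem_degreePart hσ) hx

/-- The product of the operators `1 - freezeChain k` for `k < m`. -/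
def normOp : ℕ → FreeChains X →ₗ[ℤ] FreeChains X
  | 0 => LinearMap.id
  | m + 1 => normOp m ∘ₗ (LinearMap.id - freezeChain m)

theorem normOp_succ (m : ℕ) (x : FreeChains X) :
    normOp (m + 1) x = normOp m (x - freezeChain m x) := rfl

theorem normOp_mem (m : ℕ) {n : ℕ} {x : FreeChains X} (hx : x ∈ degreePart X n) :
    normOp m x ∈ degreePart X n := by
  induction m generalizing x with
  | zero => exact hx
  | succ m ih => exact ih (sub_mem hx (freezeChain_mem m hx))

/-- The factors commute, and one of them annihilates x. -/
theorem normOp_eq_zero {k m : ℕ} (hk : k < m) {x : FreeChains X} (hx : freezeChain k x = x) :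
    normOp m x = 0 := by
  induction m generalizing x with
  | zero => omega
  | succ m ih =>
    rw [normOp_succ]
    rcases Nat.lt_succ_iff_lt_or_eq.1 hk with h | rfl
    · exact ih h (by rw [map_sub, freezeChain_freezeChain, hx])
    · rw [hx, sub_self, map_zero]

theorem normOp_sub_mem {m n : ℕ} (hm : m ≤ n) {x : FreeChains X} (hx : x ∈ degreePart X n) :
    normOp m x - x ∈ degenerate X := by
  induction m generalizing x with
  | zero =>
    rw [normOp, LinearMap.id_apply, sub_self]
    exact zero_mem _
  | succ m ih =>
    have h1 : freezeChain m x ∈ degenerate X :=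
      map_mem_of_mem_degreePart (freezeChain m) (fun σ hσ => by
        rw [freezeChain_single]
        refine single_mem_degenerate ((isDegenerate_iff _).2 ⟨m, ?_, fun t y => ?_⟩)
        · change m < σ.1
          omega
        · rw [ev_freeze, ev_freeze, Function.update_idem]) hx
    have h2 := ih (by omega) (sub_mem hx (freezeChain_mem m hx))
    rw [normOp_succ, show normOp m (x - freezeChain m x) - x =
      normOp m (x - freezeChain m x) - (x - freezeChain m x) - freezeChain m x by abel]
    exact sub_mem h2 h1

/-- The difference of the two faces in a coordinate direction. -/
def faceDiff (j : ℕ) : FreeChains X →ₗ[ℤ] FreeChains X :=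
  Finsupp.lmapDomain ℤ ℤ (fun σ => fc σ j 1) - Finsupp.lmapDomain ℤ ℤ fun σ => fc σ j 0

theorem faceDiff_single (j : ℕ) (σ : Cube X) : faceDiff j (Finsupp.single σ 1) =
    Finsupp.single (fc σ j 1) 1 - Finsupp.single (fc σ j 0) 1 := by
  simp [faceDiff]

/-- A cube that does not depend on a coordinate has equal faces in that direction. -/
theorem faceDiff_freezeChain_self {j n : ℕ} (hj : j < n) {x : FreeChains X}
    (hx : x ∈ degreePart X n) : faceDiff j (freezeChain j x) = 0 := by
  have := map_mem_of_mem_degreePart (S := ⊥) (faceDiff j ∘ₗ freezeChain j) (fun σ hσ => by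
    have h : fc (freeze j σ) j 1 = fc (freeze j σ) j 0 := cube_ext rfl fun t => by
      have hj' : j < (freeze j σ).1 := by change j < σ.1; omega
      rw [ev_fc _ hj', ev_fc _ hj', ev_freeze, ev_freeze]
      refine congrArg _ (funext fun i => ?_)
      by_cases hi : i = j
      · subst hi
        simp
      · simp [hi, ins]
    rw [Submodule.mem_bot, LinearMap.comp_apply, freezeChain_single, faceDiff_single, h,
      sub_self]) hx
  rwa [Submodule.mem_bot, LinearMap.comp_apply] at this

theorem fc_freeze {j k k' : ℕ} (h : k < j ∧ k' = k ∨ j < k ∧ k' = k - 1) {σ : Cube X}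
    (hj : j < σ.1) (ε : 𝕀) : fc (freeze k σ) j ε = freeze k' (fc σ j ε) := by
  refine cube_ext rfl fun t => ?_
  rw [ev_fc _ (by change j < σ.1; omega), ev_freeze, ev_freeze, ev_fc _ hj]
  refine congrArg _ (funext fun i => ?_)
  simp only [ins, Function.update_apply]
  split_ifs <;> first | rfl | omega

theorem faceDiff_freezeChain {j k k' n : ℕ} (h : k < j ∧ k' = k ∨ j < k ∧ k' = k - 1) (hj : j < n)
    {x : FreeChains X} (hx : x ∈ degreePart X n) :
    faceDiff j (freezeChain k x) = freezeChain k' (faceDiff j x) := by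
  have := map_mem_of_mem_degreePart (S := ⊥)
    (faceDiff j ∘ₗ freezeChain k - freezeChain k' ∘ₗ faceDiff j) (fun σ hσ => by
    rw [Submodule.mem_bot, LinearMap.sub_apply, LinearMap.comp_apply, LinearMap.comp_apply,
      freezeChain_single, faceDiff_single, faceDiff_single, map_sub, freezeChain_single,
      freezeChain_single, fc_freeze h (by omega), fc_freeze h (by omega), sub_self]) hx
  rwa [Submodule.mem_bot, LinearMap.sub_apply, sub_eq_zero] at this

theorem faceDiff_normOp_le {j m n : ℕ} (hm : m ≤ j) (hj : j < n) {x : FreeChains X}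
    (hx : x ∈ degreePart X n) : faceDiff j (normOp m x) = normOp m (faceDiff j x) := by
  induction m generalizing x with
  | zero => rfl
  | succ m ih =>
    rw [normOp_succ, normOp_succ, ih (by omega) (sub_mem hx (freezeChain_mem m hx)), map_sub,
      faceDiff_freezeChain (Or.inl ⟨by omega, rfl⟩) hj hx]

/-- Under the difference of the faces in direction j, the factor with index j becomes the identity,
smaller indices stay and larger ones drop by one. One factor is lost, just as one dimension is. -/
theorem faceDiff_normOp_succ {j m n : ℕ} (hm : j ≤ m) (hj : j < n) {x : FreeChains X}
    (hx : x ∈ degreePart X n) : faceDiff j (normOp (m + 1) x) = normOp m (faceDiff j x) := by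
  induction m, hm using Nat.le_induction generalizing x with
  | base =>
    rw [normOp_succ, faceDiff_normOp_le le_rfl hj (sub_mem hx (freezeChain_mem j hx)), map_sub,
      faceDiff_freezeChain_self hj hx, sub_zero]
  | succ m hm ih =>
    rw [normOp_succ, ih (sub_mem hx (freezeChain_mem _ hx)), map_sub,
      faceDiff_freezeChain (Or.inr ⟨by omega, (Nat.add_sub_cancel m 1).symm⟩) hj hx, normOp_succ]

/-- The projection of the cubical chains to a complement of the degenerate ones. -/
def normalize : FreeChains X →ₗ[ℤ] FreeChains X :=
  Finsupp.linearCombination ℤ fun σ => normOp σ.1 (Finsupp.single σ 1)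

theorem normalize_of_mem {n : ℕ} {x : FreeChains X} (hx : x ∈ degreePart X n) :
    normalize x = normOp n x := by
  have := map_mem_of_mem_degreePart (S := ⊥) (normalize - normOp n) (fun σ hσ => by
    rw [Submodule.mem_bot, LinearMap.sub_apply, normalize, Finsupp.linearCombination_single,
      one_smul, hσ, sub_self]) hx
  rwa [Submodule.mem_bot, LinearMap.sub_apply, sub_eq_zero] at this

/-- A cube that is independent of the coordinate k is fixed by freezing it, hence is killed by the
factor with index k. -/
theorem normalize_degenerate {x : FreeChains X} (hx : x ∈ degenerate X) : normalize x = 0 := by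
  have h : degenerate X ≤ LinearMap.ker normalize := by
    rw [degenerate, Submodule.span_le]
    rintro _ ⟨σ, hσ, rfl⟩
    obtain ⟨k, hk, h⟩ := (isDegenerate_iff σ).1 hσ
    rw [SetLike.mem_coe, LinearMap.mem_ker, normalize_of_mem (single_mem_degreePart rfl)]
    refine normOp_eq_zero hk ?_
    rw [freezeChain_single]
    refine congrArg (fun τ => Finsupp.single τ 1) (cube_ext rfl fun t => ?_)
    rw [ev_freeze, h]
  exact h hx

theorem freeBoundary_eq_sum {n : ℕ} {x : FreeChains X} (hx : x ∈ degreePart X n) :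
    freeBoundary X x = ∑ j ∈ Finset.range n, (-1 : ℤ) ^ j • faceDiff j x := by
  have := map_mem_of_mem_degreePart (S := ⊥)
    (freeBoundary X - ∑ j ∈ Finset.range n, (-1 : ℤ) ^ j • faceDiff j) (fun σ hσ => by
    rw [Submodule.mem_bot, LinearMap.sub_apply, freeBoundary_single, cubeBoundary_eq, hσ,
      LinearMap.sum_apply, sub_eq_zero]
    exact Finset.sum_congr rfl fun j _ => by rw [LinearMap.smul_apply, faceDiff_single]) hx
  rw [Submodule.mem_bot, LinearMap.sub_apply, sub_eq_zero, LinearMap.sum_apply] at this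
  rw [this]
  exact Finset.sum_congr rfl fun j _ => LinearMap.smul_apply _ _ _

theorem boundary_normalize {n : ℕ} {x : FreeChains X} (hx : x ∈ degreePart X n) :
    freeBoundary X (normalize x) = normalize (freeBoundary X x) := by
  rcases n with _ | n
  · rw [normalize_of_mem hx, boundary_degreePart_zero (normOp_mem 0 hx),
      boundary_degreePart_zero hx, map_zero]
  · rw [normalize_of_mem hx, normalize_of_mem (boundary_degreePart hx),
      freeBoundary_eq_sum (normOp_mem _ hx), freeBoundary_eq_sum hx, map_sum]
    refine Finset.sum_congr rfl fun j hj => ?_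
    rw [Finset.mem_range] at hj
    rw [map_smul, faceDiff_normOp_succ (by omega) hj hx]

/-- Each cycle modulo degenerate cubes is congruent to a cycle. -/
theorem exists_cycle_of_boundary_mem {n : ℕ} {x : FreeChains X} (hx : x ∈ degreePart X n)
    (h : freeBoundary X x ∈ degenerate X) :
    ∃ y ∈ degreePart X n, freeBoundary X y = 0 ∧ y - x ∈ degenerate X := by
  refine ⟨normalize x, ?_, ?_, ?_⟩
  · rw [normalize_of_mem hx]
    exact normOp_mem n hx
  · rw [boundary_normalize hx, normalize_degenerate h]
  · rw [normalize_of_mem hx]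
    exact normOp_sub_mem le_rfl hx

end Normalization

/-! ### The class of constant loops comes from Hochschild homology -/

section Conclusion

variable {Q : Type u} [TopologicalSpace Q]

/-- For a path-connected space, the image of the homology in the homology of the free loop space
lies in the image of the Hochschild homology. -/
theorem mapToSquare_constLoop_mem_range [PathConnectedSpace Q] (q : Q) {n : ℕ}
    (c : CubicalHomology Q n) :
    mapToSquare (constLoop Q) n c ∈ LinearMap.range (goodwillieMap q n) := by
  obtain ⟨⟨_, ⟨x, hx, rfl⟩, hb⟩, rfl⟩ := Submodule.mkQ_surjective _ c
  have hb : (degenerate Q).mkQ (freeBoundary Q x) = 0 := hb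
  rw [Submodule.mkQ_apply, Submodule.Quotient.mk_eq_zero] at hb
  -- A cycle in the free chains is needed, since the maps below are not defined modulo degenerate
  -- cubes.
  obtain ⟨z, hz, hbz, hzx⟩ := exists_cycle_of_boundary_mem hx hb
  let p : ∀ y : Q, Path y q := fun y => PathConnectedSpace.somePath y q
  let d := vertexRetraction p
  have hxz : (relations (FreeLoop Q)).mkQ (push (constLoop Q) x) =
      (relations (FreeLoop Q)).mkQ (push (constLoop Q) z) := by
    rw [eq_comm, ← sub_eq_zero, ← map_sub, ← map_sub, Submodule.mkQ_apply,
      Submodule.Quotient.mk_eq_zero]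
    exact (le_sup_left : degenerate _ ≤ relations _) (degenerate_push hzx)
  -- The Hochschild class is that of the words of the retracted cycle.
  refine ⟨Submodule.Quotient.mk ⟨(degenerateWords q).mkQ (d.toWords z),
    ⟨d.toWords z, d.toWords_mem hz, rfl⟩, ?_⟩, ?_⟩
  · change (degenerateWords q).mkQ (freeWordBoundary q (d.toWords z)) = 0
    rw [d.boundary_toWords, hbz, map_zero, map_zero]
  -- Two homotopies are added: from 𝒢 ∘ W to the constant loops of the retracted cycle, and from
  -- these to the constant loops of z. The factor (-1)^n undoes the sign in `boundary_deformChain`.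
  · refine (Submodule.Quotient.eq _).2 ⟨(relations (FreeLoop Q)).mkQ
      (d.homotopy z + (-1 : ℤ) ^ n • push (constLoop Q) (deformChain p z)),
      ⟨_, add_mem (d.homotopy_mem hz) (Submodule.smul_mem _ _
        (mapChain_degreePart (constLoop Q) (deformChain_mem p hz))), rfl⟩, ?_⟩
    change (relations (FreeLoop Q)).mkQ (freeBoundary _ (d.homotopy z +
        (-1 : ℤ) ^ n • push (constLoop Q) (deformChain p z))) =
      (relations (FreeLoop Q)).mkQ (freeGoodwillie q (d.toWords z)) -
        (relations (FreeLoop Q)).mkQ (push (constLoop Q) x)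
    -- As z is a cycle, only the two ends of the deformation contribute.
    have h1 : freeBoundary _ (push (constLoop Q) (deformChain p z)) =
        push (constLoop Q) ((-1 : ℤ) ^ n • (d.onChains z - z)) := by
      rw [← zero_add ((-1 : ℤ) ^ n • (d.onChains z - z)), ← map_zero (deformChain p), ← hbz,
        ← boundary_deformChain p hz]
      exact (LinearMap.congr_fun (push_boundary (constLoop Q)) (deformChain p z)).symm
    rw [hxz, map_add, map_add, d.mkQ_boundary_homotopy, hbz, map_zero, map_zero, map_smul, map_smul,
      h1, map_smul, map_smul, smul_smul, ← pow_add, Even.neg_one_pow ⟨n, rfl⟩, one_smul, map_sub,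
      map_sub]
    abel

end Conclusion

end

end LoopHochschild

/-- Let `Q` be a closed connected smooth `n`-manifold with fundamental class `c = [Q]` (so that `Q`
is oriented) and let `q` be a point of `Q`. The image of `[Q]` under the inclusion of constant loops
in the free loop space lies in the image of `H(𝒢)`. -/
theorem lemmaB1 {n : ℕ} {Q : Type*} [TopologicalSpace Q] [T2Space Q] [CompactSpace Q]
    [ConnectedSpace Q] [ChartedSpace (EuclideanSpace ℝ (Fin n)) Q] [IsManifold (𝓡 n) ∞ Q]
    (q : Q) (c : LoopHochschild.CubicalHomology Q n) (hc : LoopHochschild.IsFundamentalClass c) :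
    LoopHochschild.mapToSquare (LoopHochschild.constLoop Q) n c ∈
      LinearMap.range (LoopHochschild.goodwillieMap q n) := by
  have := ChartedSpace.locallyPathConnectedSpace (EuclideanSpace ℝ (Fin n)) Q
  have : PathConnectedSpace Q := pathConnectedSpace_iff_connectedSpace.2 inferInstance
  exact LoopHochschild.mapToSquare_constLoop_mem_range q c
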